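/- **Setting.** Fix $d\in\mathbb N$ and $T>0$. Let $\Omega=\{\omega\in C([0,T];\mathbb R^d):\omega_0=0\}$, let $B_t(\omega)=\omega_t$ be the canonical process, $\mathcal F^\circ_t=\sigma(B_s,\,s\le t)$ the raw filtration $\mathbb F^\circ=(\mathcal F^\circ_t)_{0\le t\le T}$, and $P_0$ the Wiener measure on $(\Omega,\mathcal F^\circ_T)$. Let $\mathcal P_S$ be the set of all laws $P^\alpha=P_0\circ (X^\alpha)^{-1}$ of Itô integrals $X^\alpha_t=\int_0^t\alpha_s^{1/2}\,dB_s$, $t\in[0,T]$, under $P_0$, where $\alpha$ ranges over the $\mathbb F^\circ$-progressively measurable processes with values in the strictly positive definite symmetric $d\times d$ matrices such that $\int_0^T|\alpha_t|\,dt<\infty$ $P_0$-a.s. Let $\mathcal P\subseteq\mathcal P_S$ be nonempty. Let $L^1_{\mathcal P}$ be the space of $\mathcal F^\circ_T$-measurable random variables $X$ with $\sup_{P\in\mathcal P}E^P[|X|]<\infty$ (taken up to equality outside sets that are $P$-null for all $P\in\mathcal P$), and let $\mathcal H\subseteq L^1_{\mathcal P}$ be a nonempty subset. Let $\mathcal T$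 be the set of $\mathbb F^\circ$-stopping times with finitely many values in $[0,T]$. For $\mathcal A\subseteq\mathcal F^\circ_T$ and $P\in\mathcal P$ put $\mathcal P(\mathcal A,P)=\{P'\in\mathcal P: P'=P\text{ on }\mathcal A\}$. Essential suprema and conditional expectations may take extended real values. * $\mathcal P$ is *time-consistent on* a set $\mathcal K\subseteq L^1_{\mathcal P}$ if for all $P\in\mathcal P$, $X\in\mathcal K$ and $\sigma\le\tau$ in $\mathcal T$, $$\operatorname*{ess\,sup}^{P}_{P'\in\mathcal P(\mathcal F^\circ_\sigma,P)}E^{P'}\Big[\operatorname*{ess\,sup}^{P'}_{P''\in\mathcal P(\mathcal F^\circ_\tau,P')}E^{P''}[X|\mathcal F^\circ_\tau]\,\Big|\,\mathcal F^\circ_\sigma\Big]=\operatorname*{ess\,sup}^{P}_{P'\in\mathcal P(\mathcal F^\circ_\sigma,P)}E^{P'}[X|\mathcal F^\circ_\sigma]\quad P\text{-a.s.}$$ * $\mathcal P$ is *stable under pasting* if for all $P\in\mathcal P$, $\tau\in\mathcal T$, $\Lambda\in\mathcal F^\circ_\tau$ and $P_1,P_2\in\mathcal P(\mathcal F^\circ_\tau,P)$,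 the measure $$\bar P(A)=E^P\big[P_1(A|\mathcal F^\circ_\tau)\mathbf 1_\Lambda+P_2(A|\mathcal F^\circ_\tau)\mathbf 1_{\Lambda^c}\big],\qquad A\in\mathcal F^\circ_T,$$ is again an element of $\mathcal P$. * $\mathcal P$ is *maximally chosen for* $\mathcal H$ if $\mathcal P$ contains every $P\in\mathcal P_S$ such that every $X\in\mathcal H$ is $P$-integrable with $E^P[X]\le\sup_{P'\in\mathcal P}E^{P'}[X]$. **Proposition.** 1. If $\mathcal P$ is stable under pasting, then $\mathcal P$ is time-consistent on $L^1_{\mathcal P}$. 2. If $\mathcal P$ is time-consistent on $\mathcal H$ and maximally chosen for $\mathcal H$, then $\mathcal P$ is stable under pasting. -/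

import Mathlib

open MeasureTheory ProbabilityTheory Filter Topology
open scoped ENNReal NNReal

noncomputable section

namespace StrongVolatility

/-! ### Canonical space, canonical process, raw filtration -/

/-- The set of continuous paths `[0,T] → ℝ^d` that start at the origin. -/
def PathSpace (d : ℕ) (T : ℝ) : Type :=
  {ω : C(Set.Icc (0 : ℝ) T, EuclideanSpace ℝ (Fin d)) //
    ∀ t : Set.Icc (0 : ℝ) T, (t : ℝ) = 0 → ω t = 0}

variable {d : ℕ} {T : ℝ}

/-- The canonical process `B_t(ω) = ω_t`. -/
def canon (t : Set.Icc (0 : ℝ) T) (ω : PathSpace d T) : EuclideanSpace ℝ (Fin d) := ω.1 t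

/-- The σ-algebra `F°_T` generated by the canonical process. -/
instance PathSpace.instMeasurableSpace : MeasurableSpace (PathSpace d T) :=
  ⨆ t : Set.Icc (0 : ℝ) T, MeasurableSpace.comap (canon t) inferInstance

/-- Measures on `F°_T`. -/
abbrev PathMeasure (d : ℕ) (T : ℝ) : Type := Measure (PathSpace d T)

/-- The raw filtration `F°_t = σ(B_s, s ≤ t)`. -/
def rawFiltration (d : ℕ) (T : ℝ) :
    Filtration (Set.Icc (0 : ℝ) T) (PathSpace.instMeasurableSpace (d := d) (T := T)) where
  seq t := ⨆ s ≤ t, MeasurableSpace.comap (canon s) inferInstance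
  mono' _ _ hst := biSup_mono fun _ => ge_trans hst
  le' _ := iSup₂_le fun s _ =>
    le_iSup (fun s : Set.Icc (0 : ℝ) T =>
      MeasurableSpace.comap (canon (d := d) s) inferInstance) s

/-- `P₀` is the Wiener measure: under the probability measure `P₀` the increment `B_t - B_s` is
independent of `F°_s` and centred Gaussian with covariance matrix `(t - s) I`, for `s ≤ t`. -/
structure IsWienerMeasure (P₀ : Measure (PathSpace d T)) : Prop where
  isProbabilityMeasure : IsProbabilityMeasure P₀
  indep : ∀ s t : Set.Icc (0 : ℝ) T, s ≤ t →
    Indep (MeasurableSpace.comap (fun ω : PathSpace d T => canon t ω - canon s ω) inferInstance)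
      (rawFiltration d T s) P₀
  law : ∀ s t : Set.Icc (0 : ℝ) T, s ≤ t →
    P₀.map (fun ω : PathSpace d T => canon t ω - canon s ω) =
      multivariateGaussian 0 (((t : ℝ) - (s : ℝ)) • (1 : Matrix (Fin d) (Fin d) ℝ))

/-! ### The Itô integral with respect to the canonical process -/

/-- Lebesgue measure on `[0,T]`. -/
def timeMeasure (T : ℝ) : Measure (Set.Icc (0 : ℝ) T) :=
  (volume : Measure ℝ).comap Subtype.val

/-- The squared Frobenius norm of a matrix. -/
def frobSq (A : Matrix (Fin d) (Fin d) ℝ) : ℝ := ∑ i, ∑ j, A i j ^ 2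

/-- A bounded simple integrand `∑_{k < n} ξ_k 1_{(t_k, t_{k+1}]}` with `ξ_k` measurable for
`F°_{t_k}`. -/
structure SimpleIntegrand (d : ℕ) (T : ℝ) where
  n : ℕ
  time : ℕ → Set.Icc (0 : ℝ) T
  monotone_time : Monotone time
  coeff : ℕ → PathSpace d T → Matrix (Fin d) (Fin d) ℝ
  measurable_coeff : ∀ k i j, Measurable[rawFiltration d T (time k)] fun ω => coeff k ω i j
  bounded_coeff : ∃ C : ℝ, ∀ k ω i j, |coeff k ω i j| ≤ C

/-- The value at time `t` of a simple integrand. -/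
def SimpleIntegrand.val (S : SimpleIntegrand d T) (t : Set.Icc (0 : ℝ) T) (ω : PathSpace d T) :
    Matrix (Fin d) (Fin d) ℝ :=
  ∑ k ∈ Finset.range S.n, if S.time k < t ∧ t ≤ S.time (k + 1) then S.coeff k ω else 0

/-- The elementary integral `∑_{k < n} ξ_k (B_{t_{k+1} ∧ t} - B_{t_k ∧ t})`. -/
def SimpleIntegrand.integral (S : SimpleIntegrand d T) (t : Set.Icc (0 : ℝ) T)
    (ω : PathSpace d T) : EuclideanSpace ℝ (Fin d) :=
  ∑ k ∈ Finset.range S.n, Matrix.toEuclideanLin (S.coeff k ω)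
    (canon (min (S.time (k + 1)) t) ω - canon (min (S.time k) t) ω)

/-- The continuous process `X` is (a version of) the Itô integral `∫ H dB` under `P₀`: there are
bounded simple integrands `S_n` such that `∫_0^T |S_n - H|² dt → 0` in `P₀`-probability and
`sup_t |∫_0^t S_n dB - X_t| → 0` in `P₀`-probability. -/
def IsItoIntegral (P₀ : Measure (PathSpace d T))
    (H : Set.Icc (0 : ℝ) T → PathSpace d T → Matrix (Fin d) (Fin d) ℝ)
    (X : PathSpace d T → PathSpace d T) : Prop :=
  ∃ S : ℕ → SimpleIntegrand d T,
    (∀ ε : ℝ≥0∞, 0 < ε → Tendsto (fun n => P₀ {ω | ε ≤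
      ∫⁻ t, ENNReal.ofReal (frobSq ((S n).val t ω - H t ω)) ∂(timeMeasure T)}) atTop (𝓝 0)) ∧
    (∀ ε : ℝ≥0∞, 0 < ε → Tendsto (fun n => P₀ {ω | ε ≤
      ⨆ t : Set.Icc (0 : ℝ) T, edist ((S n).integral t ω) (canon t (X ω))}) atTop (𝓝 0))

open scoped MatrixOrder in
/-- The positive semidefinite square root of a positive semidefinite matrix. -/
def matrixSqrt (A : Matrix (Fin d) (Fin d) ℝ) : Matrix (Fin d) (Fin d) ℝ := CFC.sqrt A

/-- The set `P_S` of the laws `P₀ ∘ (X^α)⁻¹` of `X^α = ∫ α^{1/2} dB`, where `α` ranges over the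
`F°`-progressively measurable processes with values in the positive definite matrices and with
`∫_0^T |α_t| dt < ∞` almost surely under `P₀`. -/
def strongLaws (P₀ : Measure (PathSpace d T)) : Set (Measure (PathSpace d T)) :=
  {P | ∃ (α : Set.Icc (0 : ℝ) T → PathSpace d T → Matrix (Fin d) (Fin d) ℝ)
      (X : PathSpace d T → PathSpace d T),
    IsStronglyProgressive (rawFiltration d T) α ∧
    (∀ t ω, (α t ω).PosDef) ∧
    (∀ᵐ ω ∂P₀, ∫⁻ t, ENNReal.ofReal (Real.sqrt (frobSq (α t ω))) ∂(timeMeasure T) < ∞) ∧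
    Measurable X ∧
    IsItoIntegral P₀ (fun t ω => matrixSqrt (α t ω)) X ∧
    P = P₀.map X}

/-! ### Stopping times with finitely many values -/

/-- The `F°`-stopping times with finitely many values in `[0,T]`. -/
structure FiniteStoppingTime (d : ℕ) (T : ℝ) where
  toFun : PathSpace d T → Set.Icc (0 : ℝ) T
  isStoppingTime : IsStoppingTime (rawFiltration d T)
    fun ω => (toFun ω : WithTop (Set.Icc (0 : ℝ) T))
  finite_range : (Set.range toFun).Finite

/-- The σ-algebra `F°_τ`. -/
@[reducible]
def FiniteStoppingTime.sigma (τ : FiniteStoppingTime d T) : MeasurableSpace (PathSpace d T) :=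
  τ.isStoppingTime.measurableSpace

/-! ### Essential suprema and extended conditional expectations -/

section EssSup

variable {Ω ι : Type*} [MeasurableSpace Ω]

/-- `g` is an essential supremum under `μ` of the family `(f i)_{i ∈ S}` of extended real
functions. -/
def IsEssSup (μ : Measure Ω) (S : Set ι) (f : ι → Ω → EReal) (g : Ω → EReal) : Prop :=
  Measurable g ∧ (∀ i ∈ S, f i ≤ᵐ[μ] g) ∧
    ∀ h : Ω → EReal, Measurable h → (∀ i ∈ S, f i ≤ᵐ[μ] h) → g ≤ᵐ[μ] h

theorem exists_isEssSup (μ : Measure Ω) [IsFiniteMeasure μ] (S : Set ι) (f : ι → Ω → EReal)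
    (hf : ∀ i ∈ S, Measurable (f i)) : ∃ g, IsEssSup μ S f g := by
  let φ : EReal → ℝ≥0∞ := fun x => (1 + EReal.exp (-x))⁻¹
  have hφ : StrictMono φ := by
    intro x y hxy
    refine ENNReal.inv_lt_inv.2 ?_
    refine ENNReal.add_lt_add_left (by simp) ?_
    exact EReal.exp_strictMono (EReal.neg_lt_neg_iff.2 hxy)
  have hφm : Measurable φ := hφ.monotone.measurable
  have hφ1 : ∀ x, φ x ≤ 1 := fun x => ENNReal.inv_le_one.2 le_self_add
  let V : Set ℝ≥0∞ :=
    {v | ∃ C : Set ι, C.Countable ∧ C ⊆ S ∧ v = ∫⁻ ω, φ (⨆ i ∈ C, f i ω) ∂μ}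
  have hV : V.Nonempty := ⟨∫⁻ ω, φ (⨆ i ∈ (∅ : Set ι), f i ω) ∂μ, ∅, Set.countable_empty,
    Set.empty_subset _, rfl⟩
  obtain ⟨u, -, hu, huV⟩ : ∃ u : ℕ → ℝ≥0∞, Monotone u ∧ Tendsto u atTop (𝓝 (sSup V)) ∧
      ∀ n, u n ∈ V := exists_seq_tendsto_sSup hV (OrderTop.bddAbove V)
  choose C hC hCS hCu using huV
  let D : Set ι := ⋃ n, C n
  have hD : D.Countable := Set.countable_iUnion hC
  have hDS : D ⊆ S := Set.iUnion_subset hCS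
  have hmeas : ∀ E : Set ι, E.Countable → E ⊆ S → Measurable fun ω => ⨆ i ∈ E, f i ω :=
    fun E hE hES => Measurable.biSup E hE fun i hi => hf i (hES hi)
  have hmax : sSup V ≤ ∫⁻ ω, φ (⨆ i ∈ D, f i ω) ∂μ := by
    refine le_of_tendsto' hu fun n => ?_
    rw [hCu n]
    refine lintegral_mono fun ω => hφ.monotone ?_
    exact biSup_mono fun i hi => Set.mem_iUnion_of_mem n hi
  refine ⟨fun ω => ⨆ i ∈ D, f i ω, hmeas D hD hDS, fun i hi => ?_, fun h _ hh => ?_⟩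
  · have hle : ∫⁻ ω, φ (⨆ j ∈ insert i D, f j ω) ∂μ ≤ ∫⁻ ω, φ (⨆ j ∈ D, f j ω) ∂μ :=
      le_trans (le_sSup (show _ ∈ V from
        ⟨insert i D, hD.insert i, Set.insert_subset hi hDS, rfl⟩)) hmax
    have hfin : ∫⁻ ω, φ (⨆ j ∈ D, f j ω) ∂μ ≠ ∞ := by
      refine ne_top_of_le_ne_top (measure_ne_top μ Set.univ) ?_
      calc ∫⁻ ω, φ (⨆ j ∈ D, f j ω) ∂μ ≤ ∫⁻ _, 1 ∂μ := lintegral_mono fun ω => hφ1 _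
        _ = μ Set.univ := by simp
    have hae := ae_eq_of_ae_le_of_lintegral_le (μ := μ)
      (f := fun ω => φ (⨆ j ∈ D, f j ω)) (g := fun ω => φ (⨆ j ∈ insert i D, f j ω))
      (Eventually.of_forall fun ω => hφ.monotone
        (biSup_mono fun j hj => Set.mem_insert_of_mem i hj)) hfin
      (hφm.comp (hmeas _ (hD.insert i) (Set.insert_subset hi hDS))).aemeasurable hle
    filter_upwards [hae] with ω hω
    have h1 := hφ.injective hω
    rw [h1]
    exact le_iSup₂_of_le i (Set.mem_insert i D) le_rfl
  · have := (ae_ball_iff hD).2 fun i hi => hh i (hDS hi)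
    filter_upwards [this] with ω hω
    exact iSup₂_le hω

open scoped Classical in
/-- The essential supremum `ess sup^μ_{i ∈ S} f i` of a family of extended random variables. It
exists for measurable families, and is unique up to `μ`-null sets. -/
def familyEssSup (μ : Measure Ω) (S : Set ι) (f : ι → Ω → EReal) : Ω → EReal :=
  if h : ∃ g, IsEssSup μ S f g then h.choose else fun _ => ⊤

theorem isEssSup_familyEssSup (μ : Measure Ω) [IsFiniteMeasure μ] (S : Set ι)
    (f : ι → Ω → EReal) (hf : ∀ i ∈ S, Measurable (f i)) :
    IsEssSup μ S f (familyEssSup μ S f) := by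
  have h := exists_isEssSup μ S f hf
  rw [familyEssSup, dif_pos h]
  exact h.choose_spec

/-- The conditional expectation `E^μ[Y⁺ | m] - E^μ[Y⁻ | m]` of an extended random variable, with
values in the extended reals; `Y⁻` is meant to be `μ`-integrable. -/
def extCondExp (μ : Measure Ω) (m : MeasurableSpace Ω) (Y : Ω → EReal) : Ω → EReal := fun ω =>
  ((condLExp m μ (fun ω' => (Y ω').toENNReal) ω : ℝ≥0∞) : EReal) -
    ((condLExp m μ (fun ω' => (-Y ω').toENNReal) ω : ℝ≥0∞) : EReal)

end EssSup

/-! ### Time consistency, pasting, maximality -/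

/-- `P(m, P) = {P' ∈ Ps : P' = P on m}`. -/
def agreeing (Ps : Set (PathMeasure d T)) (P : PathMeasure d T)
    (m : MeasurableSpace (PathSpace d T)) : Set (PathMeasure d T) :=
  {P' ∈ Ps | ∀ A, MeasurableSet[m] A → P' A = P A}

/-- The (representatives of elements of the) space `L^1_Ps`: the `F°_T`-measurable random
variables `X` with `sup_{P ∈ Ps} E^P[|X|] < ∞`. -/
def quasiSureL1 (Ps : Set (PathMeasure d T)) : Set (PathSpace d T → ℝ) :=
  {X | Measurable X ∧ (⨆ P ∈ Ps, ∫⁻ ω, ‖X ω‖ₑ ∂P) < ∞}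

/-- `Ps` is time-consistent on `H`. The inner essential supremum is bounded below by the integrable
variable `E^{P'}[X | F°_τ]`, so that its conditional expectation makes sense. -/
def IsTimeConsistentOn (Ps : Set (PathMeasure d T)) (H : Set (PathSpace d T → ℝ)) : Prop :=
  ∀ P ∈ Ps, ∀ X ∈ H, ∀ σ τ : FiniteStoppingTime d T, (∀ ω, σ.toFun ω ≤ τ.toFun ω) →
    familyEssSup P (agreeing Ps P σ.sigma) (fun P' : PathMeasure d T =>
        extCondExp P' σ.sigma
          (familyEssSup P' (agreeing Ps P' τ.sigma) fun (P'' : PathMeasure d T) ω =>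
            ((condExp τ.sigma P'' X ω : ℝ) : EReal)))
      =ᵐ[P]
    familyEssSup P (agreeing Ps P σ.sigma) (fun (P' : PathMeasure d T) ω =>
        ((condExp σ.sigma P' X ω : ℝ) : EReal))

/-- `Ps` is stable under pasting: for `P ∈ Ps`, a stopping time `τ`, `Λ ∈ F°_τ` and
`P₁, P₂ ∈ Ps(F°_τ, P)`, the measure
`A ↦ E^P[P₁(A | F°_τ) 1_Λ + P₂(A | F°_τ) 1_{Λᶜ}]` is an element of `Ps`. -/
def IsStableUnderPasting (Ps : Set (PathMeasure d T)) : Prop :=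
  ∀ P ∈ Ps, ∀ τ : FiniteStoppingTime d T, ∀ Λ, MeasurableSet[τ.sigma] Λ →
    ∀ P₁ ∈ agreeing Ps P τ.sigma, ∀ P₂ ∈ agreeing Ps P τ.sigma,
      ∃ Pbar ∈ Ps, ∀ A, MeasurableSet A →
        Pbar A = ENNReal.ofReal (∫ ω,
          (Λ.indicator (condExp τ.sigma P₁ (A.indicator fun _ => (1 : ℝ))) ω +
            Λᶜ.indicator (condExp τ.sigma P₂ (A.indicator fun _ => (1 : ℝ))) ω) ∂P)

/-- `Ps` is maximally chosen for `H`: it contains every `P ∈ P_S` under which all `X ∈ H` are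
integrable with `E^P[X] ≤ sup_{P' ∈ Ps} E^{P'}[X]`. -/
def IsMaximallyChosen (P₀ : PathMeasure d T) (Ps : Set (PathMeasure d T))
    (H : Set (PathSpace d T → ℝ)) : Prop :=
  ∀ P ∈ strongLaws P₀,
    (∀ X ∈ H, Integrable X P ∧
      ((∫ ω, X ω ∂P : ℝ) : EReal) ≤ ⨆ P' ∈ Ps, ((∫ ω, X ω ∂P' : ℝ) : EReal)) →
    P ∈ Ps

end StrongVolatility

end

/-! Stability implies time consistency. Pasting two competitors on the event where the first has the
larger conditional expectation given `F°_τ` realizes the maximum of both, so the inner family is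
upward directed (`agreeing_directed`). Its essential supremum is therefore an increasing limit of
conditional expectations under measures of the family. Conditional monotone convergence and the
tower property give one inequality. The other follows because `P'` is itself a competitor in its
inner problem.

Time consistency and maximality imply stability. At `σ = 0` the σ-algebra is trivial, and time
consistency becomes a statement about suprema of expectations. The conditional expectation of `X`
under the pasted law lies below the inner essential supremum, so the expectation of `X` under the
pasted law is at most the supremum over `Ps` (`integral_paste_le_iSup`). By maximality it remains to
show that the pasted law lies in `P_S`, and that is the bulk of the proof.

Let `P₁`, `P₂` be the laws of `X₁ = ∫ α₁^{1/2} dB` and `X₂ = ∫ α₂^{1/2} dB`, equal on `F°_τ`. The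
natural candidate follows `α₁` up to `τ` and then, on the event `X₁ ∉ Λ`, switches to `α₂`. This
works if `X₁ = X₂` up to `τ` almost surely (`IsStrongSolution.ae_agreeUpTo`), so that the two
integrals fit together.

To see this, one recovers the driver from the integral. The realized covariation of `X` determines
`∫ α dt`, its difference quotients determine `α`, and since `α` is invertible, `B = ∫ α^{-1/2} dX`
(`ItoApprox.exists_measurable_driver`). All steps are non-anticipating. To have one functional for
both solutions, the argument runs on the disjoint union of two copies of the path space, where `X₁`
and `X₂` form a single Itô integral. An event of `X₁` up to `t` is then an event of `B`, which is an
event `D'` of `X₁` and, with the same `D'`, of `X₂`. Equality of the laws on `F°_τ` transfers the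
null sets and forces the paths to agree.

The filtration is raw, so null sets cannot be added to it. Each step instead produces a version that
is measurable in the raw filtration. The analytic tool is a Lenglart type inequality for elementary
integrals, from which every limit is taken in probability. -/

noncomputable section

namespace StrongVolatility

/-! ### Extended conditional expectations and change of measure -/

section

section CondExp

variable {Ω : Type*} {m m₀ : MeasurableSpace Ω} {μ ν : Measure[m₀] Ω}

/-- The σ-algebra is a variable here, so that the events obtained lie in `τ.sigma` and not merely in
`F°_T`. -/
theorem measurableSet_setOf_le {α : Type*} [TopologicalSpace α] [MeasurableSpace α]
    [OpensMeasurableSpace α] [LinearOrder α] [OrderClosedTopology α] [SecondCountableTopology α]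
    {f g : Ω → α} (hf : Measurable[m] f) (hg : Measurable[m] g) :
    MeasurableSet[m] {ω | f ω ≤ g ω} :=
  measurableSet_le hf hg

theorem measurableSet_setOf_eq {f g : Ω → ℝ} (hf : Measurable[m] f) (hg : Measurable[m] g) :
    MeasurableSet[m] {ω | f ω = g ω} :=
  measurableSet_eq_fun hf hg

theorem measurable_iSup_nat {f : ℕ → Ω → EReal} (hf : ∀ n, Measurable[m] (f n)) :
    Measurable[m] fun ω => ⨆ n, f n ω :=
  Measurable.iSup hf

/-- After integration over sets of `m` this is the ordinary monotone convergence theorem, used once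
on each side. -/
theorem condLExp_iSup_of_monotone [IsFiniteMeasure μ] (hm : m ≤ m₀) {X : ℕ → Ω → ℝ≥0∞}
    (hX : ∀ n, AEMeasurable[m₀] (X n) μ) (hmono : ∀ n, X n ≤ᵐ[μ] X (n + 1)) :
    (fun ω => ⨆ n, condLExp m μ (X n) ω) =ᵐ[μ] condLExp m μ (fun ω => ⨆ n, X n ω) := by
  refine ae_eq_condLExp hm _ _ (Measurable.iSup fun n => measurable_condLExp _ _ _) ?_
  intro s hs
  have hmono' : ∀ᵐ ω ∂μ, Monotone fun n => X n ω := by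
    filter_upwards [ae_all_iff.2 hmono] with ω hω using monotone_nat_of_le_succ hω
  have hmono'' : ∀ᵐ ω ∂μ, Monotone fun n => condLExp m μ (X n) ω := by
    filter_upwards [ae_all_iff.2 fun n => condLExp_mono (mΩ := m) (hmono n)] with ω hω
      using monotone_nat_of_le_succ hω
  rw [lintegral_iSup' (fun n => (measurable_condLExp' _ _ _).aemeasurable)
    (ae_restrict_of_ae hmono''),
    lintegral_iSup' (fun n => (hX n).restrict) (ae_restrict_of_ae hmono')]
  simp_rw [setLIntegral_condLExp hm _ _ hs]

theorem measurable_extCondExp [IsFiniteMeasure μ] (Y : Ω → EReal) :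
    Measurable[m] (@extCondExp Ω m₀ μ m Y) := by
  unfold extCondExp
  have h1 := measurable_condLExp m μ (fun ω' => (Y ω').toENNReal)
  have h2 := measurable_condLExp m μ (fun ω' => (-Y ω').toENNReal)
  exact h1.coe_ereal_ennreal.sub h2.coe_ereal_ennreal

theorem condExp_eq_toReal_sub_toReal [IsFiniteMeasure μ] {g : Ω → ℝ} (hg : Integrable g μ) :
    μ[g|m] =ᵐ[μ] fun ω => (condLExp m μ (fun ω => ENNReal.ofReal (g ω)) ω).toReal -
      (condLExp m μ (fun ω => ENNReal.ofReal (-g ω)) ω).toReal := by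
  have h1 := toReal_condLExp m (μ := μ) (f := fun ω => ENNReal.ofReal (g ω))
    hg.1.aemeasurable.ennreal_ofReal hg.lintegral_lt_top.ne
  have h2 := toReal_condLExp m (μ := μ) (f := fun ω => ENNReal.ofReal (-g ω))
    hg.1.aemeasurable.neg.ennreal_ofReal hg.neg.lintegral_lt_top.ne
  have h3 : μ[g|m] =ᵐ[μ] μ[(fun ω => (ENNReal.ofReal (g ω)).toReal)
      - (fun ω => (ENNReal.ofReal (-g ω)).toReal)|m] := by
    refine condExp_congr_ae (ae_of_all _ fun ω => ?_)
    simp only [Pi.sub_apply, ENNReal.toReal_ofReal']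
    rcases le_total 0 (g ω) with h | h <;> simp [h]
  have h4 := condExp_sub (μ := μ) (m := m) (f := fun ω => (ENNReal.ofReal (g ω)).toReal)
    (g := fun ω => (ENNReal.ofReal (-g ω)).toReal)
    (by simpa only [ENNReal.toReal_ofReal'] using hg.pos_part)
    (by simpa only [ENNReal.toReal_ofReal'] using hg.neg_part)
  filter_upwards [h1, h2, h3, h4] with ω h1 h2 h3 h4
  rw [h3, h4, Pi.sub_apply, ← h1, ← h2]

/-- Splitting off an integrable minorant leaves a nonnegative variable, whose conditional
expectation is unambiguous. This rules out the form `∞ - ∞` in `extCondExp`. -/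
theorem extCondExp_eq_add_of_le [IsFiniteMeasure μ] {Y : Ω → EReal} {g : Ω → ℝ}
    (hY : Measurable Y) (hgm : Measurable g) (hg : Integrable g μ)
    (hle : ∀ᵐ ω ∂μ, (g ω : EReal) ≤ Y ω) :
    ∀ᵐ ω ∂μ, extCondExp μ m Y ω =
      (condLExp m μ (fun ω => (Y ω - g ω).toENNReal) ω : EReal) + ((μ[g|m] ω : ℝ) : EReal) := by
  set a : Ω → ℝ≥0∞ := fun ω => (Y ω).toENNReal
  set b : Ω → ℝ≥0∞ := fun ω => (-Y ω).toENNReal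
  set w : Ω → ℝ≥0∞ := fun ω => (Y ω - g ω).toENNReal
  set p : Ω → ℝ≥0∞ := fun ω => ENNReal.ofReal (g ω)
  set q : Ω → ℝ≥0∞ := fun ω => ENNReal.ofReal (-g ω)
  have hYg : Measurable fun ω => Y ω - (g ω : EReal) := hY.sub hgm.coe_real_ereal
  have ma : Measurable a := hY.ereal_toENNReal
  have mb : Measurable b := hY.neg.ereal_toENNReal
  have mw : Measurable w := hYg.ereal_toENNReal
  have mp : Measurable p := hgm.ennreal_ofReal
  have mq : Measurable q := hgm.neg.ennreal_ofReal
  have hbq : b ≤ᵐ[μ] q := by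
    filter_upwards [hle] with ω h
    have : (-Y ω).toENNReal ≤ (-(g ω : EReal)).toENNReal :=
      EReal.toENNReal_le_toENNReal (EReal.neg_le_neg_iff.2 h)
    simpa [b, q, ← EReal.coe_neg, EReal.toENNReal_of_ne_top] using this
  -- The identity `Y⁺ + g⁻ = (Y - g) + g⁺ + Y⁻` holds in `[0, ∞]` without any subtraction of
  -- infinite quantities. Its conditional expectation is solved for `Y⁺ - Y⁻` below.
  have hsum : a + q =ᵐ[μ] w + (p + b) := by
    filter_upwards [hle] with ω h
    simp only [Pi.add_apply, a, b, w, p, q]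
    induction hy : Y ω with
    | bot => simp [hy] at h
    | top => simp
    | coe y =>
      rw [hy] at h
      have h' : g ω ≤ y := by exact_mod_cast h
      rw [← EReal.coe_neg, ← EReal.coe_sub]
      simp only [EReal.toENNReal_of_ne_top (EReal.coe_ne_top _), EReal.toReal_coe]
      rw [← ENNReal.toReal_eq_toReal_iff' (by simp) (by simp),
        ENNReal.toReal_add (by simp) (by simp), ENNReal.toReal_add (by simp) (by simp),
        ENNReal.toReal_add (by simp) (by simp)]
      simp only [ENNReal.toReal_ofReal']
      rw [max_eq_left (sub_nonneg.2 h')]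
      have e1 : ∀ x : ℝ, max x 0 - max (-x) 0 = x := fun x => by
        rcases le_total 0 x with h | h <;> simp [h]
      linarith [e1 y, e1 (g ω)]
  have hS := condLExp_congr_ae (mΩ := m) hsum
  have h1 := condLExp_add_left (mΩ := m) (P := μ) q ma.aemeasurable
  have h2 := condLExp_add_left (mΩ := m) (P := μ) (p + b) mw.aemeasurable
  have h3 := condLExp_add_left (mΩ := m) (P := μ) b mp.aemeasurable
  have hpfin : ∫⁻ ω, p ω ∂μ ≠ ∞ := hg.lintegral_lt_top.ne
  have hqfin : ∫⁻ ω, q ω ∂μ ≠ ∞ := hg.neg.lintegral_lt_top.ne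
  have hbfin : ∫⁻ ω, b ω ∂μ ≠ ∞ := ne_top_of_le_ne_top hqfin (lintegral_mono_ae hbq)
  filter_upwards [hS, h1, h2, h3, condLExp_ne_top (mΩ := m) hpfin,
    condLExp_ne_top (mΩ := m) hqfin, condLExp_ne_top (mΩ := m) hbfin,
    condExp_eq_toReal_sub_toReal (m := m) hg] with ω hS h1 h2 h3 hp hq hb hc
  rw [hc]
  rw [h1, h2] at hS
  simp only [Pi.add_apply] at hS h3
  rw [h3] at hS
  change ((condLExp m μ a ω : ℝ≥0∞) : EReal) - ((condLExp m μ b ω : ℝ≥0∞) : EReal) =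
    ((condLExp m μ w ω : ℝ≥0∞) : EReal) + (((condLExp m μ p ω).toReal -
      (condLExp m μ q ω).toReal : ℝ) : EReal)
  revert hS hp hq hb
  generalize condLExp m μ a ω = A
  generalize condLExp m μ b ω = B
  generalize condLExp m μ w ω = W
  generalize condLExp m μ p ω = P
  generalize condLExp m μ q ω = Q
  intro hS hp hq hb
  lift P to ℝ≥0 using hp
  lift Q to ℝ≥0 using hq
  lift B to ℝ≥0 using hb
  -- The terms from `g` and from `Y⁻` are finite, so `A` and `W` are infinite together.
  induction A with
  | top =>
    have : W = ⊤ := by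
      by_contra hW
      lift W to ℝ≥0 using hW
      rw [top_add] at hS
      exact absurd hS.symm (by simp [← ENNReal.coe_add])
    subst this
    have e : ((B : ℝ≥0∞) : EReal) = ((B : ℝ) : EReal) := rfl
    rw [e, EReal.coe_ennreal_top, EReal.top_sub_coe, EReal.top_add_coe]
  | coe A =>
    have : W ≠ ⊤ := by
      rintro rfl
      rw [top_add] at hS
      exact absurd hS (by simp [← ENNReal.coe_add])
    lift W to ℝ≥0 using this
    have hS' : (A : ℝ) + Q = W + (P + B) := by exact_mod_cast hS
    have e : ∀ x : ℝ≥0, ((x : ℝ≥0∞) : EReal) = ((x : ℝ) : EReal) := fun _ => rfl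
    rw [e, e, e, ← EReal.coe_sub, ← EReal.coe_add]
    simp only [ENNReal.coe_toReal]
    congr 1
    linarith

theorem condExp_le_extCondExp [IsFiniteMeasure μ] {Y : Ω → EReal} {g : Ω → ℝ}
    (hY : Measurable Y) (hgm : Measurable g) (hg : Integrable g μ)
    (hle : ∀ᵐ ω ∂μ, (g ω : EReal) ≤ Y ω) :
    ∀ᵐ ω ∂μ, ((μ[g|m] ω : ℝ) : EReal) ≤ extCondExp μ m Y ω := by
  filter_upwards [extCondExp_eq_add_of_le (m := m) hY hgm hg hle] with ω h
  rw [h]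
  exact le_add_of_nonneg_left (EReal.coe_ennreal_nonneg _)

theorem extCondExp_congr_ae {Y Z : Ω → EReal} (h : Y =ᵐ[μ] Z) :
    extCondExp μ m Y =ᵐ[μ] extCondExp μ m Z := by
  have h1 := condLExp_congr_ae (mΩ := m)
    (show (fun ω => (Y ω).toENNReal) =ᵐ[μ] fun ω => (Z ω).toENNReal from
      h.mono fun ω hω => by simp only [hω])
  have h2 := condLExp_congr_ae (mΩ := m)
    (show (fun ω => (-Y ω).toENNReal) =ᵐ[μ] fun ω => (-Z ω).toENNReal from
      h.mono fun ω hω => by simp only [hω])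
  filter_upwards [h1, h2] with ω h1 h2
  simp only [extCondExp, h1, h2]

/-- Conditional monotone convergence for `f n - f 0`. Only the upper estimate is recorded, since a
common bound of all the conditional expectations passes to their limit. -/
theorem extCondExp_iSup_le [IsFiniteMeasure μ] (hm : m ≤ m₀) {f : ℕ → Ω → ℝ}
    (hfm : ∀ n, Measurable (f n)) (hf : ∀ n, Integrable (f n) μ)
    (hmono : ∀ n, f n ≤ᵐ[μ] f (n + 1)) {h : Ω → EReal}
    (hh : ∀ n, ∀ᵐ ω ∂μ, ((μ[f n|m] ω : ℝ) : EReal) ≤ h ω) :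
    ∀ᵐ ω ∂μ, extCondExp μ m (fun ω => ⨆ n, (f n ω : EReal)) ω ≤ h ω := by
  -- Subtraction of the finite `f 0` commutes with the supremum, also where the supremum is
  -- infinite.
  have hW : (fun ω => ⨆ n, ENNReal.ofReal (f n ω - f 0 ω)) =
      fun ω => ((⨆ n, (f n ω : EReal)) - f 0 ω).toENNReal := by
    funext ω
    refine le_antisymm (iSup_le fun n => ?_) ?_
    · have : ((f n ω : EReal) - f 0 ω).toENNReal ≤ ((⨆ n, (f n ω : EReal)) - f 0 ω).toENNReal :=
        EReal.toENNReal_le_toENNReal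
          (EReal.sub_le_sub (le_iSup (fun n => (f n ω : EReal)) n) le_rfl)
      rwa [← EReal.coe_sub, EReal.toENNReal_of_ne_top (EReal.coe_ne_top _),
        EReal.toReal_coe] at this
    · rw [← EReal.coe_ennreal_le_coe_ennreal_iff, EReal.coe_toENNReal]
      · refine EReal.sub_le_of_le_add (iSup_le fun n => ?_)
        have h1 : (f n ω : EReal) = ((f n ω - f 0 ω : ℝ) : EReal) + f 0 ω := by
          rw [← EReal.coe_add]; congr 1; ring
        rw [h1]
        gcongr
        refine le_trans ?_ (EReal.coe_ennreal_le_coe_ennreal_iff.2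
          (le_iSup (fun n => ENNReal.ofReal (f n ω - f 0 ω)) n))
        rw [EReal.coe_ennreal_ofReal]
        exact_mod_cast le_max_left _ _
      · rw [EReal.sub_nonneg (by simp) (by simp)]
        exact le_iSup (fun n => (f n ω : EReal)) 0
  have hmeas : Measurable fun ω => ⨆ n, (f n ω : EReal) :=
    Measurable.iSup fun n => (hfm n).coe_real_ereal
  have h1 := extCondExp_eq_add_of_le (m := m) hmeas (hfm 0) (hf 0)
    (ae_of_all _ fun ω => le_iSup (fun n => (f n ω : EReal)) 0)
  have h2 := condLExp_iSup_of_monotone (μ := μ) hm (X := fun n ω => ENNReal.ofReal (f n ω - f 0 ω))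
    (fun n => ((hfm n).sub (hfm 0)).ennreal_ofReal.aemeasurable) (fun n => by
      filter_upwards [hmono n] with ω hω
      exact ENNReal.ofReal_le_ofReal (by linarith))
  have hge : ∀ n, f 0 ≤ᵐ[μ] f n := fun n => by
    induction n with
    | zero => exact EventuallyLE.refl _ _
    | succ n ih => exact ih.trans (hmono n)
  have h3 : ∀ n, condLExp m μ (fun ω => ENNReal.ofReal (f n ω - f 0 ω)) =ᵐ[μ]
      fun ω => ENNReal.ofReal (μ[f n|m] ω - μ[f 0|m] ω) := fun n => by
    have e1 := condLExp_ofReal m (μ := μ) ((hf n).sub (hf 0)) (by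
      filter_upwards [hge n] with ω hω
      simpa using hω)
    filter_upwards [e1, condExp_sub (hf n) (hf 0) m] with ω e1 e2
    simp only [Pi.sub_apply] at e1 e2
    rw [e1, e2]
  filter_upwards [h1, h2, ae_all_iff.2 h3, ae_all_iff.2 hh] with ω h1 h2 h3 hh
  rw [h1, ← hW, ← h2]
  have hc0 : 0 ≤ h ω - ((μ[f 0|m] ω : ℝ) : EReal) := by
    rw [EReal.sub_nonneg (by simp) (by simp)]
    exact hh 0
  rw [← EReal.le_sub_iff_add_le (by simp) (by simp), ← EReal.coe_toENNReal hc0,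
    EReal.coe_ennreal_le_coe_ennreal_iff]
  refine iSup_le fun n => ?_
  rw [h3, ← EReal.coe_ennreal_le_coe_ennreal_iff, EReal.coe_toENNReal hc0,
    EReal.coe_ennreal_ofReal]
  have : ((max (μ[f n|m] ω - μ[f 0|m] ω) 0 : ℝ) : EReal) =
      max (((μ[f n|m] ω - μ[f 0|m] ω : ℝ)) : EReal) 0 := by
    exact_mod_cast EReal.coe_strictMono.monotone.map_max
  rw [this]
  refine max_le ?_ hc0
  rw [EReal.coe_sub]
  exact EReal.sub_le_sub (hh n) le_rfl

/-- Two measures in `agreeing` may be mutually singular on `F°_T`. Almost sure statements can be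
moved between them only for events of the common σ-algebra, and for this reason `m`-measurability is
tracked throughout. -/
theorem ae_iff_of_trim_eq (hm : m ≤ m₀) (h : μ.trim hm = ν.trim hm) {p : Ω → Prop}
    (hp : MeasurableSet[m] {ω | p ω}) : (∀ᵐ ω ∂μ, p ω) ↔ ∀ᵐ ω ∂ν, p ω := by
  rw [ae_iff, ae_iff]
  have hc : MeasurableSet[m] {ω | ¬ p ω} := hp.compl
  rw [← trim_measurableSet_eq hm hc, ← trim_measurableSet_eq hm hc, h]

theorem setIntegral_eq_of_trim_eq (hm : m ≤ m₀) (h : μ.trim hm = ν.trim hm) {g : Ω → ℝ}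
    (hg : StronglyMeasurable[m] g) {s : Set Ω} (hs : MeasurableSet[m] s) :
    ∫ ω in s, g ω ∂μ = ∫ ω in s, g ω ∂ν := by
  rw [setIntegral_trim hm hg hs, setIntegral_trim hm hg hs, h]

theorem integrable_iff_of_trim_eq (hm : m ≤ m₀) (h : μ.trim hm = ν.trim hm) {g : Ω → ℝ}
    (hg : StronglyMeasurable[m] g) : Integrable g μ ↔ Integrable g ν := by
  constructor <;> intro hi
  · exact integrable_of_integrable_trim hm (h ▸ hi.trim hm hg)
  · exact integrable_of_integrable_trim hm (h ▸ hi.trim hm hg)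

theorem condExp_ae_eq_of_trim_eq [IsFiniteMeasure μ] [IsFiniteMeasure ν] {m' : MeasurableSpace Ω}
    (hm : m ≤ m₀) (hm' : m' ≤ m) (h : μ.trim hm = ν.trim hm) {g : Ω → ℝ}
    (hg : StronglyMeasurable[m] g) (hgi : Integrable g μ) : μ[g|m'] =ᵐ[μ] ν[g|m'] := by
  have h' : μ.trim (hm'.trans hm) = ν.trim (hm'.trans hm) := by
    rw [← trim_trim (hm₁₂ := hm') (hm₂ := hm), h, trim_trim]
  have hgν : Integrable g ν := (integrable_iff_of_trim_eq hm h hg).1 hgi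
  refine (ae_eq_condExp_of_forall_setIntegral_eq (hm'.trans hm) hgi ?_ ?_ ?_).symm
  · intro s _ _
    exact ((integrable_iff_of_trim_eq (hm'.trans hm) h' stronglyMeasurable_condExp).2
      integrable_condExp).integrableOn
  · intro s hs _
    rw [setIntegral_eq_of_trim_eq (hm'.trans hm) h' stronglyMeasurable_condExp hs,
      setIntegral_condExp (hm'.trans hm) hgν hs, setIntegral_eq_of_trim_eq hm h hg (hm' s hs)]
  · exact stronglyMeasurable_condExp.aestronglyMeasurable

end CondExp

/-! ### Essential suprema as suprema of countable subfamilies -/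

section EssSup

variable {Ω ι : Type*} [MeasurableSpace Ω]

theorem IsEssSup.ae_eq {μ : Measure Ω} {S : Set ι} {f : ι → Ω → EReal} {g h : Ω → EReal}
    (hg : IsEssSup μ S f g) (hh : IsEssSup μ S f h) : g =ᵐ[μ] h :=
  (hg.2.2 h hh.1 hh.2.1).antisymm (hh.2.2 g hg.1 hg.2.1)

/-- Composition with a bounded strictly increasing `φ` makes all integrals finite. A countable
subfamily with maximal integral cannot be improved by one more member, so it dominates every member.
The index set `D` is kept because a sequence is extracted from it. -/
theorem exists_countable_isEssSup (μ : Measure Ω) [IsFiniteMeasure μ] (S : Set ι)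
    (f : ι → Ω → EReal) (hf : ∀ i ∈ S, Measurable (f i)) :
    ∃ D : Set ι, D.Countable ∧ D ⊆ S ∧ IsEssSup μ S f fun ω => ⨆ i ∈ D, f i ω := by
  let φ : EReal → ℝ≥0∞ := fun x => (1 + EReal.exp (-x))⁻¹
  have hφ : StrictMono φ := by
    intro x y hxy
    refine ENNReal.inv_lt_inv.2 ?_
    refine ENNReal.add_lt_add_left (by simp) ?_
    exact EReal.exp_strictMono (EReal.neg_lt_neg_iff.2 hxy)
  have hφm : Measurable φ := hφ.monotone.measurable
  have hφ1 : ∀ x, φ x ≤ 1 := fun x => ENNReal.inv_le_one.2 le_self_add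
  let V : Set ℝ≥0∞ :=
    {v | ∃ C : Set ι, C.Countable ∧ C ⊆ S ∧ v = ∫⁻ ω, φ (⨆ i ∈ C, f i ω) ∂μ}
  have hV : V.Nonempty := ⟨∫⁻ ω, φ (⨆ i ∈ (∅ : Set ι), f i ω) ∂μ, ∅, Set.countable_empty,
    Set.empty_subset _, rfl⟩
  obtain ⟨u, -, hu, huV⟩ : ∃ u : ℕ → ℝ≥0∞, Monotone u ∧ Tendsto u atTop (𝓝 (sSup V)) ∧
      ∀ n, u n ∈ V := exists_seq_tendsto_sSup hV (OrderTop.bddAbove V)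
  choose C hC hCS hCu using huV
  let D : Set ι := ⋃ n, C n
  have hD : D.Countable := Set.countable_iUnion hC
  have hDS : D ⊆ S := Set.iUnion_subset hCS
  have hmeas : ∀ E : Set ι, E.Countable → E ⊆ S → Measurable fun ω => ⨆ i ∈ E, f i ω :=
    fun E hE hES => Measurable.biSup E hE fun i hi => hf i (hES hi)
  have hmax : sSup V ≤ ∫⁻ ω, φ (⨆ i ∈ D, f i ω) ∂μ := by
    refine le_of_tendsto' hu fun n => ?_
    rw [hCu n]
    refine lintegral_mono fun ω => hφ.monotone ?_
    exact biSup_mono fun i hi => Set.mem_iUnion_of_mem n hi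
  refine ⟨D, hD, hDS, hmeas D hD hDS, fun i hi => ?_, fun h _ hh => ?_⟩
  · have hle : ∫⁻ ω, φ (⨆ j ∈ insert i D, f j ω) ∂μ ≤ ∫⁻ ω, φ (⨆ j ∈ D, f j ω) ∂μ :=
      le_trans (le_sSup (show _ ∈ V from
        ⟨insert i D, hD.insert i, Set.insert_subset hi hDS, rfl⟩)) hmax
    have hfin : ∫⁻ ω, φ (⨆ j ∈ D, f j ω) ∂μ ≠ ∞ := by
      refine ne_top_of_le_ne_top (measure_ne_top μ Set.univ) ?_
      calc ∫⁻ ω, φ (⨆ j ∈ D, f j ω) ∂μ ≤ ∫⁻ _, 1 ∂μ := lintegral_mono fun ω => hφ1 _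
        _ = μ Set.univ := by simp
    have hae := ae_eq_of_ae_le_of_lintegral_le (μ := μ)
      (f := fun ω => φ (⨆ j ∈ D, f j ω)) (g := fun ω => φ (⨆ j ∈ insert i D, f j ω))
      (Eventually.of_forall fun ω => hφ.monotone
        (biSup_mono fun j hj => Set.mem_insert_of_mem i hj)) hfin
      (hφm.comp (hmeas _ (hD.insert i) (Set.insert_subset hi hDS))).aemeasurable hle
    filter_upwards [hae] with ω hω
    have h1 := hφ.injective hω
    rw [h1]
    exact le_iSup₂_of_le i (Set.mem_insert i D) le_rfl
  · have := (ae_ball_iff hD).2 fun i hi => hh i (hDS hi)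
    filter_upwards [this] with ω hω
    exact iSup₂_le hω

/-- The essential supremum of an upward directed family is the limit of an increasing sequence of
members of the family. -/
theorem exists_monotone_seq_isEssSup (μ : Measure Ω) [IsFiniteMeasure μ] {S : Set ι}
    (hS : S.Nonempty) (f : ι → Ω → EReal) (hf : ∀ i ∈ S, Measurable (f i))
    (hdir : ∀ i ∈ S, ∀ j ∈ S, ∃ k ∈ S, f i ≤ᵐ[μ] f k ∧ f j ≤ᵐ[μ] f k) :
    ∃ q : ℕ → ι, (∀ n, q n ∈ S) ∧ (∀ n, f (q n) ≤ᵐ[μ] f (q (n + 1))) ∧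
      IsEssSup μ S f fun ω => ⨆ n, f (q n) ω := by
  obtain ⟨D, hD, hDS, hess⟩ := exists_countable_isEssSup μ S f hf
  obtain ⟨i₀, hi₀⟩ := hS
  -- The extra index makes the countable set nonempty, hence the range of a sequence.
  obtain ⟨e, he⟩ := (hD.insert i₀).exists_eq_range (Set.insert_nonempty _ _)
  have heS : ∀ n, e n ∈ S := fun n =>
    Set.insert_subset hi₀ hDS (he ▸ Set.mem_range_self n)
  have hdir' : ∀ i j : S, ∃ k : S, f i ≤ᵐ[μ] f k ∧ f j ≤ᵐ[μ] f k := fun i j => by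
    obtain ⟨k, hk, h⟩ := hdir i i.2 j j.2
    exact ⟨⟨k, hk⟩, h⟩
  choose F hF1 hF2 using hdir'
  -- By directedness `q (n + 1)` is chosen above both `q n` and `e (n + 1)`, so the sequence
  -- increases and its limit dominates all of `D`.
  obtain ⟨q, hq0, hqs⟩ : ∃ q : ℕ → S, q 0 = ⟨e 0, heS 0⟩ ∧
      ∀ n, q (n + 1) = F (q n) ⟨e (n + 1), heS (n + 1)⟩ :=
    ⟨fun n => Nat.rec ⟨e 0, heS 0⟩ (fun n p => F p ⟨e (n + 1), heS (n + 1)⟩) n, rfl, fun _ => rfl⟩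
  have hq : ∀ n, f (q n : ι) ≤ᵐ[μ] f (q (n + 1) : ι) := fun n => by
    rw [hqs]
    exact hF1 _ _
  have hqe : ∀ n, f (e n) ≤ᵐ[μ] f (q n : ι) := fun n => by
    cases n with
    | zero => rw [hq0]
    | succ n =>
      rw [hqs]
      exact hF2 (q n) ⟨e (n + 1), heS (n + 1)⟩
  refine ⟨fun n => q n, fun n => (q n).2, hq, ?_⟩
  refine ⟨Measurable.iSup fun n => hf _ (q n).2, fun i hi => ?_, fun h hm hh => ?_⟩
  · filter_upwards [hess.2.1 i hi, ae_all_iff.2 hqe] with ω h1 h2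
    refine h1.trans (iSup₂_le fun j hj => ?_)
    obtain ⟨n, rfl⟩ : j ∈ Set.range e := he ▸ Set.mem_insert_of_mem _ hj
    exact (h2 n).trans (le_iSup (fun n => f (q n) ω) n)
  · filter_upwards [ae_all_iff.2 fun n => hh (q n) (q n).2] with ω hω
    exact iSup_le hω

end EssSup

end

/-! ### Pasting, and time consistency from stability -/

section

variable {d : ℕ} {T : ℝ}

theorem FiniteStoppingTime.sigma_le (τ : FiniteStoppingTime d T) :
    τ.sigma ≤ PathSpace.instMeasurableSpace := τ.isStoppingTime.measurableSpace_le

theorem FiniteStoppingTime.sigma_mono {σ τ : FiniteStoppingTime d T}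
    (h : ∀ ω, σ.toFun ω ≤ τ.toFun ω) : σ.sigma ≤ τ.sigma :=
  IsStoppingTime.measurableSpace_mono _ _ fun ω => WithTop.coe_le_coe.2 (h ω)

theorem trim_eq_of_mem_agreeing {Ps : Set (PathMeasure d T)} {P P' : PathMeasure d T}
    {m : MeasurableSpace (PathSpace d T)} (hm : m ≤ PathSpace.instMeasurableSpace)
    (h : P' ∈ agreeing Ps P m) : P'.trim hm = P.trim hm := by
  refine @Measure.ext _ m _ _ fun A hA => ?_
  rw [trim_measurableSet_eq hm hA, trim_measurableSet_eq hm hA, h.2 A hA]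

/-- The measure that behaves like `P₁` on `Λ` and like `P₂` off `Λ`. -/
def paste (P₁ P₂ : PathMeasure d T) (Λ : Set (PathSpace d T)) : PathMeasure d T :=
  P₁.restrict Λ + P₂.restrict Λᶜ

theorem paste_apply (P₁ P₂ : PathMeasure d T) {Λ A : Set (PathSpace d T)}
    (hA : MeasurableSet[PathSpace.instMeasurableSpace] A) :
    paste P₁ P₂ Λ A = P₁ (A ∩ Λ) + P₂ (A ∩ Λᶜ) := by
  simp [paste, Measure.restrict_apply hA]

section Paste

variable {P P₁ P₂ : PathMeasure d T} {m : MeasurableSpace (PathSpace d T)}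
  {Λ : Set (PathSpace d T)} {X : PathSpace d T → ℝ}

theorem integral_indicator_condExp_eq_measureReal [IsFiniteMeasure P₁]
    (hm : m ≤ PathSpace.instMeasurableSpace) (h : P₁.trim hm = P.trim hm)
    (hΛ : MeasurableSet[m] Λ) {A : Set (PathSpace d T)}
    (hA : MeasurableSet[PathSpace.instMeasurableSpace] A) :
    ∫ ω, Λ.indicator (condExp m P₁ (A.indicator fun _ => (1 : ℝ))) ω ∂P = P₁.real (A ∩ Λ) := by
  rw [integral_indicator (hm _ hΛ),
    ← setIntegral_eq_of_trim_eq hm h stronglyMeasurable_condExp hΛ,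
    setIntegral_condExp hm ((integrable_const _).indicator hA) hΛ, setIntegral_indicator hA]
  simp [Set.inter_comm]

/-- As `Λ` lies in `m`, where the three measures agree, the conditioning disappears upon integration
over `Λ` and over `Λᶜ`. Stability thus concerns the simpler measure `paste`. -/
theorem ofReal_integral_paste_eq [IsFiniteMeasure P] [IsFiniteMeasure P₁] [IsFiniteMeasure P₂]
    (hm : m ≤ PathSpace.instMeasurableSpace) (h₁ : P₁.trim hm = P.trim hm)
    (h₂ : P₂.trim hm = P.trim hm) (hΛ : MeasurableSet[m] Λ) {A : Set (PathSpace d T)}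
    (hA : MeasurableSet[PathSpace.instMeasurableSpace] A) :
    ENNReal.ofReal (∫ ω, (Λ.indicator (condExp m P₁ (A.indicator fun _ => (1 : ℝ))) ω +
      Λᶜ.indicator (condExp m P₂ (A.indicator fun _ => (1 : ℝ))) ω) ∂P) = paste P₁ P₂ Λ A := by
  rw [integral_add, integral_indicator_condExp_eq_measureReal hm h₁ hΛ hA,
    integral_indicator_condExp_eq_measureReal hm h₂ hΛ.compl hA, paste_apply _ _ hA,
    ENNReal.ofReal_add measureReal_nonneg measureReal_nonneg, ofReal_measureReal,
    ofReal_measureReal]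
  · exact ((integrable_iff_of_trim_eq hm h₁ stronglyMeasurable_condExp).1
      integrable_condExp).indicator (hm _ hΛ)
  · exact ((integrable_iff_of_trim_eq hm h₂ stronglyMeasurable_condExp).1
      integrable_condExp).indicator (hm _ hΛ.compl)

theorem trim_paste (hm : m ≤ PathSpace.instMeasurableSpace) (h₁ : P₁.trim hm = P.trim hm)
    (h₂ : P₂.trim hm = P.trim hm) (hΛ : MeasurableSet[m] Λ) :
    (paste P₁ P₂ Λ).trim hm = P.trim hm := by
  refine @Measure.ext _ m _ _ fun A hA => ?_
  have e₁ : P₁ (A ∩ Λ) = P (A ∩ Λ) := by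
    rw [← trim_measurableSet_eq hm (hA.inter hΛ), h₁, trim_measurableSet_eq hm (hA.inter hΛ)]
  have e₂ : P₂ (A ∩ Λᶜ) = P (A ∩ Λᶜ) := by
    rw [← trim_measurableSet_eq hm (hA.inter hΛ.compl), h₂,
      trim_measurableSet_eq hm (hA.inter hΛ.compl)]
  rw [trim_measurableSet_eq hm hA, trim_measurableSet_eq hm hA, paste_apply _ _ (hm _ hA), e₁, e₂]
  exact measure_inter_add_sdiff A (hm _ hΛ)

theorem restrict_paste (hΛ : MeasurableSet[PathSpace.instMeasurableSpace] Λ) :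
    (paste P₁ P₂ Λ).restrict Λ = P₁.restrict Λ := by
  simp [paste, Measure.restrict_add, Measure.restrict_restrict hΛ]

theorem restrict_compl_paste (hΛ : MeasurableSet[PathSpace.instMeasurableSpace] Λ) :
    (paste P₁ P₂ Λ).restrict Λᶜ = P₂.restrict Λᶜ := by
  simp [paste, Measure.restrict_add, Measure.restrict_restrict hΛ.compl]

theorem isFiniteMeasure_paste [IsFiniteMeasure P₁] [IsFiniteMeasure P₂] :
    IsFiniteMeasure (paste P₁ P₂ Λ) := by
  unfold paste; infer_instance

theorem integrable_paste (hi₁ : Integrable X P₁) (hi₂ : Integrable X P₂) :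
    Integrable X (paste P₁ P₂ Λ) :=
  hi₁.restrict.add_measure hi₂.restrict

/-- Conditioning on `m` is local on sets of `m`: on `Λ` it depends only on the measure restricted to
`Λ`. -/
theorem condExp_restrict_congr [IsFiniteMeasure P] [IsFiniteMeasure P₁]
    (hm : m ≤ PathSpace.instMeasurableSpace) (hΛ : MeasurableSet[m] Λ)
    (h : P.restrict Λ = P₁.restrict Λ) (hi : Integrable X P) (hi₁ : Integrable X P₁) :
    ∀ᵐ ω ∂P, ω ∈ Λ → (P[X|m]) ω = (P₁[X|m]) ω := by
  rw [← ae_restrict_iff' (hm _ hΛ)]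
  have e₁ := condExp_restrict_ae_eq_restrict hm hΛ hi
  have e₂ := condExp_restrict_ae_eq_restrict hm hΛ hi₁
  rw [← h] at e₂
  filter_upwards [e₁, e₂] with ω e₁ e₂
  rw [← e₁, e₂]

theorem condExp_paste [IsFiniteMeasure P₁] [IsFiniteMeasure P₂]
    (hm : m ≤ PathSpace.instMeasurableSpace) (hΛ : MeasurableSet[m] Λ)
    (hi₁ : Integrable X P₁) (hi₂ : Integrable X P₂) :
    ∀ᵐ ω ∂(paste P₁ P₂ Λ), (ω ∈ Λ → ((paste P₁ P₂ Λ)[X|m]) ω = (P₁[X|m]) ω) ∧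
      (ω ∉ Λ → ((paste P₁ P₂ Λ)[X|m]) ω = (P₂[X|m]) ω) := by
  have := isFiniteMeasure_paste (P₁ := P₁) (P₂ := P₂) (Λ := Λ)
  have hi := integrable_paste (Λ := Λ) hi₁ hi₂
  filter_upwards [condExp_restrict_congr hm hΛ (restrict_paste (hm _ hΛ)) hi hi₁,
    condExp_restrict_congr hm hΛ.compl (restrict_compl_paste (hm _ hΛ)) hi hi₂] with ω h1 h2
  exact ⟨h1, h2⟩

end Paste

theorem isStableUnderPasting_iff {Ps : Set (PathMeasure d T)}
    (hprob : ∀ P ∈ Ps, IsProbabilityMeasure P) :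
    IsStableUnderPasting Ps ↔ ∀ P ∈ Ps, ∀ τ : FiniteStoppingTime d T, ∀ Λ,
      MeasurableSet[τ.sigma] Λ → ∀ P₁ ∈ agreeing Ps P τ.sigma, ∀ P₂ ∈ agreeing Ps P τ.sigma,
        paste P₁ P₂ Λ ∈ Ps := by
  refine forall₂_congr fun P hP => forall_congr' fun τ => forall₂_congr fun Λ hΛ =>
    forall₂_congr fun P₁ h₁ => forall₂_congr fun P₂ h₂ => ?_
  have := hprob P hP
  have := hprob P₁ h₁.1
  have := hprob P₂ h₂.1
  have key := fun A hA => ofReal_integral_paste_eq (A := A) τ.sigma_le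
    (trim_eq_of_mem_agreeing τ.sigma_le h₁) (trim_eq_of_mem_agreeing τ.sigma_le h₂) hΛ hA
  constructor
  · rintro ⟨Q, hQ, h⟩
    have : Q = paste P₁ P₂ Λ := Measure.ext fun A hA => (h A hA).trans (key A hA)
    rwa [← this]
  · exact fun h => ⟨_, h, fun A hA => (key A hA).symm⟩

theorem integrable_of_mem_quasiSureL1 {Ps : Set (PathMeasure d T)} {X : PathSpace d T → ℝ}
    (hX : X ∈ quasiSureL1 Ps) {P : PathMeasure d T} (hP : P ∈ Ps) : Integrable X P :=
  ⟨hX.1.aestronglyMeasurable, (le_iSup₂ (f := fun P (_ : P ∈ Ps) => ∫⁻ ω, ‖X ω‖ₑ ∂P) P hP).trans_lt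
    hX.2⟩

theorem measurable_coe_condExp {m : MeasurableSpace (PathSpace d T)} (P : PathMeasure d T)
    (X : PathSpace d T → ℝ) : Measurable[m] fun ω => (((P[X|m]) ω : ℝ) : EReal) :=
  measurable_coe_real_ereal.comp stronglyMeasurable_condExp.measurable

/-- Pasting on the event where `P₁` gives the larger conditional expectation yields the maximum of
the two. This is the only use of stability in the first half of the theorem. -/
theorem agreeing_directed {Ps : Set (PathMeasure d T)}
    (hprob : ∀ P ∈ Ps, IsProbabilityMeasure P) (hst : IsStableUnderPasting Ps)
    {X : PathSpace d T → ℝ} (hX : X ∈ quasiSureL1 Ps) {P : PathMeasure d T} (hP : P ∈ Ps)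
    (τ : FiniteStoppingTime d T) {P₁ P₂ : PathMeasure d T} (h₁ : P₁ ∈ agreeing Ps P τ.sigma)
    (h₂ : P₂ ∈ agreeing Ps P τ.sigma) :
    ∃ Q ∈ agreeing Ps P τ.sigma, P₁[X|τ.sigma] ≤ᵐ[P] Q[X|τ.sigma] ∧
      P₂[X|τ.sigma] ≤ᵐ[P] Q[X|τ.sigma] := by
  have := hprob P hP
  have := hprob P₁ h₁.1
  have := hprob P₂ h₂.1
  let Λ : Set (PathSpace d T) := {ω | (P₂[X|τ.sigma]) ω ≤ (P₁[X|τ.sigma]) ω}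
  have hΛ : MeasurableSet[τ.sigma] Λ :=
    measurableSet_setOf_le stronglyMeasurable_condExp.measurable
      stronglyMeasurable_condExp.measurable
  have hQ : paste P₁ P₂ Λ ∈ Ps := (isStableUnderPasting_iff hprob).1 hst P hP τ Λ hΛ P₁ h₁ P₂ h₂
  have htr : (paste P₁ P₂ Λ).trim τ.sigma_le = P.trim τ.sigma_le :=
    trim_paste τ.sigma_le (trim_eq_of_mem_agreeing _ h₁) (trim_eq_of_mem_agreeing _ h₂) hΛ
  have hce := condExp_paste (m := τ.sigma) τ.sigma_le hΛ (integrable_of_mem_quasiSureL1 hX h₁.1)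
    (integrable_of_mem_quasiSureL1 hX h₂.1)
  refine ⟨paste P₁ P₂ Λ, ⟨hQ, fun A hA => ?_⟩, ?_, ?_⟩
  · rw [← trim_measurableSet_eq τ.sigma_le hA, htr, trim_measurableSet_eq τ.sigma_le hA]
  · have hm : MeasurableSet[τ.sigma]
        {ω | (P₁[X|τ.sigma]) ω ≤ ((paste P₁ P₂ Λ)[X|τ.sigma]) ω} :=
      measurableSet_setOf_le stronglyMeasurable_condExp.measurable
        stronglyMeasurable_condExp.measurable
    -- The comparison is known under the pasted measure; as an event of `F°_τ` it has the same
    -- probability under `P`.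
    refine (ae_iff_of_trim_eq τ.sigma_le htr hm).1 ?_
    filter_upwards [hce] with ω hω
    by_cases h : ω ∈ Λ
    · exact (hω.1 h).ge
    · rw [hω.2 h]
      exact (not_le.1 h).le
  · have hm : MeasurableSet[τ.sigma]
        {ω | (P₂[X|τ.sigma]) ω ≤ ((paste P₁ P₂ Λ)[X|τ.sigma]) ω} :=
      measurableSet_setOf_le stronglyMeasurable_condExp.measurable
        stronglyMeasurable_condExp.measurable
    refine (ae_iff_of_trim_eq τ.sigma_le htr hm).1 ?_
    filter_upwards [hce] with ω hω
    by_cases h : ω ∈ Λ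
    · rw [hω.1 h]
      exact h
    · exact (hω.2 h).ge

/-- For the upper bound, the inner essential supremum under `P'` is an increasing limit of
conditional expectations under measures `q n` that also belong to the outer family, because `F°_σ ⊆
F°_τ`. For the lower bound, `P'` competes in its own inner problem. -/
theorem isTimeConsistentOn_of_isStableUnderPasting {Ps : Set (PathMeasure d T)}
    (hprob : ∀ P ∈ Ps, IsProbabilityMeasure P) (hst : IsStableUnderPasting Ps) :
    IsTimeConsistentOn Ps (quasiSureL1 Ps) := by
  intro P hP X hX σ τ hστ
  have := hprob P hP
  have hle := FiniteStoppingTime.sigma_mono hστ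
  set V : PathMeasure d T → PathSpace d T → EReal := fun P' =>
    familyEssSup P' (agreeing Ps P' τ.sigma) fun (P'' : PathMeasure d T) ω =>
      ((condExp τ.sigma P'' X ω : ℝ) : EReal) with hV
  have hVess : ∀ P' ∈ Ps, IsEssSup P' (agreeing Ps P' τ.sigma)
      (fun (P'' : PathMeasure d T) ω => ((condExp τ.sigma P'' X ω : ℝ) : EReal)) (V P') :=
    fun P' hP' => by
      have := hprob P' hP'
      exact isEssSup_familyEssSup _ _ _ fun P'' _ =>
        (measurable_coe_condExp P'' X).mono τ.sigma_le le_rfl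
  have hLm : ∀ P' ∈ agreeing Ps P σ.sigma, Measurable[σ.sigma] (extCondExp P' σ.sigma (V P')) :=
    fun P' hP' => by
      have := hprob P' hP'.1
      exact measurable_extCondExp _
  have hL := isEssSup_familyEssSup P (agreeing Ps P σ.sigma)
    (fun P' : PathMeasure d T => extCondExp P' σ.sigma (V P'))
    fun P' hP' => (hLm P' hP').mono σ.sigma_le le_rfl
  have hR := isEssSup_familyEssSup P (agreeing Ps P σ.sigma)
    (fun (P' : PathMeasure d T) ω => ((condExp σ.sigma P' X ω : ℝ) : EReal))
    fun P' _ => (measurable_coe_condExp P' X).mono σ.sigma_le le_rfl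
  refine EventuallyLE.antisymm (hL.2.2 _ hR.1 fun P' hP' => ?_) (hR.2.2 _ hL.1 fun P' hP' => ?_)
  · have := hprob P' hP'.1
    have hS : (agreeing Ps P' τ.sigma).Nonempty := ⟨P', hP'.1, fun _ _ => rfl⟩
    obtain ⟨q, hqS, hqmono, hqess⟩ := exists_monotone_seq_isEssSup P' hS
      (fun (P'' : PathMeasure d T) ω => ((condExp τ.sigma P'' X ω : ℝ) : EReal))
      (fun P'' _ => (measurable_coe_condExp P'' X).mono τ.sigma_le le_rfl)
      (fun P₁ h₁ P₂ h₂ => by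
        obtain ⟨Q, hQ, e₁, e₂⟩ := agreeing_directed hprob hst hX hP'.1 τ h₁ h₂
        exact ⟨Q, hQ, e₁.mono fun ω h => EReal.coe_le_coe_iff.2 h,
          e₂.mono fun ω h => EReal.coe_le_coe_iff.2 h⟩)
    have hVq := (hVess P' hP'.1).ae_eq hqess
    have hqt : ∀ n, (q n).trim τ.sigma_le = P'.trim τ.sigma_le := fun n =>
      trim_eq_of_mem_agreeing τ.sigma_le (hqS n)
    have hqσ : ∀ n, q n ∈ agreeing Ps P σ.sigma := fun n =>
      ⟨(hqS n).1, fun A hA => ((hqS n).2 A (hle A hA)).trans (hP'.2 A hA)⟩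
    have hqi : ∀ n, Integrable ((q n)[X|τ.sigma]) P' := fun n =>
      (integrable_iff_of_trim_eq τ.sigma_le (hqt n) stronglyMeasurable_condExp).1
        integrable_condExp
    -- The variable inside is `F°_τ`-measurable, and `P'` and `q n` agree there; the outer
    -- expectation may be taken under `q n`, where the tower property applies.
    have htower : ∀ n, P'[(q n)[X|τ.sigma]|σ.sigma] =ᵐ[P'] (q n)[X|σ.sigma] := fun n => by
      have := hprob (q n) (hqS n).1
      refine (condExp_ae_eq_of_trim_eq τ.sigma_le hle (hqt n).symm stronglyMeasurable_condExp
        (hqi n)).trans ?_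
      have e := condExp_condExp_of_le (μ := q n) (f := X) hle τ.sigma_le
      have htσ : (q n).trim σ.sigma_le = P'.trim σ.sigma_le := by
        rw [trim_eq_of_mem_agreeing σ.sigma_le (hqσ n), trim_eq_of_mem_agreeing σ.sigma_le hP']
      exact (ae_iff_of_trim_eq σ.sigma_le htσ (measurableSet_setOf_eq
        stronglyMeasurable_condExp.measurable stronglyMeasurable_condExp.measurable)).1 e
    -- The chosen version of the essential supremum is only known to be `F°_T`-measurable. The
    -- countable supremum `R` below it is `F°_σ`-measurable, and so an inequality against `R` can be
    -- moved from `P'` to `P`.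
    obtain ⟨R, hRm, hRle, hRge⟩ : ∃ R : PathSpace d T → EReal, Measurable[σ.sigma] R ∧
        (∀ n, ∀ ω, (((q n)[X|σ.sigma]) ω : EReal) ≤ R ω) ∧
        R ≤ᵐ[P] familyEssSup P (agreeing Ps P σ.sigma)
          (fun (P' : PathMeasure d T) ω => ((condExp σ.sigma P' X ω : ℝ) : EReal)) := by
      refine ⟨fun ω => ⨆ n, (((q n)[X|σ.sigma]) ω : EReal),
        measurable_iSup_nat fun n => measurable_coe_condExp _ _,
        fun n ω => le_iSup (fun n => (((q n)[X|σ.sigma]) ω : EReal)) n, ?_⟩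
      filter_upwards [ae_all_iff.2 fun n => hR.2.1 (q n) (hqσ n)] with ω hω
      exact iSup_le hω
    have hub : ∀ᵐ ω ∂P', extCondExp P' σ.sigma (V P') ω ≤ R ω := by
      have e1 := extCondExp_iSup_le (μ := P') (m := σ.sigma) σ.sigma_le
        (f := fun n => (q n)[X|τ.sigma])
        (fun n => (stronglyMeasurable_condExp.mono τ.sigma_le).measurable) hqi
        (fun n => (hqmono n).mono fun ω h => EReal.coe_le_coe_iff.1 h) (h := R) (fun n => by
          filter_upwards [htower n] with ω hω
          rw [hω]
          exact hRle n ω)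
      filter_upwards [e1, extCondExp_congr_ae (m := σ.sigma) hVq] with ω h1 h2
      rwa [h2]
    have hub' : ∀ᵐ ω ∂P, extCondExp P' σ.sigma (V P') ω ≤ R ω :=
      (ae_iff_of_trim_eq σ.sigma_le (trim_eq_of_mem_agreeing σ.sigma_le hP')
        (measurableSet_setOf_le (hLm P' hP') hRm)).1 hub
    exact EventuallyLE.trans hub' hRge
  · have := hprob P' hP'.1
    have h1 := (hVess P' hP'.1).2.1 P' ⟨hP'.1, fun _ _ => rfl⟩
    have h2 := condExp_le_extCondExp (μ := P') (m := σ.sigma) (hVess P' hP'.1).1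
      (g := P'[X|τ.sigma]) (stronglyMeasurable_condExp.mono τ.sigma_le).measurable
      integrable_condExp h1
    have e := condExp_condExp_of_le (μ := P') (f := X) hle τ.sigma_le
    have h3 : ∀ᵐ ω ∂P', (((P'[X|σ.sigma]) ω : ℝ) : EReal) ≤ extCondExp P' σ.sigma (V P') ω := by
      filter_upwards [h2, e] with ω h2 e
      rwa [← e]
    have h4 : ∀ᵐ ω ∂P, (((P'[X|σ.sigma]) ω : ℝ) : EReal) ≤ extCondExp P' σ.sigma (V P') ω :=
      (ae_iff_of_trim_eq σ.sigma_le (trim_eq_of_mem_agreeing σ.sigma_le hP')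
        (measurableSet_setOf_le (measurable_coe_condExp P' X)
          (hLm P' hP'))).1 h3
    exact EventuallyLE.trans h4 (hL.2.1 P' hP')

end

/-! ### Time consistency bounds expectations under pasted laws -/

section

variable {d : ℕ} {T : ℝ}

/-- All paths start at the origin. Conditioning at time `0` is therefore plain expectation, which
turns time consistency at `σ = 0` into a relation between numbers. -/
theorem rawFiltration_eq_bot {t : Set.Icc (0 : ℝ) T} (ht : (t : ℝ) = 0) :
    rawFiltration d T t = (⊥ : MeasurableSpace (PathSpace d T)) := by
  refine le_bot_iff.1 (iSup₂_le fun s hs => ?_)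
  have hs0 : (s : ℝ) = 0 := le_antisymm (le_trans (show (s : ℝ) ≤ t from hs) ht.le) s.2.1
  have : canon (d := d) s = fun _ => 0 := funext fun ω => ω.2 s hs0
  rw [this, MeasurableSpace.comap_const]

/-- The deterministic stopping time `0`. -/
def FiniteStoppingTime.zero (d : ℕ) (hT : 0 < T) : FiniteStoppingTime d T where
  toFun _ := ⟨0, le_rfl, hT.le⟩
  isStoppingTime := isStoppingTime_const _ _
  finite_range := (Set.finite_singleton _).subset Set.range_const_subset

theorem FiniteStoppingTime.sigma_zero (hT : 0 < T) :
    (FiniteStoppingTime.zero d hT).sigma = ⊥ :=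
  (IsStoppingTime.measurableSpace_const _ _).trans (rawFiltration_eq_bot rfl)

/-- The variable `f` glues the two conditional expectations given `F°_τ`, and its `P`-mean is the
mean of `X` under the pasted law. It lies below the inner essential supremum under `P`, so its mean
is at most the left side of time consistency at `σ = 0`; the right side is at most the supremum over
`Ps`. -/
theorem integral_paste_le_iSup {Ps : Set (PathMeasure d T)} (hT : 0 < T)
    (hprob : ∀ P ∈ Ps, IsProbabilityMeasure P) {H : Set (PathSpace d T → ℝ)}
    (hHL : H ⊆ quasiSureL1 Ps) (htc : IsTimeConsistentOn Ps H) {P : PathMeasure d T} (hP : P ∈ Ps)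
    (τ : FiniteStoppingTime d T) {Λ : Set (PathSpace d T)} (hΛ : MeasurableSet[τ.sigma] Λ)
    {P₁ P₂ : PathMeasure d T} (h₁ : P₁ ∈ agreeing Ps P τ.sigma)
    (h₂ : P₂ ∈ agreeing Ps P τ.sigma) {X : PathSpace d T → ℝ} (hX : X ∈ H) :
    ((∫ ω, X ω ∂(paste P₁ P₂ Λ) : ℝ) : EReal) ≤ ⨆ P' ∈ Ps, ((∫ ω, X ω ∂P' : ℝ) : EReal) := by
  have := hprob P hP
  have := hprob P₁ h₁.1
  have := hprob P₂ h₂.1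
  have hi₁ := integrable_of_mem_quasiSureL1 (hHL hX) h₁.1
  have hi₂ := integrable_of_mem_quasiSureL1 (hHL hX) h₂.1
  have t₁ := trim_eq_of_mem_agreeing τ.sigma_le h₁
  have t₂ := trim_eq_of_mem_agreeing τ.sigma_le h₂
  have j₁ : Integrable (P₁[X|τ.sigma]) P :=
    (integrable_iff_of_trim_eq τ.sigma_le t₁ stronglyMeasurable_condExp).1 integrable_condExp
  have j₂ : Integrable (P₂[X|τ.sigma]) P :=
    (integrable_iff_of_trim_eq τ.sigma_le t₂ stronglyMeasurable_condExp).1 integrable_condExp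
  have hΛ' := τ.sigma_le _ hΛ
  set f : PathSpace d T → ℝ :=
    Λ.indicator (P₁[X|τ.sigma]) + Λᶜ.indicator (P₂[X|τ.sigma]) with hf
  have hfi : Integrable f P := (j₁.indicator hΛ').add (j₂.indicator hΛ'.compl)
  have hfm : Measurable f :=
    ((stronglyMeasurable_condExp.mono τ.sigma_le).measurable.indicator hΛ').add
      ((stronglyMeasurable_condExp.mono τ.sigma_le).measurable.indicator hΛ'.compl)
  have hint : ∫ ω, X ω ∂(paste P₁ P₂ Λ) = ∫ ω, f ω ∂P := by
    rw [paste, integral_add_measure hi₁.restrict hi₂.restrict, hf]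
    simp only [Pi.add_apply]
    rw [integral_add (j₁.indicator hΛ') (j₂.indicator hΛ'.compl), integral_indicator hΛ',
      integral_indicator hΛ'.compl,
      ← setIntegral_eq_of_trim_eq τ.sigma_le t₁ stronglyMeasurable_condExp hΛ,
      ← setIntegral_eq_of_trim_eq τ.sigma_le t₂ stronglyMeasurable_condExp hΛ.compl,
      setIntegral_condExp τ.sigma_le hi₁ hΛ, setIntegral_condExp τ.sigma_le hi₂ hΛ.compl]
  let σ := FiniteStoppingTime.zero d hT
  have hσ : σ.sigma = ⊥ := FiniteStoppingTime.sigma_zero hT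
  have htc' := htc P hP X hX σ τ fun ω => (τ.toFun ω).2.1
  set V : PathMeasure d T → PathSpace d T → EReal := fun P' =>
    familyEssSup P' (agreeing Ps P' τ.sigma) fun (P'' : PathMeasure d T) ω =>
      ((condExp τ.sigma P'' X ω : ℝ) : EReal) with hV
  have hVess : IsEssSup P (agreeing Ps P τ.sigma)
      (fun (P'' : PathMeasure d T) ω => ((condExp τ.sigma P'' X ω : ℝ) : EReal)) (V P) :=
    isEssSup_familyEssSup _ _ _ fun P'' _ =>
      (measurable_coe_condExp P'' X).mono τ.sigma_le le_rfl
  have hL := isEssSup_familyEssSup P (agreeing Ps P σ.sigma)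
    (fun P' : PathMeasure d T => extCondExp P' σ.sigma (V P'))
    fun P' hP' => by
      have := hprob P' hP'.1
      exact (measurable_extCondExp (m := σ.sigma) _).mono σ.sigma_le le_rfl
  have hR := isEssSup_familyEssSup P (agreeing Ps P σ.sigma)
    (fun (P' : PathMeasure d T) ω => ((condExp σ.sigma P' X ω : ℝ) : EReal))
    fun P' _ => (measurable_coe_condExp P' X).mono σ.sigma_le le_rfl
  have hfV : ∀ᵐ ω ∂P, (f ω : EReal) ≤ V P ω := by
    filter_upwards [hVess.2.1 P₁ h₁, hVess.2.1 P₂ h₂] with ω e₁ e₂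
    by_cases h : ω ∈ Λ
    · simpa [hf, h] using e₁
    · simpa [hf, h] using e₂
  have h1 := condExp_le_extCondExp (μ := P) (m := σ.sigma) hVess.1 hfm hfi hfV
  have h2 := hL.2.1 P ⟨hP, fun _ _ => rfl⟩
  have h3 := hR.2.2 (fun _ => ⨆ P' ∈ Ps, ((∫ ω, X ω ∂P' : ℝ) : EReal)) measurable_const
    fun P' hP' => ae_of_all _ fun ω => by
      have := hprob P' hP'.1
      simp only [hσ, condExp_bot]
      exact le_iSup₂ (f := fun P' (_ : P' ∈ Ps) => ((∫ ω, X ω ∂P' : ℝ) : EReal)) P' hP'.1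
  have h4 : ∀ᵐ ω ∂P, ((∫ ω, X ω ∂(paste P₁ P₂ Λ) : ℝ) : EReal) ≤
      ⨆ P' ∈ Ps, ((∫ ω, X ω ∂P' : ℝ) : EReal) := by
    filter_upwards [h1, h2, h3, htc'] with ω h1 h2 h3 h4
    rw [hint]
    rw [h4] at h2
    simp only [hσ, condExp_bot] at h1 h2 h3
    exact h1.trans (h2.trans h3)
  exact h4.exists.choose_spec

/-- Maximality reduces the claim to the bound on expectations and to the membership of the pasted
law in `P_S`. The latter does not involve `Ps`; it enters as `hpaste` and is supplied by
`paste_mem_strongLaws`. -/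
theorem isStableUnderPasting_of_isTimeConsistentOn {P₀ : PathMeasure d T}
    {Ps : Set (PathMeasure d T)} (hT : 0 < T)
    (hprob : ∀ P ∈ Ps, IsProbabilityMeasure P) (hPsS : Ps ⊆ strongLaws P₀)
    {H : Set (PathSpace d T → ℝ)} (hHL : H ⊆ quasiSureL1 Ps) (htc : IsTimeConsistentOn Ps H)
    (hmax : IsMaximallyChosen P₀ Ps H)
    (hpaste : ∀ P₁ ∈ strongLaws P₀, ∀ P₂ ∈ strongLaws P₀, ∀ τ : FiniteStoppingTime d T,
      (∀ A, MeasurableSet[τ.sigma] A → P₁ A = P₂ A) → ∀ Λ, MeasurableSet[τ.sigma] Λ →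
        paste P₁ P₂ Λ ∈ strongLaws P₀) :
    IsStableUnderPasting Ps := by
  refine (isStableUnderPasting_iff hprob).2 fun P hP τ Λ hΛ P₁ h₁ P₂ h₂ => hmax _
    (hpaste P₁ (hPsS h₁.1) P₂ (hPsS h₂.1) τ (fun A hA => (h₁.2 A hA).trans (h₂.2 A hA).symm) Λ hΛ)
    fun X hX => ⟨integrable_paste (integrable_of_mem_quasiSureL1 (hHL hX) h₁.1)
      (integrable_of_mem_quasiSureL1 (hHL hX) h₂.1),
      integral_paste_le_iSup hT hprob hHL htc hP τ hΛ h₁ h₂ hX⟩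

theorem isProbabilityMeasure_of_mem_strongLaws {P₀ : PathMeasure d T} (hP₀ : IsWienerMeasure P₀)
    {P : PathMeasure d T} (hP : P ∈ strongLaws P₀) : IsProbabilityMeasure P := by
  have := hP₀.isProbabilityMeasure
  obtain ⟨α, X, -, -, -, hX, -, rfl⟩ := hP
  exact Measure.isProbabilityMeasure_map hX.aemeasurable

end

/-! ### Brownian increments and sums of martingale differences -/

section

variable {d : ℕ} {T : ℝ} {Ω : Type*} {mΩ : MeasurableSpace Ω}

/-- `W` is a Brownian motion on `[0,T]` relative to the filtration `𝓕`. -/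
structure IsBrownian (μ : Measure Ω) (𝓕 : Filtration (Set.Icc (0 : ℝ) T) mΩ)
    (W : Set.Icc (0 : ℝ) T → Ω → EuclideanSpace ℝ (Fin d)) : Prop where
  adapted : ∀ t, Measurable[𝓕 t] (W t)
  indep : ∀ s t, s ≤ t →
    Indep (MeasurableSpace.comap (fun ω => W t ω - W s ω) inferInstance) (𝓕 s) μ
  law : ∀ s t, s ≤ t → μ.map (fun ω => W t ω - W s ω) =
    multivariateGaussian 0 (((t : ℝ) - (s : ℝ)) • (1 : Matrix (Fin d) (Fin d) ℝ))
  zero : ∀ t : Set.Icc (0 : ℝ) T, (t : ℝ) = 0 → ∀ ω, W t ω = 0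

section Moments

variable {μ : Measure Ω} {𝓕 : Filtration (Set.Icc (0 : ℝ) T) mΩ}
  {W : Set.Icc (0 : ℝ) T → Ω → EuclideanSpace ℝ (Fin d)} {s t : Set.Icc (0 : ℝ) T}

theorem IsBrownian.measurable (hW : IsBrownian μ 𝓕 W) (t : Set.Icc (0 : ℝ) T) :
    Measurable (W t) := (hW.adapted t).mono (𝓕.le t) le_rfl

theorem IsBrownian.measurable_increment (hW : IsBrownian μ 𝓕 W) (hst : s ≤ t) (a : Fin d) :
    Measurable[𝓕 t] fun ω => (W t ω - W s ω) a := by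
  have h1 : Measurable[𝓕 t] fun ω => W t ω a := (measurable_pi_apply a).comp
    ((WithLp.measurable_ofLp 2 _).comp (hW.adapted t))
  have h2 : Measurable[𝓕 t] fun ω => W s ω a := (measurable_pi_apply a).comp
    ((WithLp.measurable_ofLp 2 _).comp ((hW.adapted s).mono (𝓕.mono hst) le_rfl))
  exact h1.sub h2

theorem posSemidef_smul_one {h : ℝ} (hh : 0 ≤ h) :
    (h • (1 : Matrix (Fin d) (Fin d) ℝ)).PosSemidef :=
  Matrix.PosSemidef.one.smul hh

theorem IsBrownian.memLp_increment (hW : IsBrownian μ 𝓕 W) (hst : s ≤ t) (a : Fin d)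
    {p : ℝ≥0∞} (hp : p ≠ ∞) : MemLp (fun ω => (W t ω - W s ω) a) p μ := by
  have hm : Measurable fun ω => W t ω - W s ω := (hW.measurable t).sub (hW.measurable s)
  have h1 : MemLp id p (μ.map fun ω => W t ω - W s ω) := by
    rw [hW.law s t hst]
    exact IsGaussian.memLp_id _ p hp
  have h2 := (memLp_map_measure_iff h1.1 hm.aemeasurable).1 h1
  exact (EuclideanSpace.proj (𝕜 := ℝ) a).comp_memLp' h2

theorem IsBrownian.integral_increment (hW : IsBrownian μ 𝓕 W) (hst : s ≤ t) (a : Fin d) :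
    ∫ ω, (W t ω - W s ω) a ∂μ = 0 := by
  have hm : Measurable fun ω => W t ω - W s ω := (hW.measurable t).sub (hW.measurable s)
  have h := integral_map (μ := μ) hm.aemeasurable
    (f := fun x : EuclideanSpace ℝ (Fin d) => x a)
    (by fun_prop : Measurable fun x : EuclideanSpace ℝ (Fin d) => x a).aestronglyMeasurable
  rw [← h, hW.law s t hst]
  have h2 := (EuclideanSpace.proj (𝕜 := ℝ) a).integral_comp_comm
    (IsGaussian.integrable_id (μ := multivariateGaussian (0 : EuclideanSpace ℝ (Fin d))
      (((t : ℝ) - (s : ℝ)) • (1 : Matrix (Fin d) (Fin d) ℝ))))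
  simpa using h2

theorem IsBrownian.integral_increment_mul (hW : IsBrownian μ 𝓕 W) [IsProbabilityMeasure μ]
    (hst : s ≤ t) (a b : Fin d) :
    ∫ ω, (W t ω - W s ω) a * (W t ω - W s ω) b ∂μ =
      ((t : ℝ) - s) * (1 : Matrix (Fin d) (Fin d) ℝ) a b := by
  have hm : Measurable fun ω => W t ω - W s ω := (hW.measurable t).sub (hW.measurable s)
  have h := integral_map (μ := μ) hm.aemeasurable
    (f := fun x : EuclideanSpace ℝ (Fin d) => x a * x b)
    (by fun_prop : Measurable fun x : EuclideanSpace ℝ (Fin d) => x a * x b).aestronglyMeasurable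
  have hst' : 0 ≤ (t : ℝ) - s := sub_nonneg.2 hst
  have hc := covariance_eval_multivariateGaussian (μ := 0) (posSemidef_smul_one (d := d) hst') a b
  have hz : ∀ c : Fin d, ∫ x : EuclideanSpace ℝ (Fin d), x c ∂(multivariateGaussian 0
      (((t : ℝ) - (s : ℝ)) • (1 : Matrix (Fin d) (Fin d) ℝ))) = 0 := fun c => by
    have h2 := (EuclideanSpace.proj (𝕜 := ℝ) c).integral_comp_comm
      (IsGaussian.integrable_id (μ := multivariateGaussian (0 : EuclideanSpace ℝ (Fin d))
        (((t : ℝ) - (s : ℝ)) • (1 : Matrix (Fin d) (Fin d) ℝ))))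
    simpa using h2
  have hL : ∀ c : Fin d, MemLp (fun x : EuclideanSpace ℝ (Fin d) => x c) 2
      (multivariateGaussian 0 (((t : ℝ) - (s : ℝ)) • (1 : Matrix (Fin d) (Fin d) ℝ))) := fun c =>
    (EuclideanSpace.proj (𝕜 := ℝ) c).comp_memLp' (IsGaussian.memLp_id _ 2 (by simp))
  rw [covariance_eq_sub (hL a) (hL b), hz, zero_mul, sub_zero] at hc
  rw [← h, hW.law s t hst]
  simpa [Matrix.smul_apply] using hc

theorem IsBrownian.integral_increment_pow_four (hW : IsBrownian μ 𝓕 W) (hst : s ≤ t)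
    (a : Fin d) :
    ∫ ω, (W t ω - W s ω) a ^ 4 ∂μ = ((t : ℝ) - s) ^ 2 * ∫ x, x ^ 4 ∂(gaussianReal 0 1) := by
  have hm : Measurable fun ω => W t ω - W s ω := (hW.measurable t).sub (hW.measurable s)
  have hst' : 0 ≤ (t : ℝ) - s := sub_nonneg.2 hst
  have h := integral_map (μ := μ) hm.aemeasurable
    (f := fun x : EuclideanSpace ℝ (Fin d) => x a ^ 4)
    (by fun_prop : Measurable fun x : EuclideanSpace ℝ (Fin d) => x a ^ 4).aestronglyMeasurable
  have hmp := measurePreserving_eval_multivariateGaussian (μ := 0)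
    (posSemidef_smul_one (d := d) hst') (i := a)
  have h2 := integral_map (μ := multivariateGaussian (0 : EuclideanSpace ℝ (Fin d))
    (((t : ℝ) - (s : ℝ)) • (1 : Matrix (Fin d) (Fin d) ℝ))) hmp.measurable.aemeasurable
    (f := fun x : ℝ => x ^ 4) (by fun_prop : Measurable fun x : ℝ => x ^ 4).aestronglyMeasurable
  rw [← h, hW.law s t hst, ← h2, hmp.map_eq]
  have h3 : gaussianReal 0 ((t : ℝ) - s).toNNReal =
      (gaussianReal 0 1).map fun x => √((t : ℝ) - s) * x := by
    rw [gaussianReal_map_const_mul]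
    congr 1
    · simp
    · ext
      simp [Real.sq_sqrt hst', hst']
  have h4 : ((0 : EuclideanSpace ℝ (Fin d)) a) = 0 := rfl
  have h5 : (((t : ℝ) - s) • (1 : Matrix (Fin d) (Fin d) ℝ)) a a = (t : ℝ) - s := by simp
  rw [h4, h5, h3, integral_map (by fun_prop) (by fun_prop), ← integral_const_mul]
  congr 1
  ext x
  rw [mul_pow, show √((t : ℝ) - s) ^ 4 = (√((t : ℝ) - s) ^ 2) ^ 2 by ring, Real.sq_sqrt hst']

/-- A constant in the bound for the variance of products of Brownian increments. -/
def varianceConst : ℝ := 2 * (∫ x, x ^ 4 ∂(gaussianReal 0 1)) + 2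

theorem varianceConst_nonneg : 0 ≤ varianceConst := by
  have : 0 ≤ ∫ x, x ^ 4 ∂(gaussianReal 0 1) := integral_nonneg fun x => by positivity
  unfold varianceConst
  positivity

theorem IsBrownian.memLp_increment_mul_sub (hW : IsBrownian μ 𝓕 W) [IsProbabilityMeasure μ]
    (hst : s ≤ t) (a b : Fin d) (c : ℝ) :
    MemLp (fun ω => (W t ω - W s ω) a * (W t ω - W s ω) b - c) 2 μ := by
  refine MemLp.sub ?_ (memLp_const c)
  exact MemLp.mul (p := 4) (q := 4) (hW.memLp_increment hst b (by simp))
    (hW.memLp_increment hst a (by simp)) (hpqr := ⟨by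
      rw [← two_mul, show (4 : ℝ≥0∞) = 2 * 2 by norm_num,
        ENNReal.mul_inv (by simp) (by simp), ← mul_assoc,
        ENNReal.mul_inv_cancel (by simp) (by simp),
        one_mul]⟩)

theorem IsBrownian.integral_increment_mul_sub_sq_le (hW : IsBrownian μ 𝓕 W)
    [IsProbabilityMeasure μ] (hst : s ≤ t) (a b : Fin d) :
    ∫ ω, ((W t ω - W s ω) a * (W t ω - W s ω) b -
      ((t : ℝ) - s) * (1 : Matrix (Fin d) (Fin d) ℝ) a b) ^ 2 ∂μ ≤
      varianceConst * ((t : ℝ) - s) ^ 2 := by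
  set h : ℝ := (t : ℝ) - s
  have hi : ∀ c : Fin d, Integrable (fun ω => (W t ω - W s ω) c ^ 4) μ := fun c => by
    have := (hW.memLp_increment hst c (p := 4) (by simp)).integrable_norm_pow (by simp)
    refine this.congr (ae_of_all _ fun ω => ?_)
    simp only [Real.norm_eq_abs]
    exact Even.pow_abs (by decide) _
  calc _ ≤ ∫ ω, ((W t ω - W s ω) a ^ 4 + (W t ω - W s ω) b ^ 4 + 2 * h ^ 2) ∂μ := by
        refine integral_mono (hW.memLp_increment_mul_sub hst a b _).integrable_sq
          (((hi a).add (hi b)).add (integrable_const _)) fun ω => ?_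
        have h1 : (1 : Matrix (Fin d) (Fin d) ℝ) a b ^ 2 ≤ 1 := by
          rw [Matrix.one_apply]; split_ifs <;> simp
        set x := (W t ω - W s ω) a
        set y := (W t ω - W s ω) b
        set e := (1 : Matrix (Fin d) (Fin d) ℝ) a b
        change (x * y - h * e) ^ 2 ≤ x ^ 4 + y ^ 4 + 2 * h ^ 2
        have h2 : h ^ 2 * e ^ 2 ≤ h ^ 2 * 1 := by gcongr
        -- This combines `(xy - he)² ≤ 2x²y² + 2h²e²` with `2x²y² ≤ x⁴ + y⁴`; it explains the form
        -- of `varianceConst`.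
        nlinarith [sq_nonneg (x ^ 2 - y ^ 2), sq_nonneg (x * y + h * e)]
    _ = varianceConst * h ^ 2 := by
        have hab : Integrable (fun ω => (W t ω - W s ω) a ^ 4 + (W t ω - W s ω) b ^ 4) μ :=
          (hi a).add (hi b)
        rw [integral_add hab (integrable_const _), integral_add (hi a) (hi b),
          hW.integral_increment_pow_four hst, hW.integral_increment_pow_four hst,
          integral_const]
        simp only [probReal_univ, smul_eq_mul, one_mul, varianceConst, h]
        ring

end Moments

/-- The second moment of a sum of martingale differences `g_j ξ_j`. -/
theorem integral_sq_sum_eq {μ : Measure Ω} [IsProbabilityMeasure μ]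
    {𝒢 : ℕ → MeasurableSpace Ω} (hle : ∀ j, 𝒢 j ≤ mΩ) (hmono : Monotone 𝒢)
    {g ξ : ℕ → Ω → ℝ} (hg : ∀ j, Measurable[𝒢 j] (g j)) {C : ℝ} (hC : ∀ j ω, |g j ω| ≤ C)
    (hξ : ∀ j, Measurable[𝒢 (j + 1)] (ξ j)) (hξ2 : ∀ j, MemLp (ξ j) 2 μ)
    (hξ0 : ∀ j, ∫ ω, ξ j ω ∂μ = 0)
    (hind : ∀ j, Indep (MeasurableSpace.comap (ξ j) inferInstance) (𝒢 j) μ) (M : ℕ) :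
    MemLp (fun ω => ∑ j ∈ Finset.range M, g j ω * ξ j ω) 2 μ ∧
      ∫ ω, (∑ j ∈ Finset.range M, g j ω * ξ j ω) ^ 2 ∂μ =
        ∑ j ∈ Finset.range M, (∫ ω, g j ω ^ 2 ∂μ) * ∫ ω, ξ j ω ^ 2 ∂μ := by
  have hterm : ∀ j, MemLp (fun ω => g j ω * ξ j ω) 2 μ := fun j => by
    refine MemLp.of_le_mul (c := C) (hξ2 j)
      (((hg j).mono (hle j) le_rfl).mul ((hξ j).mono (hle _) le_rfl)).aestronglyMeasurable
      (ae_of_all _ fun ω => ?_)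
    rw [norm_mul]
    gcongr
    exact hC j ω
  have hL : ∀ M, MemLp (fun ω => ∑ j ∈ Finset.range M, g j ω * ξ j ω) 2 μ := fun M =>
    memLp_finsetSum _ fun j _ => hterm j
  refine ⟨hL M, ?_⟩
  have hindf : ∀ j (Z : Ω → ℝ), Measurable[𝒢 j] Z → ∀ φ : ℝ → ℝ, Measurable φ →
      ∫ ω, Z ω * φ (ξ j ω) ∂μ = (∫ ω, Z ω ∂μ) * ∫ ω, φ (ξ j ω) ∂μ := fun j Z hZ φ hφ => by
    have h1 : IndepFun Z (ξ j) μ := by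
      rw [IndepFun_iff_Indep]
      exact indep_of_indep_of_le_left (hind j).symm hZ.comap_le
    exact (h1.comp measurable_id hφ).integral_fun_mul_eq_mul_integral
      (hZ.mono (hle j) le_rfl).aestronglyMeasurable
      (hφ.comp ((hξ j).mono (hle _) le_rfl)).aestronglyMeasurable
  have hSm : ∀ M, Measurable[𝒢 M] fun ω => ∑ j ∈ Finset.range M, g j ω * ξ j ω := fun M => by
    refine @Finset.measurable_sum _ _ _ _ _ _ (𝒢 M) _ _ fun j hj => ?_
    have hj' := Finset.mem_range.1 hj
    exact ((hg j).mono (hmono hj'.le) le_rfl).mul ((hξ j).mono (hmono hj') le_rfl)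
  induction M with
  | zero => simp
  | succ M ih =>
    simp_rw [Finset.sum_range_succ]
    have e1 : ∀ ω, (∑ j ∈ Finset.range M, g j ω * ξ j ω + g M ω * ξ M ω) ^ 2 =
        (∑ j ∈ Finset.range M, g j ω * ξ j ω) ^ 2 +
          (2 * ((∑ j ∈ Finset.range M, g j ω * ξ j ω) * g M ω) * ξ M ω +
            g M ω ^ 2 * ξ M ω ^ 2) := fun ω => by ring
    simp_rw [e1]
    have hsq : Integrable (fun ω => g M ω ^ 2 * ξ M ω ^ 2) μ := by
      simpa only [mul_pow] using (hterm M).integrable_sq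
    have hcr : Integrable (fun ω => 2 * ((∑ j ∈ Finset.range M, g j ω * ξ j ω) * g M ω) * ξ M ω)
        μ := by
      have := ((hL M).integrable_mul (hterm M)).const_mul 2
      refine this.congr (ae_of_all _ fun ω => ?_)
      simp only [Pi.mul_apply]
      ring
    have hcs : Integrable (fun ω => 2 * ((∑ j ∈ Finset.range M, g j ω * ξ j ω) * g M ω) * ξ M ω +
        g M ω ^ 2 * ξ M ω ^ 2) μ := hcr.add hsq
    -- The factor in front of `ξ M` is known at stage `M`, and `ξ M` is centred and independent of
    -- that stage.
    have hc0 : ∫ ω, 2 * ((∑ j ∈ Finset.range M, g j ω * ξ j ω) * g M ω) * ξ M ω ∂μ = 0 := by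
      rw [hindf M (fun ω => 2 * ((∑ j ∈ Finset.range M, g j ω * ξ j ω) * g M ω))
        (((hSm M).mul (hg M)).const_mul 2) (fun x => x) measurable_id, hξ0, mul_zero]
    rw [integral_add (hL M).integrable_sq hcs, integral_add hcr hsq, ih,
      hindf M _ ((hg M).pow_const 2) (fun x => x ^ 2) (by fun_prop), hc0]
    ring

end

/-! ### Elementary integrals and a Lenglart type inequality -/

section

variable {d : ℕ} {T : ℝ} {Ω : Type*} {mΩ : MeasurableSpace Ω}

theorem frobSq_nonneg (A : Matrix (Fin d) (Fin d) ℝ) : 0 ≤ frobSq A :=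
  Finset.sum_nonneg fun _ _ => Finset.sum_nonneg fun _ _ => sq_nonneg _

@[simp] theorem frobSq_zero : frobSq (0 : Matrix (Fin d) (Fin d) ℝ) = 0 := by
  simp [frobSq]

theorem sq_entry_le_frobSq (A : Matrix (Fin d) (Fin d) ℝ) (a b : Fin d) : A a b ^ 2 ≤ frobSq A :=
  (Finset.single_le_sum (f := fun b => A a b ^ 2) (fun _ _ => sq_nonneg _)
    (Finset.mem_univ b)).trans
    (Finset.single_le_sum (f := fun a => ∑ b, A a b ^ 2)
      (fun _ _ => Finset.sum_nonneg fun _ _ => sq_nonneg _) (Finset.mem_univ a))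

theorem toEuclideanLin_apply_apply (A : Matrix (Fin d) (Fin d) ℝ) (v : EuclideanSpace ℝ (Fin d))
    (a : Fin d) : Matrix.toEuclideanLin A v a = ∑ b, A a b * v b := rfl

/-- A bounded sequence of random matrices such that the `j`-th one is known at time `u j`. -/
structure IsAdaptedCoeff (𝓕 : Filtration (Set.Icc (0 : ℝ) T) mΩ) (u : ℕ → Set.Icc (0 : ℝ) T)
    (c : ℕ → Ω → Matrix (Fin d) (Fin d) ℝ) : Prop where
  measurable : ∀ j a b, Measurable[𝓕 (u j)] fun ω => c j ω a b
  bounded : ∃ C : ℝ, ∀ j ω a b, |c j ω a b| ≤ C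

/-- The sum `∑_{j < M} c_j (W_{u_{j+1}} - W_{u_j})`. -/
def gridSum (W : Set.Icc (0 : ℝ) T → Ω → EuclideanSpace ℝ (Fin d)) (u : ℕ → Set.Icc (0 : ℝ) T)
    (M : ℕ) (c : ℕ → Ω → Matrix (Fin d) (Fin d) ℝ) (ω : Ω) : EuclideanSpace ℝ (Fin d) :=
  ∑ j ∈ Finset.range M, Matrix.toEuclideanLin (c j ω) (W (u (j + 1)) ω - W (u j) ω)

theorem gridSum_apply (W : Set.Icc (0 : ℝ) T → Ω → EuclideanSpace ℝ (Fin d))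
    (u : ℕ → Set.Icc (0 : ℝ) T) (M : ℕ) (c : ℕ → Ω → Matrix (Fin d) (Fin d) ℝ) (ω : Ω) (a : Fin d) :
    gridSum W u M c ω a =
      ∑ j ∈ Finset.range M, ∑ b, c j ω a b * (W (u (j + 1)) ω - W (u j) ω) b := by
  simp only [gridSum, WithLp.ofLp_sum, Finset.sum_apply]
  rfl

section

variable {μ : Measure Ω} {𝓕 : Filtration (Set.Icc (0 : ℝ) T) mΩ}
  {W : Set.Icc (0 : ℝ) T → Ω → EuclideanSpace ℝ (Fin d)} {u : ℕ → Set.Icc (0 : ℝ) T}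
  {c : ℕ → Ω → Matrix (Fin d) (Fin d) ℝ}

theorem measurable_frobSq_comp {m : MeasurableSpace Ω} {A : Ω → Matrix (Fin d) (Fin d) ℝ}
    (hA : ∀ a b, Measurable[m] fun ω => A ω a b) : Measurable[m] fun ω => frobSq (A ω) :=
  Finset.measurable_sum _ fun a _ => Finset.measurable_sum _ fun b _ => (hA a b).pow_const 2

theorem frobSq_le_of_abs_le {A : Matrix (Fin d) (Fin d) ℝ} {C : ℝ} (h : ∀ a b, |A a b| ≤ C) :
    frobSq A ≤ d * (d * C ^ 2) := by
  calc frobSq A ≤ ∑ _a : Fin d, ∑ _b : Fin d, C ^ 2 := by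
        refine Finset.sum_le_sum fun a _ => Finset.sum_le_sum fun b _ => ?_
        rw [← sq_abs]
        exact pow_le_pow_left₀ (abs_nonneg _) (h a b) 2
    _ = d * (d * C ^ 2) := by simp

theorem IsAdaptedCoeff.integrable_frobSq [IsProbabilityMeasure μ] (hc : IsAdaptedCoeff 𝓕 u c)
    (j : ℕ) : Integrable (fun ω => frobSq (c j ω)) μ := by
  obtain ⟨C, hC⟩ := hc.bounded
  refine Integrable.of_bound ((measurable_frobSq_comp fun a b =>
    hc.measurable j a b).mono (𝓕.le _) le_rfl).aestronglyMeasurable (d * (d * C ^ 2))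
    (ae_of_all _ fun ω => ?_)
  rw [Real.norm_of_nonneg (frobSq_nonneg _)]
  exact frobSq_le_of_abs_le fun a b => hC j ω a b

theorem IsAdaptedCoeff.indicator (hc : IsAdaptedCoeff 𝓕 u c) {s : ℕ → Set Ω}
    (hs : ∀ j, MeasurableSet[𝓕 (u j)] (s j)) :
    IsAdaptedCoeff 𝓕 u fun j => (s j).indicator (c j) := by
  obtain ⟨C, hC⟩ := hc.bounded
  refine ⟨fun j a b => ?_, max C 0, fun j ω a b => ?_⟩
  · have : (fun ω => (s j).indicator (c j) ω a b) = (s j).indicator fun ω => c j ω a b := by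
      funext ω
      by_cases h : ω ∈ s j <;> simp [h]
    rw [this]
    exact (hc.measurable j a b).indicator (hs j)
  · by_cases h : ω ∈ s j
    · simpa [h] using Or.inl (hC j ω a b)
    · simp [h]

/-- The Itô isometry applied to each coordinate of `W` separately. The factor `d` comes from the
Cauchy–Schwarz inequality over the coordinates and spares the evaluation of mixed terms. -/
theorem IsBrownian.integral_norm_gridSum_sq_le [IsProbabilityMeasure μ] (hW : IsBrownian μ 𝓕 W)
    (hu : Monotone u) (hc : IsAdaptedCoeff 𝓕 u c) (M : ℕ) :
    Integrable (fun ω => ‖gridSum W u M c ω‖ ^ 2) μ ∧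
      ∫ ω, ‖gridSum W u M c ω‖ ^ 2 ∂μ ≤ d * ∑ j ∈ Finset.range M,
        (∫ ω, frobSq (c j ω) ∂μ) * ((u (j + 1) : ℝ) - u j) := by
  obtain ⟨C, hC⟩ := hc.bounded
  have hj : ∀ j, u j ≤ u (j + 1) := fun j => hu j.le_succ
  have key : ∀ a b, _ := fun a b => integral_sq_sum_eq (μ := μ) (𝒢 := fun j => 𝓕 (u j))
    (fun j => 𝓕.le _) (fun i j hij => 𝓕.mono (hu hij)) (g := fun j ω => c j ω a b)
    (ξ := fun j ω => (W (u (j + 1)) ω - W (u j) ω) b) (fun j => hc.measurable j a b)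
    (fun j ω => hC j ω a b) (fun j => hW.measurable_increment (hj j) b)
    (fun j => hW.memLp_increment (hj j) b (by simp)) (fun j => hW.integral_increment (hj j) b)
    (fun j => indep_of_indep_of_le_left (hW.indep _ _ (hj j)) (by
      refine Measurable.comap_le ?_
      have h1 : Measurable fun v : EuclideanSpace ℝ (Fin d) => v b := by fun_prop
      exact h1.comp (comap_measurable _))) M
  have hvar : ∀ (b : Fin d) j, ∫ ω, (W (u (j + 1)) ω - W (u j) ω) b ^ 2 ∂μ =
      (u (j + 1) : ℝ) - u j := fun b j => by
    have := hW.integral_increment_mul (hj j) b b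
    simpa [sq] using this
  have hsq : ∀ ω, ‖gridSum W u M c ω‖ ^ 2 = ∑ a, (∑ b, ∑ j ∈ Finset.range M,
      c j ω a b * (W (u (j + 1)) ω - W (u j) ω) b) ^ 2 := fun ω => by
    rw [EuclideanSpace.real_norm_sq_eq]
    refine Finset.sum_congr rfl fun a _ => ?_
    congr 1
    rw [Finset.sum_comm]
    exact gridSum_apply W u M c ω a
  have hmem : ∀ a, MemLp (fun ω => ∑ b, ∑ j ∈ Finset.range M,
      c j ω a b * (W (u (j + 1)) ω - W (u j) ω) b) 2 μ := fun a =>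
    memLp_finsetSum _ fun b _ => (key a b).1
  have hint : Integrable (fun ω => ‖gridSum W u M c ω‖ ^ 2) μ := by
    simp_rw [hsq]
    exact integrable_finsetSum _ fun a _ => (hmem a).integrable_sq
  refine ⟨hint, ?_⟩
  calc ∫ ω, ‖gridSum W u M c ω‖ ^ 2 ∂μ
      ≤ ∫ ω, ∑ a, (d * ∑ b, (∑ j ∈ Finset.range M,
          c j ω a b * (W (u (j + 1)) ω - W (u j) ω) b) ^ 2) ∂μ := by
        refine integral_mono hint (integrable_finsetSum _ fun a _ => Integrable.const_mul
          (integrable_finsetSum _ fun b _ => (key a b).1.integrable_sq) _) fun ω => ?_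
        simp only [hsq]
        refine Finset.sum_le_sum fun a _ => ?_
        simpa using sq_sum_le_card_mul_sum_sq (s := (Finset.univ : Finset (Fin d)))
          (f := fun b => ∑ j ∈ Finset.range M, c j ω a b * (W (u (j + 1)) ω - W (u j) ω) b)
    _ = ∑ a, d * ∑ b, ∑ j ∈ Finset.range M, (∫ ω, c j ω a b ^ 2 ∂μ) *
          ((u (j + 1) : ℝ) - u j) := by
        rw [integral_finsetSum _ fun a _ => Integrable.const_mul
          (integrable_finsetSum _ fun b _ => (key a b).1.integrable_sq) _]
        refine Finset.sum_congr rfl fun a _ => ?_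
        rw [integral_const_mul, integral_finsetSum _ fun b _ => (key a b).1.integrable_sq]
        congr 1
        refine Finset.sum_congr rfl fun b _ => ?_
        rw [(key a b).2]
        simp_rw [hvar]
    _ = d * ∑ j ∈ Finset.range M, (∫ ω, frobSq (c j ω) ∂μ) * ((u (j + 1) : ℝ) - u j) := by
        rw [← Finset.mul_sum]
        congr 1
        have hsi : ∀ j a b, Integrable (fun ω => c j ω a b ^ 2) μ := fun j a b => by
          refine Integrable.of_bound (((hc.measurable j a b).pow_const 2).mono (𝓕.le _)
            le_rfl).aestronglyMeasurable (C ^ 2) (ae_of_all _ fun ω => ?_)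
          rw [Real.norm_of_nonneg (sq_nonneg _), ← sq_abs]
          exact pow_le_pow_left₀ (abs_nonneg _) (hC j ω a b) 2
        have hf : ∀ j, ∫ ω, frobSq (c j ω) ∂μ = ∑ a, ∑ b, ∫ ω, c j ω a b ^ 2 ∂μ := fun j => by
          unfold frobSq
          rw [integral_finsetSum _ fun a _ => integrable_finsetSum _ fun b _ => hsi j a b]
          exact Finset.sum_congr rfl fun a _ => integral_finsetSum _ fun b _ => hsi j a b
        simp_rw [hf, Finset.sum_mul]
        exact (Finset.sum_comm.trans (Finset.sum_congr rfl fun a _ => Finset.sum_comm)).symm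

open scoped Classical in
/-- A Lenglart type inequality: the sum of the squared integrals over disjoint cells is controlled
in probability by the integrated square of the integrand. -/
theorem IsBrownian.measure_sum_norm_gridSum_sq_ge_le [IsProbabilityMeasure μ]
    (hW : IsBrownian μ 𝓕 W) (hu : Monotone u) (hc : IsAdaptedCoeff 𝓕 u c) (M L : ℕ)
    (p : ℕ → ℕ → Prop) (hp : ∀ j l l', u j < u (j + 1) → p l j → p l' j → l = l') {ε δ : ℝ}
    (hε : 0 ≤ ε) (hδ : 0 < δ) :
    μ {ω | δ ≤ ∑ l ∈ Finset.range L,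
        ‖gridSum W u M (fun j ω => if p l j then c j ω else 0) ω‖ ^ 2} ≤
      μ {ω | ε < ∑ j ∈ Finset.range M, frobSq (c j ω) * ((u (j + 1) : ℝ) - u j)} +
        ENNReal.ofReal (d * ε / δ) := by
  have hΔ : ∀ j, 0 ≤ (u (j + 1) : ℝ) - u j := fun j => sub_nonneg.2 (hu j.le_succ)
  set A : ℕ → Ω → ℝ := fun j ω =>
    ∑ i ∈ Finset.range j, frobSq (c i ω) * ((u (i + 1) : ℝ) - u i) with hA
  -- The `j`-th coefficient is kept as long as the accumulated energy, the `j`-th cell included, is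
  -- at most `ε`. Only `c 0, …, c j` enter, so the truncation is known at time `u j`.
  set s : ℕ → Set Ω := fun j => {ω | A (j + 1) ω ≤ ε} with hs
  set c' : ℕ → Ω → Matrix (Fin d) (Fin d) ℝ := fun j => (s j).indicator (c j) with hc'
  have hsm : ∀ j, MeasurableSet[𝓕 (u j)] (s j) := fun j => by
    refine measurableSet_setOf_le ?_ measurable_const
    refine Finset.measurable_sum _ fun i hi => Measurable.mul_const ?_ _
    exact (measurable_frobSq_comp fun a b => hc.measurable i a b).mono
      (𝓕.mono (hu (Nat.lt_succ_iff.1 (Finset.mem_range.1 hi)))) le_rfl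
  have hc'a : IsAdaptedCoeff 𝓕 u c' := hc.indicator hsm
  have hAmono : ∀ ω, Monotone fun j => A j ω := fun ω => monotone_nat_of_le_succ fun j => by
    simp only [hA, Finset.sum_range_succ]
    exact le_add_of_nonneg_right (mul_nonneg (frobSq_nonneg _) (hΔ j))
  have hbound : ∀ ω M, ∑ j ∈ Finset.range M, frobSq (c' j ω) * ((u (j + 1) : ℝ) - u j) ≤ ε := by
    intro ω M
    induction M with
    | zero => simpa using hε
    | succ M ih =>
      by_cases h : ω ∈ s M
      · refine le_trans (Finset.sum_le_sum fun j _ => ?_) (show A (M + 1) ω ≤ ε from h)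
        refine mul_le_mul_of_nonneg_right ?_ (hΔ j)
        by_cases h' : ω ∈ s j
        · simp [hc', h']
        · simp [hc', h', frobSq_nonneg]
      · rw [Finset.sum_range_succ]
        simpa [hc', h] using ih
  let q : ℕ → ℕ → Ω → Matrix (Fin d) (Fin d) ℝ := fun l j ω => if p l j then c' j ω else 0
  have hq : ∀ l, IsAdaptedCoeff 𝓕 u (q l) := fun l => by
    have : q l = fun j => ({_ω | p l j} : Set Ω).indicator (c' j) := by
      funext j ω
      by_cases h : p l j <;> simp [q, h]
    rw [this]
    exact hc'a.indicator fun j => MeasurableSet.const _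
  -- Unless the total energy exceeds `ε`, nothing has been truncated.
  have hsub : {ω | δ ≤ ∑ l ∈ Finset.range L,
        ‖gridSum W u M (fun j ω => if p l j then c j ω else 0) ω‖ ^ 2} ⊆
      {ω | ε < A M ω} ∪ {ω | δ ≤ ∑ l ∈ Finset.range L, ‖gridSum W u M (q l) ω‖ ^ 2} := by
    intro ω hω
    by_cases h : ε < A M ω
    · exact Or.inl h
    · refine Or.inr (le_of_le_of_eq (show δ ≤ _ from hω) ?_ : δ ≤ _)
      refine Finset.sum_congr rfl fun l _ => ?_
      congr 2
      unfold gridSum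
      refine Finset.sum_congr rfl fun j hj => ?_
      have : ω ∈ s j := (hAmono ω (Finset.mem_range.1 hj)).trans (not_lt.1 h)
      simp [q, hc', this]
  refine (measure_mono hsub).trans ((measure_union_le _ _).trans (add_le_add le_rfl ?_))
  have hI := fun l => hW.integral_norm_gridSum_sq_le hu (hq l) M
  have hmk := mul_meas_ge_le_integral_of_nonneg (μ := μ)
    (f := fun ω => ∑ l ∈ Finset.range L, ‖gridSum W u M (q l) ω‖ ^ 2)
    (ae_of_all _ fun ω => Finset.sum_nonneg fun _ _ => by positivity)
    (integrable_finsetSum _ fun l _ => (hI l).1) δ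
  have hle : ∫ ω, ∑ l ∈ Finset.range L, ‖gridSum W u M (q l) ω‖ ^ 2 ∂μ ≤ d * ε := by
    rw [integral_finsetSum _ fun l _ => (hI l).1]
    refine (Finset.sum_le_sum fun l _ => (hI l).2).trans ?_
    rw [← Finset.mul_sum]
    gcongr
    rw [Finset.sum_comm]
    -- A cell of positive length belongs to at most one class `l`, so summing the energies over the
    -- classes counts it at most once.
    have hcell : ∀ j, ∑ l ∈ Finset.range L, (∫ ω, frobSq (q l j ω) ∂μ) *
        ((u (j + 1) : ℝ) - u j) ≤ (∫ ω, frobSq (c' j ω) ∂μ) * ((u (j + 1) : ℝ) - u j) := by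
      intro j
      have hnn : 0 ≤ ∫ ω, frobSq (c' j ω) ∂μ := integral_nonneg fun ω => frobSq_nonneg _
      rcases (hu j.le_succ).eq_or_lt with h | h
      · simp [← h]
      · rw [← Finset.sum_mul]
        refine mul_le_mul_of_nonneg_right ?_ (hΔ j)
        by_cases hex : ∃ l₀ ∈ Finset.range L, p l₀ j
        · obtain ⟨l₀, hl₀, hpl⟩ := hex
          rw [Finset.sum_eq_single_of_mem l₀ hl₀ fun l _ hl => ?_]
          · simp [q, hpl]
          · have : ¬ p l j := fun h' => hl (hp j l l₀ h h' hpl)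
            simp [q, this]
        · push Not at hex
          rw [Finset.sum_eq_zero fun l hl => ?_]
          · exact hnn
          · simp [q, hex l hl]
    refine (Finset.sum_le_sum fun j _ => hcell j).trans ?_
    simp_rw [← integral_mul_const]
    rw [← integral_finsetSum _ fun j _ => (hc'a.integrable_frobSq j).mul_const _]
    refine (integral_mono (integrable_finsetSum _ fun j _ =>
      (hc'a.integrable_frobSq j).mul_const _) (integrable_const ε) fun ω => hbound ω M).trans ?_
    simp
  rw [← ofReal_measureReal]
  refine ENNReal.ofReal_le_ofReal ?_
  rw [le_div_iff₀ hδ, mul_comm]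
  exact hmk.trans hle

end

end

/-! ### Realized covariation of elementary integrals, and grids -/

section

variable {d : ℕ} {T : ℝ} {Ω : Type*} {mΩ : MeasurableSpace Ω}

theorem sum_increment_le {u : ℕ → Set.Icc (0 : ℝ) T} (M : ℕ) :
    ∑ j ∈ Finset.range M, ((u (j + 1) : ℝ) - u j) ≤ T := by
  rw [Finset.sum_range_sub (fun j => (u j : ℝ))]
  linarith [(u M).2.2, (u 0).2.1]

section QuadraticVariation

variable {μ : Measure Ω} {𝓕 : Filtration (Set.Icc (0 : ℝ) T) mΩ}
  {W : Set.Icc (0 : ℝ) T → Ω → EuclideanSpace ℝ (Fin d)} {u : ℕ → Set.Icc (0 : ℝ) T}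
  {c : ℕ → Ω → Matrix (Fin d) (Fin d) ℝ}

/-- The difference of the realized covariation of `∑ c_j ΔW_j` and its bracket is small in
probability if the mesh is small. -/
theorem IsBrownian.measure_realized_sub_bracket_ge_le [IsProbabilityMeasure μ]
    (hW : IsBrownian μ 𝓕 W) (hu : Monotone u)
    (hm : ∀ j a b, Measurable[𝓕 (u j)] fun ω => c j ω a b) {C : ℝ}
    (hC : ∀ j ω a b, |c j ω a b| ≤ C) {η : ℝ} (hη : ∀ j, (u (j + 1) : ℝ) - u j ≤ η) (M : ℕ)
    (a b : Fin d) {δ : ℝ} (hδ : 0 < δ) :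
    μ {ω | δ ≤ |∑ j ∈ Finset.range M,
      (Matrix.toEuclideanLin (c j ω) (W (u (j + 1)) ω - W (u j) ω) a *
        Matrix.toEuclideanLin (c j ω) (W (u (j + 1)) ω - W (u j) ω) b -
        (c j ω * (c j ω).transpose) a b * ((u (j + 1) : ℝ) - u j))|} ≤
      ENNReal.ofReal (d ^ 2 * (d ^ 2 * (C ^ 4 * (varianceConst * (η * T)))) / δ ^ 2) := by
  have hj : ∀ j, u j ≤ u (j + 1) := fun j => hu j.le_succ
  have hΔ : ∀ j, 0 ≤ (u (j + 1) : ℝ) - u j := fun j => sub_nonneg.2 (hu j.le_succ)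
  -- Products of increments minus their means are again martingale differences. Their second moments
  -- are of order `(Δu)² ≤ η Δu`, which makes the total small with the mesh.
  let ξ : Fin d × Fin d → ℕ → Ω → ℝ := fun p j ω =>
    (W (u (j + 1)) ω - W (u j) ω) p.1 * (W (u (j + 1)) ω - W (u j) ω) p.2 -
      ((u (j + 1) : ℝ) - u j) * (1 : Matrix (Fin d) (Fin d) ℝ) p.1 p.2
  have hC4 : ∀ p : Fin d × Fin d, ∀ j ω, |c j ω a p.1 * c j ω b p.2| ≤ C ^ 2 := fun p j ω => by
    rw [abs_mul, sq]
    exact mul_le_mul (hC j ω _ _) (hC j ω _ _) (abs_nonneg _) ((abs_nonneg _).trans (hC j ω a p.1))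
  have key : ∀ p : Fin d × Fin d, _ := fun p => integral_sq_sum_eq (μ := μ) (𝒢 := fun j => 𝓕 (u j))
    (fun j => 𝓕.le _) (fun i j hij => 𝓕.mono (hu hij)) (g := fun j ω => c j ω a p.1 * c j ω b p.2)
    (ξ := ξ p) (fun j => (hm j a p.1).mul (hm j b p.2))
    (hC4 p)
    (fun j => ((hW.measurable_increment (hj j) p.1).mul
      (hW.measurable_increment (hj j) p.2)).sub measurable_const)
    (fun j => hW.memLp_increment_mul_sub (hj j) p.1 p.2 _)
    (fun j => by
      have hi : Integrable (fun ω => (W (u (j + 1)) ω - W (u j) ω) p.1 *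
          (W (u (j + 1)) ω - W (u j) ω) p.2) μ :=
        (hW.memLp_increment (hj j) p.1 (p := 2) (by simp)).integrable_mul
          (hW.memLp_increment (hj j) p.2 (p := 2) (by simp))
      rw [integral_sub hi (integrable_const _), hW.integral_increment_mul (hj j)]
      simp)
    (fun j => indep_of_indep_of_le_left (hW.indep _ _ (hj j)) (by
      refine Measurable.comap_le ?_
      have h1 : Measurable fun v : EuclideanSpace ℝ (Fin d) => v p.1 * v p.2 -
        ((u (j + 1) : ℝ) - u j) * (1 : Matrix (Fin d) (Fin d) ℝ) p.1 p.2 := by fun_prop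
      exact h1.comp (comap_measurable _))) M
  have hexp : ∀ ω, ∑ j ∈ Finset.range M,
      (Matrix.toEuclideanLin (c j ω) (W (u (j + 1)) ω - W (u j) ω) a *
        Matrix.toEuclideanLin (c j ω) (W (u (j + 1)) ω - W (u j) ω) b -
        (c j ω * (c j ω).transpose) a b * ((u (j + 1) : ℝ) - u j)) =
      ∑ p : Fin d × Fin d, ∑ j ∈ Finset.range M, c j ω a p.1 * c j ω b p.2 * ξ p j ω := fun ω => by
    rw [Finset.sum_comm]
    refine Finset.sum_congr rfl fun j _ => ?_
    have e1 : (c j ω * (c j ω).transpose) a b =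
        ∑ p : Fin d × Fin d, c j ω a p.1 * c j ω b p.2 *
          (1 : Matrix (Fin d) (Fin d) ℝ) p.1 p.2 := by
      rw [Fintype.sum_prod_type]
      simp [Matrix.mul_apply, Matrix.one_apply]
    rw [toEuclideanLin_apply_apply, toEuclideanLin_apply_apply, Finset.sum_mul_sum,
      ← Finset.sum_product', e1, Finset.sum_mul, ← Finset.univ_product_univ,
      ← Finset.sum_sub_distrib]
    refine Finset.sum_congr rfl fun p _ => ?_
    simp only [ξ]
    ring
  set Z : Ω → ℝ := fun ω => ∑ p : Fin d × Fin d, ∑ j ∈ Finset.range M,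
    c j ω a p.1 * c j ω b p.2 * ξ p j ω with hZ
  simp_rw [hexp]
  have hZm : MemLp Z 2 μ := memLp_finsetSum _ fun p _ => (key p).1
  have hle : ∫ ω, Z ω ^ 2 ∂μ ≤ d ^ 2 * (d ^ 2 * (C ^ 4 * (varianceConst * (η * T)))) := by
    calc ∫ ω, Z ω ^ 2 ∂μ ≤ ∫ ω, ((d : ℝ) ^ 2 * ∑ p : Fin d × Fin d, (∑ j ∈ Finset.range M,
          c j ω a p.1 * c j ω b p.2 * ξ p j ω) ^ 2) ∂μ := by
          refine integral_mono hZm.integrable_sq (Integrable.const_mul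
            (integrable_finsetSum _ fun p _ => (key p).1.integrable_sq) _) fun ω => ?_
          refine (sq_sum_le_card_mul_sum_sq (s := (Finset.univ : Finset (Fin d × Fin d)))).trans ?_
          simp [sq]
      _ = (d : ℝ) ^ 2 * ∑ p : Fin d × Fin d, ∫ ω, (∑ j ∈ Finset.range M,
          c j ω a p.1 * c j ω b p.2 * ξ p j ω) ^ 2 ∂μ := by
          rw [integral_const_mul, integral_finsetSum _ fun p _ => (key p).1.integrable_sq]
      _ ≤ (d : ℝ) ^ 2 * ∑ p : Fin d × Fin d, C ^ 4 * (varianceConst * (η * T)) := by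
          refine mul_le_mul_of_nonneg_left (Finset.sum_le_sum fun p _ => ?_) (by positivity)
          rw [(key p).2]
          have hgi : ∀ j, ∫ ω, (c j ω a p.1 * c j ω b p.2) ^ 2 ∂μ ≤ C ^ 4 := fun j => by
            have h0 : ∀ ω, (c j ω a p.1 * c j ω b p.2) ^ 2 ≤ C ^ 4 := fun ω => by
              rw [← sq_abs, show C ^ 4 = (C ^ 2) ^ 2 by ring]
              exact pow_le_pow_left₀ (abs_nonneg _) (hC4 p j ω) 2
            have := integral_mono_of_nonneg (μ := μ)
              (f := fun ω => (c j ω a p.1 * c j ω b p.2) ^ 2)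
              (ae_of_all _ fun ω => sq_nonneg _) (integrable_const (C ^ 4)) (ae_of_all _ h0)
            simpa using this
          calc _ ≤ ∑ j ∈ Finset.range M, C ^ 4 *
                (varianceConst * (η * ((u (j + 1) : ℝ) - u j))) := by
                refine Finset.sum_le_sum fun j _ => ?_
                refine mul_le_mul (hgi j) ?_ (integral_nonneg fun ω => sq_nonneg _)
                  (Even.pow_nonneg (by decide) _)
                refine (hW.integral_increment_mul_sub_sq_le (hj j) p.1 p.2).trans ?_
                refine mul_le_mul_of_nonneg_left ?_ varianceConst_nonneg
                rw [sq]
                exact mul_le_mul_of_nonneg_right (hη j) (hΔ j)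
            _ ≤ C ^ 4 * (varianceConst * (η * T)) := by
                rw [← Finset.mul_sum, ← Finset.mul_sum, ← Finset.mul_sum]
                refine mul_le_mul_of_nonneg_left (mul_le_mul_of_nonneg_left
                  (mul_le_mul_of_nonneg_left (sum_increment_le M) ((hΔ 0).trans (hη 0)))
                  varianceConst_nonneg) (Even.pow_nonneg (by decide) _)
      _ = _ := by simp [sq]
  have hmk := mul_meas_ge_le_integral_of_nonneg (μ := μ) (f := fun ω => Z ω ^ 2)
    (ae_of_all _ fun ω => sq_nonneg _) hZm.integrable_sq (δ ^ 2)
  have hset : {ω | δ ≤ |Z ω|} = {ω | δ ^ 2 ≤ Z ω ^ 2} := by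
    ext ω
    change δ ≤ |Z ω| ↔ δ ^ 2 ≤ Z ω ^ 2
    rw [← sq_abs (Z ω)]
    exact (pow_le_pow_iff_left₀ hδ.le (abs_nonneg _) two_ne_zero).symm
  rw [hset, ← ofReal_measureReal]
  refine ENNReal.ofReal_le_ofReal ?_
  rw [le_div_iff₀ (by positivity), mul_comm]
  exact hmk.trans hle

end QuadraticVariation

/-! ### Grids -/

/-- A finite grid in `[0,T]` that contains both end points. -/
structure Grid (T : ℝ) where
  u : ℕ → Set.Icc (0 : ℝ) T
  M : ℕ
  mono : Monotone u
  zero : (u 0 : ℝ) = 0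
  top : ∀ j, M ≤ j → (u j : ℝ) = T

/-- The enumeration stays at the maximum from the index `M` on. Grids may therefore have empty
cells, and later statements distinguish cells with `u j < u (j + 1)`. -/
theorem exists_monotone_enumeration {α : Type*} [LinearOrder α] (F : Finset α) (hF : F.Nonempty) :
    ∃ (u : ℕ → α) (M : ℕ), Monotone u ∧ (∀ t, t ∈ F ↔ t ∈ Set.range u) ∧
      (∀ j, M ≤ j → u j = F.max' hF) := by
  induction F using Finset.induction_on_max with
  | empty => simp at hF
  | insert a s hs ih =>
    rcases s.eq_empty_or_nonempty with rfl | hne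
    · exact ⟨fun _ => a, 0, monotone_const, fun t => by simp [eq_comm], fun j _ => by simp⟩
    · obtain ⟨u, M, hu, hr, hM⟩ := ih hne
      have hua : ∀ j, u j < a := fun j => hs _ ((hr _).2 ⟨j, rfl⟩)
      have hmax : (insert a s).max' hF = a := by
        refine le_antisymm (Finset.max'_le _ _ _ fun y hy => ?_)
          (Finset.le_max' _ _ (Finset.mem_insert_self _ _))
        rcases Finset.mem_insert.1 hy with rfl | hy
        · exact le_rfl
        · exact (hs y hy).le
      refine ⟨fun j => if j ≤ M then u j else a, M + 1, fun i j hij => ?_, fun t => ?_,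
        fun j hj => ?_⟩
      · simp only
        split_ifs with h1 h2 h2
        · exact hu hij
        · exact (hua i).le
        · omega
        · exact le_rfl
      · rw [Finset.mem_insert, hr]
        constructor
        · rintro (rfl | ⟨j, rfl⟩)
          · exact ⟨M + 1, by simp⟩
          · rcases le_total j M with h | h
            · exact ⟨j, by simp [h]⟩
            · exact ⟨M, by simp [hM j h, hM M le_rfl]⟩
        · rintro ⟨j, rfl⟩
          simp only
          split_ifs with h
          · exact Or.inr ⟨j, rfl⟩
          · exact Or.inl rfl
      · rw [hmax]
        simp only
        rw [if_neg (by omega)]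

theorem Grid.dichotomy (g : Grid T) {s : Set.Icc (0 : ℝ) T} (hs : s ∈ Set.range g.u) (j : ℕ) :
    s ≤ g.u j ∨ g.u (j + 1) ≤ s := by
  obtain ⟨k, rfl⟩ := hs
  rcases le_or_gt k j with h | h
  · exact Or.inl (g.mono h)
  · exact Or.inr (g.mono h)

theorem exists_grid (hT : 0 < T) (F : Finset (Set.Icc (0 : ℝ) T)) {η : ℝ} (hη : 0 < η) :
    ∃ g : Grid T, (∀ t ∈ F, t ∈ Set.range g.u) ∧ ∀ j, (g.u (j + 1) : ℝ) - g.u j ≤ η := by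
  obtain ⟨N, hN⟩ := exists_nat_gt (T / η)
  have hN0 : 0 < N := by
    have : (0 : ℝ) < N := (by positivity : 0 < T / η).trans hN
    exact_mod_cast this
  have hN0' : (0 : ℝ) < N := by exact_mod_cast hN0
  have hη' : T / N < η := by
    rw [div_lt_iff₀ hN0']
    rwa [div_lt_iff₀ hη, mul_comm] at hN
  let pt : ℕ → Set.Icc (0 : ℝ) T := fun k => Set.projIcc 0 T hT.le (k * (T / N))
  let F' : Finset (Set.Icc (0 : ℝ) T) := F ∪ (Finset.range (N + 1)).image pt
  have hmem : ∀ k ≤ N, pt k ∈ F' := fun k hk => Finset.mem_union_right _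
    (Finset.mem_image_of_mem _ (Finset.mem_range.2 (by omega)))
  have hval : ∀ k ≤ N, (pt k : ℝ) = k * (T / N) := fun k hk => by
    have h : (k : ℝ) * (T / N) ∈ Set.Icc 0 T := by
      refine ⟨by positivity, ?_⟩
      rw [mul_div_assoc', div_le_iff₀ hN0', mul_comm]
      gcongr
    simp only [pt, Set.projIcc_of_mem hT.le h]
  obtain ⟨u, M, hu, hr, hM⟩ := exists_monotone_enumeration F' ⟨_, hmem 0 (Nat.zero_le _)⟩
  have h0 : (pt 0 : ℝ) = 0 := by simp [hval 0 (Nat.zero_le _)]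
  have hTop : (pt N : ℝ) = T := by
    rw [hval N le_rfl]
    field_simp
  refine ⟨⟨u, M, hu, ?_, fun j hj => ?_⟩, fun t ht => (hr t).1 (Finset.mem_union_left _ ht), ?_⟩
  · obtain ⟨k, hk⟩ := (hr _).1 (hmem 0 (Nat.zero_le _))
    have : (u 0 : ℝ) ≤ u k := hu (Nat.zero_le k)
    rw [hk, h0] at this
    exact le_antisymm this (u 0).2.1
  · have : (pt N : ℝ) ≤ u j := by
      rw [hM j hj]
      exact Finset.le_max' _ _ (hmem N le_rfl)
    rw [hTop] at this
    exact le_antisymm (u j).2.2 this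
  · intro j
    by_contra hcon
    push Not at hcon
    change η < (u (j + 1) : ℝ) - u j at hcon
    -- If the gap after `u j` exceeded `η`, the first multiple of `T / N` beyond `u j` would be a
    -- grid point strictly inside it.
    obtain ⟨k, hk1, hk2⟩ : ∃ k ≤ N, (u j : ℝ) < pt k ∧ (pt k : ℝ) ≤ u j + T / N := by
      have hTN : 0 < T / N := by positivity
      have hnn : 0 ≤ (u j : ℝ) / (T / N) := div_nonneg (u j).2.1 hTN.le
      have hle : ⌊(u j : ℝ) / (T / N)⌋₊ + 1 ≤ N := by
        have hlt : (u j : ℝ) < T := by linarith [(u (j + 1)).2.2]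
        have : (u j : ℝ) / (T / N) < N := by
          rw [div_lt_iff₀ hTN]
          field_simp
          exact hlt
        exact (Nat.floor_lt hnn).2 this
      refine ⟨⌊(u j : ℝ) / (T / N)⌋₊ + 1, hle, ?_⟩
      rw [hval _ hle]
      have h1 := Nat.floor_le hnn
      have h2 := Nat.lt_floor_add_one ((u j : ℝ) / (T / N))
      rw [le_div_iff₀ hTN] at h1
      rw [div_lt_iff₀ hTN] at h2
      push_cast
      constructor
      · exact h2
      · linarith
    obtain ⟨i, hi⟩ := (hr _).1 (hmem k hk1)
    rcases le_or_gt i j with h | h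
    · have : (u i : ℝ) ≤ u j := hu h
      rw [hi] at this
      linarith [hk2.1]
    · have : (u (j + 1) : ℝ) ≤ u i := hu h
      rw [hi] at this
      linarith [hk2.2]

end

/-! ### Time integrals and step processes on grids -/

section

variable {d : ℕ} {T : ℝ} {Ω : Type*} {mΩ : MeasurableSpace Ω}

section TimeMeasure

theorem timeMeasure_apply (s : Set (Set.Icc (0 : ℝ) T)) :
    timeMeasure T s = volume (Subtype.val '' s) :=
  comap_subtype_coe_apply measurableSet_Icc _ _

instance timeMeasure.isFiniteMeasure : IsFiniteMeasure (timeMeasure T) := ⟨by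
  rw [timeMeasure_apply, Set.image_univ, Subtype.range_coe]
  exact measure_Icc_lt_top⟩

instance timeMeasure.nullSingletonClass : NullSingletonClass (timeMeasure T) := ⟨fun x => by
  rw [timeMeasure_apply, Set.image_singleton, measure_singleton]⟩

theorem timeMeasure_Ioc (s t : Set.Icc (0 : ℝ) T) :
    timeMeasure T (Set.Ioc s t) = ENNReal.ofReal ((t : ℝ) - s) := by
  have : Subtype.val '' Set.Ioc s t = Set.Ioc (s : ℝ) t := by
    ext x
    constructor
    · rintro ⟨y, hy, rfl⟩
      exact hy
    · intro hx
      exact ⟨⟨x, s.2.1.trans hx.1.le, hx.2.trans t.2.2⟩, hx, rfl⟩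
  rw [timeMeasure_apply, this, Real.volume_Ioc]

end TimeMeasure

namespace Grid

variable (g : Grid T)

theorem exists_cell {s : Set.Icc (0 : ℝ) T} (hs : 0 < (s : ℝ)) :
    ∃ j < g.M, g.u j < s ∧ s ≤ g.u (j + 1) := by
  classical
  have hex : ∃ k, s ≤ g.u k := ⟨g.M, by
    change (s : ℝ) ≤ g.u g.M
    rw [g.top _ le_rfl]
    exact s.2.2⟩
  have hk0 : Nat.find hex ≠ 0 := fun h => by
    have h1 := Nat.find_spec hex
    rw [h] at h1
    have h2 : (s : ℝ) ≤ g.u 0 := h1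
    rw [g.zero] at h2
    linarith
  obtain ⟨j, hj⟩ := Nat.exists_eq_succ_of_ne_zero hk0
  have h1 : g.u j < s := not_le.1 (Nat.find_min hex (by omega))
  refine ⟨j, ?_, h1, by simpa [hj] using Nat.find_spec hex⟩
  by_contra hjM
  have h2 : (g.u j : ℝ) < s := h1
  rw [g.top j (not_lt.1 hjM)] at h2
  exact absurd s.2.2 (not_le.2 h2)

theorem cell_unique {s : Set.Icc (0 : ℝ) T} {i j : ℕ} (hi : g.u i < s ∧ s ≤ g.u (i + 1))
    (hj : g.u j < s ∧ s ≤ g.u (j + 1)) : i = j := by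
  by_contra hne
  rcases lt_or_gt_of_ne hne with h | h
  · exact absurd (hi.2.trans (g.mono h)) (not_le.2 hj.1)
  · exact absurd (hj.2.trans (g.mono h)) (not_le.2 hi.1)

/-- A function on `[0,T]` is a step function on the grid if it is constant on the half-open
cells. -/
theorem ae_eq_sum_indicator {β : Type*} [AddCommMonoid β] {f : Set.Icc (0 : ℝ) T → β}
    (hf : ∀ j s, g.u j < s → s ≤ g.u (j + 1) → f s = f (g.u (j + 1))) :
    f =ᵐ[timeMeasure T] fun s => ∑ j ∈ Finset.range g.M,
      (Set.Ioc (g.u j) (g.u (j + 1))).indicator (fun _ => f (g.u (j + 1))) s := by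
  -- The half-open cells miss only time `0`.
  have h0 : ∀ᵐ s ∂(timeMeasure T), s ≠ g.u 0 := by
    rw [ae_iff]
    simp
  filter_upwards [h0] with s hs
  have hs0 : 0 < (s : ℝ) := by
    refine lt_of_le_of_ne s.2.1 fun h => hs (Subtype.ext ?_)
    rw [g.zero, ← h]
  obtain ⟨j, hjM, hj⟩ := g.exists_cell hs0
  rw [Finset.sum_eq_single_of_mem j (Finset.mem_range.2 hjM) fun i _ hij => ?_]
  · rw [Set.indicator_of_mem (show s ∈ Set.Ioc _ _ from hj), hf j s hj.1 hj.2]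
  · exact Set.indicator_of_notMem
      (fun hi : s ∈ Set.Ioc _ _ => hij (g.cell_unique ⟨hi.1, hi.2⟩ hj)) _

theorem lintegral_eq_sum {f : Set.Icc (0 : ℝ) T → ℝ≥0∞}
    (hf : ∀ j s, g.u j < s → s ≤ g.u (j + 1) → f s = f (g.u (j + 1))) :
    ∫⁻ s, f s ∂(timeMeasure T) = ∑ j ∈ Finset.range g.M,
      f (g.u (j + 1)) * ENNReal.ofReal ((g.u (j + 1) : ℝ) - g.u j) := by
  rw [lintegral_congr_ae (g.ae_eq_sum_indicator hf),
    lintegral_finsetSum _ fun j _ => measurable_const.indicator measurableSet_Ioc]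
  refine Finset.sum_congr rfl fun j _ => ?_
  rw [lintegral_indicator measurableSet_Ioc, setLIntegral_const, timeMeasure_Ioc]

theorem integral_eq_sum {f : Set.Icc (0 : ℝ) T → ℝ}
    (hf : ∀ j s, g.u j < s → s ≤ g.u (j + 1) → f s = f (g.u (j + 1))) :
    ∫ s, f s ∂(timeMeasure T) = ∑ j ∈ Finset.range g.M,
      f (g.u (j + 1)) * ((g.u (j + 1) : ℝ) - g.u j) := by
  rw [integral_congr_ae (g.ae_eq_sum_indicator hf),
    integral_finsetSum _ fun j _ => (integrable_const _).indicator measurableSet_Ioc]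
  refine Finset.sum_congr rfl fun j _ => ?_
  rw [integral_indicator measurableSet_Ioc, setIntegral_const, measureReal_def, timeMeasure_Ioc,
    ENNReal.toReal_ofReal (sub_nonneg.2 (g.mono j.le_succ)), smul_eq_mul, mul_comm]

theorem ofReal_sum_eq_lintegral {f : Set.Icc (0 : ℝ) T → ℝ} (h0 : ∀ s, 0 ≤ f s)
    (hf : ∀ j s, g.u j < s → s ≤ g.u (j + 1) → f s = f (g.u (j + 1))) :
    ENNReal.ofReal (∑ j ∈ Finset.range g.M, f (g.u (j + 1)) * ((g.u (j + 1) : ℝ) - g.u j)) =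
      ∫⁻ s, ENNReal.ofReal (f s) ∂(timeMeasure T) := by
  have hΔ : ∀ j, 0 ≤ (g.u (j + 1) : ℝ) - g.u j := fun j => sub_nonneg.2 (g.mono j.le_succ)
  rw [g.lintegral_eq_sum fun j s h1 h2 => by rw [hf j s h1 h2],
    ENNReal.ofReal_sum_of_nonneg fun j _ => mul_nonneg (h0 _) (hΔ j)]
  exact Finset.sum_congr rfl fun j _ => ENNReal.ofReal_mul (h0 _)

theorem aemeasurable_of_step {β : Type*} [AddCommMonoid β] [MeasurableSpace β] [MeasurableAdd₂ β]
    {f : Set.Icc (0 : ℝ) T → β}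
    (hf : ∀ j s, g.u j < s → s ≤ g.u (j + 1) → f s = f (g.u (j + 1))) :
    AEMeasurable f (timeMeasure T) :=
  ⟨_, Finset.measurable_sum _ fun _ _ => measurable_const.indicator measurableSet_Ioc,
    g.ae_eq_sum_indicator hf⟩

end Grid

/-- `V` is a bounded step process whose jumps occur only at the points of the grid and whose value
on a cell is known at the left end point of the cell. -/
structure IsStepOn (𝓕 : Filtration (Set.Icc (0 : ℝ) T) mΩ) (g : Grid T)
    (V : Set.Icc (0 : ℝ) T → Ω → Matrix (Fin d) (Fin d) ℝ) : Prop where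
  const : ∀ j s, g.u j < s → s ≤ g.u (j + 1) → V s = V (g.u (j + 1))
  measurable : ∀ j, g.u j < g.u (j + 1) → ∀ a b,
    Measurable[𝓕 (g.u j)] fun ω => V (g.u (j + 1)) ω a b
  bounded : ∃ C : ℝ, ∀ s ω a b, |V s ω a b| ≤ C

/-- The integral up to a grid point of a step process on a grid. -/
def Grid.stepInt (g : Grid T) (W : Set.Icc (0 : ℝ) T → Ω → EuclideanSpace ℝ (Fin d))
    (V : Set.Icc (0 : ℝ) T → Ω → Matrix (Fin d) (Fin d) ℝ) (t : Set.Icc (0 : ℝ) T) (ω : Ω) :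
    EuclideanSpace ℝ (Fin d) :=
  ∑ j ∈ Finset.range g.M, if g.u (j + 1) ≤ t then
    Matrix.toEuclideanLin (V (g.u (j + 1)) ω) (W (g.u (j + 1)) ω - W (g.u j) ω) else 0

open scoped Classical in
/-- The coefficients of a step process on a grid. -/
def Grid.coeff (g : Grid T) (V : Set.Icc (0 : ℝ) T → Ω → Matrix (Fin d) (Fin d) ℝ) (j : ℕ) (ω : Ω) :
    Matrix (Fin d) (Fin d) ℝ :=
  -- On an empty cell `V` need not be known at the left end; the value `0` keeps the coefficient
  -- adapted, and the increment vanishes there anyway.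
  if g.u j < g.u (j + 1) then V (g.u (j + 1)) ω else 0

section Step

variable {𝓕 : Filtration (Set.Icc (0 : ℝ) T) mΩ} {g g' : Grid T}
  {V V' : Set.Icc (0 : ℝ) T → Ω → Matrix (Fin d) (Fin d) ℝ}
  {W : Set.Icc (0 : ℝ) T → Ω → EuclideanSpace ℝ (Fin d)}

theorem Grid.abs_coeff_le {C : ℝ} (hC0 : 0 ≤ C) (hC : ∀ s ω a b, |V s ω a b| ≤ C) (j : ℕ) (ω : Ω)
    (a b : Fin d) : |g.coeff V j ω a b| ≤ C := by
  unfold Grid.coeff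
  split_ifs
  · exact hC _ _ _ _
  · simpa using hC0

theorem IsStepOn.measurable_coeff (hV : IsStepOn 𝓕 g V) (j : ℕ) (a b : Fin d) :
    Measurable[𝓕 (g.u j)] fun ω => g.coeff V j ω a b := by
  by_cases h : g.u j < g.u (j + 1)
  · simpa [Grid.coeff, h] using hV.measurable j h a b
  · simp [Grid.coeff, h]

theorem IsStepOn.isAdaptedCoeff (hV : IsStepOn 𝓕 g V) : IsAdaptedCoeff 𝓕 g.u (g.coeff V) := by
  obtain ⟨C, hC⟩ := hV.bounded
  exact ⟨hV.measurable_coeff, max C 0, Grid.abs_coeff_le (le_max_right _ _)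
    fun s ω a b => (hC s ω a b).trans (le_max_left _ _)⟩

theorem Grid.toEuclideanLin_coeff (g : Grid T) (j : ℕ) (ω : Ω) :
    Matrix.toEuclideanLin (g.coeff V j ω) (W (g.u (j + 1)) ω - W (g.u j) ω) =
      Matrix.toEuclideanLin (V (g.u (j + 1)) ω) (W (g.u (j + 1)) ω - W (g.u j) ω) := by
  unfold Grid.coeff
  split_ifs with h
  · rfl
  · rw [(g.mono j.le_succ).antisymm (not_lt.1 h), sub_self, map_zero, map_zero]

theorem Grid.frobSq_coeff_mul (g : Grid T) (j : ℕ) (ω : Ω) :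
    frobSq (g.coeff V j ω) * ((g.u (j + 1) : ℝ) - g.u j) =
      frobSq (V (g.u (j + 1)) ω) * ((g.u (j + 1) : ℝ) - g.u j) := by
  unfold Grid.coeff
  split_ifs with h
  · rfl
  · rw [(g.mono j.le_succ).antisymm (not_lt.1 h), sub_self, mul_zero, mul_zero]

theorem Grid.exists_coarse_cell (hgg : Set.range g.u ⊆ Set.range g'.u) {j : ℕ}
    (hj : g'.u j < g'.u (j + 1)) : ∃ k < g.M, g.u k ≤ g'.u j ∧ g'.u (j + 1) ≤ g.u (k + 1) := by
  have h0 : 0 < (g'.u (j + 1) : ℝ) := lt_of_le_of_lt (g'.u j).2.1 hj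
  obtain ⟨k, hkM, hk1, hk2⟩ := g.exists_cell h0
  exact ⟨k, hkM, (g'.dichotomy (hgg ⟨k, rfl⟩) j).resolve_right (not_le.2 hk1), hk2⟩

theorem IsStepOn.refine (hV : IsStepOn 𝓕 g V) (hgg : Set.range g.u ⊆ Set.range g'.u) :
    IsStepOn 𝓕 g' V where
  const j s h1 h2 := by
    obtain ⟨k, -, hk1, hk2⟩ := Grid.exists_coarse_cell hgg (h1.trans_le h2)
    rw [hV.const k s (hk1.trans_lt h1) (h2.trans hk2),
      hV.const k _ (hk1.trans_lt (h1.trans_le h2)) hk2]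
  measurable j hj a b := by
    obtain ⟨k, -, hk1, hk2⟩ := Grid.exists_coarse_cell hgg hj
    rw [hV.const k _ (hk1.trans_lt hj) hk2]
    exact (hV.measurable k (hk1.trans_lt (hj.trans_le hk2)) a b).mono (𝓕.mono hk1) le_rfl
  bounded := hV.bounded

theorem IsStepOn.sub (hV : IsStepOn 𝓕 g V) (hV' : IsStepOn 𝓕 g V') :
    IsStepOn 𝓕 g fun s ω => V s ω - V' s ω := by
  obtain ⟨C, hC⟩ := hV.bounded
  obtain ⟨C', hC'⟩ := hV'.bounded
  refine ⟨fun j s h1 h2 => by rw [hV.const j s h1 h2, hV'.const j s h1 h2],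
    fun j hj a b => (hV.measurable j hj a b).sub (hV'.measurable j hj a b), C + C',
    fun s ω a b => ?_⟩
  exact (abs_sub _ _).trans (add_le_add (hC s ω a b) (hC' s ω a b))

theorem IsStepOn.mul (hV : IsStepOn 𝓕 g V) (hV' : IsStepOn 𝓕 g V') :
    IsStepOn 𝓕 g fun s ω => V s ω * V' s ω := by
  obtain ⟨C, hC⟩ := hV.bounded
  obtain ⟨C', hC'⟩ := hV'.bounded
  refine ⟨fun j s h1 h2 => by rw [hV.const j s h1 h2, hV'.const j s h1 h2], fun j hj a b => ?_,
    ∑ _b : Fin d, C * C', fun s ω a b => ?_⟩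
  · simp only [Matrix.mul_apply]
    exact Finset.measurable_sum _ fun c _ => (hV.measurable j hj a c).mul (hV'.measurable j hj c b)
  · rw [Matrix.mul_apply]
    refine (Finset.abs_sum_le_sum_abs _ _).trans (Finset.sum_le_sum fun c _ => ?_)
    rw [abs_mul]
    exact mul_le_mul (hC _ _ _ _) (hC' _ _ _ _) (abs_nonneg _)
      ((abs_nonneg _).trans (hC s ω a c))

open scoped Classical in
theorem Grid.stepInt_sub_stepInt (g : Grid T) {s t : Set.Icc (0 : ℝ) T} (hst : s ≤ t)
    (hs : s ∈ Set.range g.u) (ω : Ω) :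
    g.stepInt W V t ω - g.stepInt W V s ω = ∑ j ∈ Finset.range g.M,
      if s ≤ g.u j ∧ g.u (j + 1) ≤ t then
        Matrix.toEuclideanLin (V (g.u (j + 1)) ω) (W (g.u (j + 1)) ω - W (g.u j) ω) else 0 := by
  rw [Grid.stepInt, Grid.stepInt, ← Finset.sum_sub_distrib]
  refine Finset.sum_congr rfl fun j _ => ?_
  rcases (g.mono j.le_succ).eq_or_lt with h | h
  · rw [Nat.succ_eq_add_one] at h
    simp [← h]
  rcases g.dichotomy hs j with h1 | h1
  · have h2 : ¬ g.u (j + 1) ≤ s := not_le.2 (h1.trans_lt h)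
    simp [h1, h2]
  · have h2 : ¬ s ≤ g.u j := not_le.2 (h.trans_le h1)
    simp [h1, h2, h1.trans hst]

open scoped Classical in
theorem Grid.increment_eq_sum (g : Grid T) {s t : Set.Icc (0 : ℝ) T} (hst : s ≤ t)
    (hs : s ∈ Set.range g.u) (ht : t ∈ Set.range g.u) (ω : Ω) :
    W t ω - W s ω = ∑ j ∈ Finset.range g.M,
      if s ≤ g.u j ∧ g.u (j + 1) ≤ t then W (g.u (j + 1)) ω - W (g.u j) ω else 0 := by
  have key : ∀ r ∈ Set.range g.u, W r ω - W (g.u 0) ω = ∑ j ∈ Finset.range g.M,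
      if g.u (j + 1) ≤ r then W (g.u (j + 1)) ω - W (g.u j) ω else 0 := by
    rintro r ⟨k, rfl⟩
    obtain ⟨k', hk, hkk⟩ : ∃ k' ≤ g.M, g.u k = g.u k' := by
      rcases le_total k g.M with h | h
      · exact ⟨k, h, rfl⟩
      · exact ⟨g.M, le_rfl, Subtype.ext ((g.top k h).trans (g.top _ le_rfl).symm)⟩
    rw [hkk]
    clear hkk k
    rw [← Finset.sum_range_sub (fun j => W (g.u j) ω), ← Finset.sum_subset
      (Finset.range_mono hk) (s₁ := Finset.range k') (s₂ := Finset.range g.M)]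
    · refine Finset.sum_congr rfl fun j hj => ?_
      rw [if_pos (g.mono (Finset.mem_range.1 hj))]
    · intro j _ hj
      have hkj : k' ≤ j := not_lt.1 fun h => hj (Finset.mem_range.2 h)
      split_ifs with h
      · have h1 := g.mono hkj
        have h2 := g.mono j.le_succ
        rw [(h2.antisymm (h.trans h1) : g.u j = g.u (j + 1)), sub_self]
      · rfl
  have h1 : W t ω - W s ω = (W t ω - W (g.u 0) ω) - (W s ω - W (g.u 0) ω) := by abel
  rw [h1, key t ht, key s hs, ← Finset.sum_sub_distrib]
  refine Finset.sum_congr rfl fun j _ => ?_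
  rcases (g.mono j.le_succ).eq_or_lt with h | h
  · rw [Nat.succ_eq_add_one] at h
    simp [← h]
  rcases g.dichotomy hs j with h1 | h1
  · have h2 : ¬ g.u (j + 1) ≤ s := not_le.2 (h1.trans_lt h)
    simp [h1, h2]
  · have h2 : ¬ s ≤ g.u j := not_le.2 (h.trans_le h1)
    simp [h1, h2, h1.trans hst]

end Step

end

/-! ### Itô integrals as limits of step integrals, and integration against them -/

section

variable {d : ℕ} {T : ℝ} {Ω : Type*} {mΩ : MeasurableSpace Ω}

theorem frobSq_mul_le (A B : Matrix (Fin d) (Fin d) ℝ) :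
    frobSq (A * B) ≤ frobSq A * frobSq B := by
  have h : ∀ a b, (A * B) a b ^ 2 ≤ (∑ c, A a c ^ 2) * ∑ c, B c b ^ 2 := fun a b => by
    rw [Matrix.mul_apply]
    exact Finset.sum_mul_sq_le_sq_mul_sq _ _ _
  calc frobSq (A * B) ≤ ∑ a, ∑ b, (∑ c, A a c ^ 2) * ∑ c, B c b ^ 2 :=
        Finset.sum_le_sum fun a _ => Finset.sum_le_sum fun b _ => h a b
    _ = frobSq A * frobSq B := by
        simp_rw [← Finset.mul_sum, ← Finset.sum_mul, frobSq]
        rw [Finset.sum_comm (f := fun b c => B c b ^ 2)]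

theorem frobSq_add_le (A B : Matrix (Fin d) (Fin d) ℝ) :
    frobSq (A + B) ≤ 2 * frobSq A + 2 * frobSq B := by
  simp only [frobSq, Finset.mul_sum, ← Finset.sum_add_distrib, Matrix.add_apply]
  refine Finset.sum_le_sum fun a _ => Finset.sum_le_sum fun b _ => ?_
  nlinarith [sq_nonneg (A a b - B a b)]

theorem norm_toEuclideanLin_sq_le (A : Matrix (Fin d) (Fin d) ℝ) (v : EuclideanSpace ℝ (Fin d)) :
    ‖Matrix.toEuclideanLin A v‖ ^ 2 ≤ frobSq A * ‖v‖ ^ 2 := by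
  rw [EuclideanSpace.real_norm_sq_eq, EuclideanSpace.real_norm_sq_eq, frobSq, Finset.sum_mul]
  refine Finset.sum_le_sum fun a _ => ?_
  rw [toEuclideanLin_apply_apply]
  exact Finset.sum_mul_sq_le_sq_mul_sq _ _ _

/-- The step processes `S n`, which jump at most at the points of `F n`, approximate the integrand
`H`, and their integrals `Y n` approximate `X`. -/
structure ItoApprox (μ : Measure Ω) (𝓕 : Filtration (Set.Icc (0 : ℝ) T) mΩ)
    (W : Set.Icc (0 : ℝ) T → Ω → EuclideanSpace ℝ (Fin d))
    (H : Set.Icc (0 : ℝ) T → Ω → Matrix (Fin d) (Fin d) ℝ)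
    (X : Set.Icc (0 : ℝ) T → Ω → EuclideanSpace ℝ (Fin d))
    (S : ℕ → Set.Icc (0 : ℝ) T → Ω → Matrix (Fin d) (Fin d) ℝ)
    (Y : ℕ → Set.Icc (0 : ℝ) T → Ω → EuclideanSpace ℝ (Fin d))
    (F : ℕ → Finset (Set.Icc (0 : ℝ) T)) : Prop where
  -- The quantification over every grid that contains `F n` makes passage to common refinements
  -- free.
  isStepOn : ∀ n (g : Grid T), (∀ t ∈ F n, t ∈ Set.range g.u) → IsStepOn 𝓕 g (S n)
  eq_stepInt : ∀ n (g : Grid T), (∀ t ∈ F n, t ∈ Set.range g.u) → ∀ t ∈ Set.range g.u, ∀ ω,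
    Y n t ω = g.stepInt W (S n) t ω
  measurable_integrand : ∀ ω a b, Measurable fun t => H t ω a b
  tendsto_integrand : ∀ ε : ℝ≥0∞, 0 < ε → Tendsto (fun n => μ {ω | ε ≤
    ∫⁻ t, ENNReal.ofReal (frobSq (S n t ω - H t ω)) ∂(timeMeasure T)}) atTop (𝓝 0)
  tendsto_integral : ∀ t, ∀ ε : ℝ, 0 < ε →
    Tendsto (fun n => μ {ω | ε ≤ ‖X t ω - Y n t ω‖}) atTop (𝓝 0)

section

variable {μ : Measure Ω} {𝓕 : Filtration (Set.Icc (0 : ℝ) T) mΩ}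
  {W X : Set.Icc (0 : ℝ) T → Ω → EuclideanSpace ℝ (Fin d)}
  {H : Set.Icc (0 : ℝ) T → Ω → Matrix (Fin d) (Fin d) ℝ}
  {S : ℕ → Set.Icc (0 : ℝ) T → Ω → Matrix (Fin d) (Fin d) ℝ}
  {Y : ℕ → Set.Icc (0 : ℝ) T → Ω → EuclideanSpace ℝ (Fin d)}
  {F : ℕ → Finset (Set.Icc (0 : ℝ) T)}

/-- The part of `∑_k (K_k ΔX_k - D_k ΔW_k)` over the indices `k` that satisfy `c`. -/
def Grid.residual (g : Grid T) (W X : Set.Icc (0 : ℝ) T → Ω → EuclideanSpace ℝ (Fin d))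
    (K D : Set.Icc (0 : ℝ) T → Ω → Matrix (Fin d) (Fin d) ℝ) (c : ℕ → Prop) [DecidablePred c]
    (ω : Ω) : EuclideanSpace ℝ (Fin d) :=
  ∑ k ∈ Finset.range g.M, if c k then
    Matrix.toEuclideanLin (K (g.u (k + 1)) ω) (X (g.u (k + 1)) ω - X (g.u k) ω) -
      Matrix.toEuclideanLin (D (g.u (k + 1)) ω) (W (g.u (k + 1)) ω - W (g.u k) ω) else 0

-- For an elementary integral `y` of `V`, the sum of `K Δy - D ΔW` over coarse cells unfolds into
-- the elementary integral of `K V - D` over fine cells. The map `κ` sends a fine cell to the coarse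
-- cell that contains it.
open scoped Classical in
theorem Grid.residual_eq_gridSum {g g' : Grid T} (hgg : Set.range g.u ⊆ Set.range g'.u)
    {K D V : Set.Icc (0 : ℝ) T → Ω → Matrix (Fin d) (Fin d) ℝ}
    (hK : IsStepOn 𝓕 g K) (hD : IsStepOn 𝓕 g D)
    {y : Set.Icc (0 : ℝ) T → Ω → EuclideanSpace ℝ (Fin d)}
    (hy : ∀ t ∈ Set.range g'.u, ∀ ω, y t ω = g'.stepInt W V t ω) {κ : ℕ → ℕ}
    (hκ : ∀ j, g'.u j < g'.u (j + 1) → κ j < g.M ∧ g.u (κ j) ≤ g'.u j ∧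
      g'.u (j + 1) ≤ g.u (κ j + 1)) (c : ℕ → Prop) (ω : Ω) :
    g.residual W y K D c ω = gridSum W g'.u g'.M (fun j ω => if c (κ j) then
      g'.coeff (fun s ω => K s ω * V s ω - D s ω) j ω else 0) ω := by
  have hterm : ∀ k, Matrix.toEuclideanLin (K (g.u (k + 1)) ω) (y (g.u (k + 1)) ω - y (g.u k) ω) -
      Matrix.toEuclideanLin (D (g.u (k + 1)) ω) (W (g.u (k + 1)) ω - W (g.u k) ω) =
      ∑ j ∈ Finset.range g'.M, if g.u k ≤ g'.u j ∧ g'.u (j + 1) ≤ g.u (k + 1) then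
        Matrix.toEuclideanLin (K (g.u (k + 1)) ω * V (g'.u (j + 1)) ω - D (g.u (k + 1)) ω)
          (W (g'.u (j + 1)) ω - W (g'.u j) ω) else 0 := by
    intro k
    have hk : g.u k ≤ g.u (k + 1) := g.mono k.le_succ
    have m1 := hgg ⟨k, rfl⟩
    have m2 := hgg ⟨k + 1, rfl⟩
    rw [hy _ m2, hy _ m1, g'.stepInt_sub_stepInt hk m1, g'.increment_eq_sum hk m1 m2, map_sum,
      map_sum, ← Finset.sum_sub_distrib]
    refine Finset.sum_congr rfl fun j _ => ?_
    split_ifs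
    · rw [map_sub (Matrix.toEuclideanLin), LinearMap.sub_apply]
      congr 1
      ext a
      simp only [Matrix.toLpLin_apply]
      rw [Matrix.mulVec_mulVec]
    · simp
  unfold Grid.residual gridSum
  simp_rw [hterm]
  have hpush : ∀ k, (if c k then ∑ j ∈ Finset.range g'.M,
      if g.u k ≤ g'.u j ∧ g'.u (j + 1) ≤ g.u (k + 1) then
        Matrix.toEuclideanLin (K (g.u (k + 1)) ω * V (g'.u (j + 1)) ω - D (g.u (k + 1)) ω)
          (W (g'.u (j + 1)) ω - W (g'.u j) ω) else 0 else 0) =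
      ∑ j ∈ Finset.range g'.M, if c k then
        (if g.u k ≤ g'.u j ∧ g'.u (j + 1) ≤ g.u (k + 1) then
        Matrix.toEuclideanLin (K (g.u (k + 1)) ω * V (g'.u (j + 1)) ω - D (g.u (k + 1)) ω)
          (W (g'.u (j + 1)) ω - W (g'.u j) ω) else 0) else 0 := fun k => by
    split_ifs
    · rfl
    · simp
  simp_rw [hpush]
  rw [Finset.sum_comm]
  refine Finset.sum_congr rfl fun j _ => ?_
  rcases (g'.mono j.le_succ).eq_or_lt with h | h
  · rw [Nat.succ_eq_add_one] at h
    simp [← h]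
  · obtain ⟨h1, h2, h3⟩ := hκ j h
    rw [Finset.sum_eq_single_of_mem (κ j) (Finset.mem_range.2 h1) fun k _ hk => ?_]
    · by_cases hc : c (κ j)
      · simp only [hc, if_true, h2, h3, and_self]
        rw [Grid.coeff, if_pos h, hK.const (κ j) _ (h2.trans_lt h) h3,
          hD.const (κ j) _ (h2.trans_lt h) h3]
      · simp [hc]
    · have : ¬ (g.u k ≤ g'.u j ∧ g'.u (j + 1) ≤ g.u (k + 1)) := fun hh =>
        hk (g.cell_unique ⟨hh.1.trans_lt h, hh.2⟩ ⟨h2.trans_lt h, h3⟩)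
      simp [this]

/-- The factor `g.M` is harmless, because the coarse grid stays fixed while the approximation of `X`
improves. -/
theorem Grid.residual_sub_residual (g : Grid T)
    (K D : Set.Icc (0 : ℝ) T → Ω → Matrix (Fin d) (Fin d) ℝ) (c : ℕ → Prop) [DecidablePred c]
    (y : Set.Icc (0 : ℝ) T → Ω → EuclideanSpace ℝ (Fin d)) (ω : Ω) {B ρ : ℝ} (hB : 0 ≤ B)
    (hK : ∀ s, frobSq (K s ω) ≤ B ^ 2) (hρ : 0 ≤ ρ)
    (h : ∀ k ≤ g.M, ‖X (g.u k) ω - y (g.u k) ω‖ ≤ ρ) :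
    ‖g.residual W X K D c ω - g.residual W y K D c ω‖ ≤ g.M * (B * (2 * ρ)) := by
  unfold Grid.residual
  rw [← Finset.sum_sub_distrib]
  refine (norm_sum_le _ _).trans ?_
  have hb : ∀ k ∈ Finset.range g.M, ‖(if c k then
      Matrix.toEuclideanLin (K (g.u (k + 1)) ω) (X (g.u (k + 1)) ω - X (g.u k) ω) -
        Matrix.toEuclideanLin (D (g.u (k + 1)) ω) (W (g.u (k + 1)) ω - W (g.u k) ω) else 0) -
      (if c k then
      Matrix.toEuclideanLin (K (g.u (k + 1)) ω) (y (g.u (k + 1)) ω - y (g.u k) ω) -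
        Matrix.toEuclideanLin (D (g.u (k + 1)) ω) (W (g.u (k + 1)) ω - W (g.u k) ω) else 0)‖ ≤
      B * (2 * ρ) := by
    intro k hk
    have hk' := Finset.mem_range.1 hk
    split_ifs
    · rw [sub_sub_sub_cancel_right, ← map_sub]
      have e : X (g.u (k + 1)) ω - X (g.u k) ω - (y (g.u (k + 1)) ω - y (g.u k) ω) =
          (X (g.u (k + 1)) ω - y (g.u (k + 1)) ω) - (X (g.u k) ω - y (g.u k) ω) := by abel
      rw [e]
      set v := (X (g.u (k + 1)) ω - y (g.u (k + 1)) ω) - (X (g.u k) ω - y (g.u k) ω)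
      have hv : ‖v‖ ≤ 2 * ρ := (norm_sub_le _ _).trans
        (by linarith [h (k + 1) hk', h k hk'.le])
      refine le_of_sq_le_sq ?_ (by positivity)
      refine (norm_toEuclideanLin_sq_le _ _).trans ?_
      rw [mul_pow]
      exact mul_le_mul (hK _) (pow_le_pow_left₀ (norm_nonneg _) hv 2) (by positivity)
        (by positivity)
    · simp only [sub_self, norm_zero]
      positivity
  refine (Finset.sum_le_sum hb).trans ?_
  simp

open scoped Classical in
/-- If `X = ∫ H dW`, then `∫ K dX - ∫ D dW` is small in probability whenever `∫ |K H - D|² dt` is,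
uniformly over partitions into cells. -/
theorem ItoApprox.measure_sum_residual_sq_ge_le [IsProbabilityMeasure μ] (hW : IsBrownian μ 𝓕 W)
    (hT : 0 < T) (hX : ItoApprox μ 𝓕 W H X S Y F) (g : Grid T)
    {K D : Set.Icc (0 : ℝ) T → Ω → Matrix (Fin d) (Fin d) ℝ}
    (hK : IsStepOn 𝓕 g K) (hD : IsStepOn 𝓕 g D) (L : ℕ) (c : ℕ → ℕ → Prop)
    (hc : ∀ k l l', c l k → c l' k → l = l') {ε δ : ℝ} (hε : 0 < ε) (hδ : 0 < δ) :
    μ {ω | δ ≤ ∑ l ∈ Finset.range L, ‖g.residual W X K D (c l) ω‖ ^ 2} ≤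
      μ {ω | ENNReal.ofReal (ε / 4) ≤
        ∫⁻ t, ENNReal.ofReal (frobSq (K t ω * H t ω - D t ω)) ∂(timeMeasure T)} +
      ENNReal.ofReal (4 * d * ε / δ) := by
  obtain ⟨C, hC⟩ := hK.bounded
  obtain ⟨B, hB0, hB⟩ : ∃ B : ℝ, 0 < B ∧ ∀ s ω, frobSq (K s ω) ≤ B ^ 2 := by
    refine ⟨max 1 (d * (d * C ^ 2)), by positivity, fun s ω => ?_⟩
    refine (frobSq_le_of_abs_le (hC s ω)).trans ?_
    have h1 : (1 : ℝ) ≤ max 1 (d * (d * C ^ 2)) := le_max_left _ _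
    have h2 : (d * (d * C ^ 2) : ℝ) ≤ max 1 (d * (d * C ^ 2)) := le_max_right _ _
    nlinarith
  -- In `|x|² ≤ 2|y|² + 2|x - y|²`, summed over the classes, the part from replacing `X` by its
  -- approximation must stay below `δ / 2`; the part from the approximation is compared with the
  -- other `δ / 2`.
  obtain ⟨ρ, hρ0, hρ⟩ : ∃ ρ : ℝ, 0 < ρ ∧ L * (g.M * (B * (2 * ρ))) ^ 2 < δ / 4 := by
    have : Tendsto (fun ρ : ℝ => L * (g.M * (B * (2 * ρ))) ^ 2) (𝓝[>] 0) (𝓝 0) := by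
      have h : Continuous fun ρ : ℝ => (L : ℝ) * (g.M * (B * (2 * ρ))) ^ 2 := by fun_prop
      have h0 := h.tendsto 0
      simp only [mul_zero, ne_eq, OfNat.ofNat_ne_zero, not_false_eq_true, zero_pow] at h0
      exact h0.mono_left nhdsWithin_le_nhds
    obtain ⟨ρ, h1, h2⟩ := ((this.eventually (gt_mem_nhds (by positivity : (0 : ℝ) < δ / 4))).and
      self_mem_nhdsWithin).exists
    exact ⟨ρ, h2, h1⟩
  set RH : Set Ω := {ω | ENNReal.ofReal (ε / 4) ≤
        ∫⁻ t, ENNReal.ofReal (frobSq (K t ω * H t ω - D t ω)) ∂(timeMeasure T)} with hRH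
  -- The threshold is chosen such that `2B² · ε / (4B²) + 2 · ε / 4 = ε` in the energy estimate
  -- below.
  set bad1 : ℕ → Set Ω := fun n => {ω | ENNReal.ofReal (ε / 4 / B ^ 2) ≤
    ∫⁻ t, ENNReal.ofReal (frobSq (S n t ω - H t ω)) ∂(timeMeasure T)} with hbad1
  set bad2 : ℕ → Set Ω := fun n => ⋃ k ∈ Finset.range (g.M + 1),
    {ω | ρ ≤ ‖X (g.u k) ω - Y n (g.u k) ω‖} with hbad2
  have hlim1 : Tendsto (fun n => μ (bad1 n)) atTop (𝓝 0) :=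
    hX.tendsto_integrand _ (by rw [ENNReal.ofReal_pos]; positivity)
  have hlim2 : Tendsto (fun n => μ (bad2 n)) atTop (𝓝 0) := by
    have : Tendsto (fun n => ∑ k ∈ Finset.range (g.M + 1),
        μ {ω | ρ ≤ ‖X (g.u k) ω - Y n (g.u k) ω‖}) atTop (𝓝 0) := by
      simpa using tendsto_finsetSum (Finset.range (g.M + 1)) fun k _ =>
        hX.tendsto_integral (g.u k) ρ hρ0
    exact tendsto_of_tendsto_of_tendsto_of_le_of_le tendsto_const_nhds this (fun _ => zero_le)
      fun n => measure_biUnion_finset_le _ _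
  have hmain : ∀ n, μ {ω | δ ≤ ∑ l ∈ Finset.range L, ‖g.residual W X K D (c l) ω‖ ^ 2} ≤
      (μ RH + ENNReal.ofReal (4 * d * ε / δ)) + (μ (bad1 n) + μ (bad2 n)) := by
    intro n
    obtain ⟨g', hg', -⟩ := exists_grid hT
      ((Finset.range (g.M + 1)).image g.u ∪ F n) one_pos
    have hF : ∀ t ∈ F n, t ∈ Set.range g'.u := fun t ht => hg' t (Finset.mem_union_right _ ht)
    have hgg : Set.range g.u ⊆ Set.range g'.u := by
      rintro _ ⟨k, rfl⟩
      have hin : ∀ k ≤ g.M, g.u k ∈ Set.range g'.u := fun k hk =>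
        hg' _ (Finset.mem_union_left _ (Finset.mem_image_of_mem _
          (Finset.mem_range.2 (Nat.lt_succ_of_le hk))))
      rcases le_total k g.M with h | h
      · exact hin k h
      · rw [Subtype.ext ((g.top k h).trans (g.top _ le_rfl).symm)]
        exact hin _ le_rfl
    have hS := hX.isStepOn n g' hF
    have hV : IsStepOn 𝓕 g' fun s ω => K s ω * S n s ω - D s ω :=
      ((hK.refine hgg).mul hS).sub (hD.refine hgg)
    have hκ : ∀ j, ∃ k, g'.u j < g'.u (j + 1) → k < g.M ∧ g.u k ≤ g'.u j ∧
        g'.u (j + 1) ≤ g.u (k + 1) := fun j => by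
      by_cases h : g'.u j < g'.u (j + 1)
      · obtain ⟨k, hk⟩ := Grid.exists_coarse_cell hgg h
        exact ⟨k, fun _ => hk⟩
      · exact ⟨0, fun h' => absurd h' h⟩
    choose κ hκ using hκ
    have hres := fun l => Grid.residual_eq_gridSum (W := W) hgg hK hD
      (hX.eq_stepInt n g' hF) hκ (c l)
    have hlen := hW.measure_sum_norm_gridSum_sq_ge_le g'.mono hV.isAdaptedCoeff g'.M L
      (fun l j => c l (κ j)) (fun j l l' _ h1 h2 => hc _ l l' h1 h2) hε.le
      (show 0 < δ / 4 by positivity)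
    have hsub : {ω | δ ≤ ∑ l ∈ Finset.range L, ‖g.residual W X K D (c l) ω‖ ^ 2} ⊆
        {ω | δ / 4 ≤ ∑ l ∈ Finset.range L, ‖gridSum W g'.u g'.M (fun j ω => if c l (κ j) then
          g'.coeff (fun s ω => K s ω * S n s ω - D s ω) j ω else 0) ω‖ ^ 2} ∪ bad2 n := by
      intro ω hω
      by_contra hcon
      rw [Set.mem_union, not_or] at hcon
      obtain ⟨h1, h2⟩ := hcon
      have h1' := not_le.1 (show ¬ (δ / 4 ≤ _) from h1)
      simp_rw [← hres] at h1'
      have h3 : ∀ k ≤ g.M, ‖X (g.u k) ω - Y n (g.u k) ω‖ ≤ ρ := fun k hk => by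
        by_contra hlt
        exact h2 (Set.mem_biUnion (Finset.mem_coe.2 (Finset.mem_range.2 (Nat.lt_succ_of_le hk)))
          (not_le.1 hlt).le)
      have h4 : ∀ l, ‖g.residual W X K D (c l) ω‖ ^ 2 ≤
          2 * ‖g.residual W (Y n) K D (c l) ω‖ ^ 2 + 2 * (g.M * (B * (2 * ρ))) ^ 2 := fun l => by
        have h5 := g.residual_sub_residual (W := W) (X := X) K D (c l) (Y n) ω hB0.le
          (fun s => hB s ω) hρ0.le h3
        have h6 : ‖g.residual W X K D (c l) ω‖ ≤ ‖g.residual W (Y n) K D (c l) ω‖ +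
            g.M * (B * (2 * ρ)) := by
          have := norm_le_norm_add_norm_sub' (g.residual W X K D (c l) ω)
            (g.residual W (Y n) K D (c l) ω)
          linarith
        have h7 := pow_le_pow_left₀ (norm_nonneg _) h6 2
        nlinarith [sq_nonneg (‖g.residual W (Y n) K D (c l) ω‖ - g.M * (B * (2 * ρ)))]
      have h8 : δ ≤ ∑ l ∈ Finset.range L, ‖g.residual W X K D (c l) ω‖ ^ 2 := hω
      have h9 := h8.trans (Finset.sum_le_sum fun l _ => h4 l)
      rw [Finset.sum_add_distrib, ← Finset.mul_sum, Finset.sum_const, Finset.card_range,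
        nsmul_eq_mul] at h9
      linarith
    have hsub2 : {ω | ε < ∑ j ∈ Finset.range g'.M,
        frobSq (g'.coeff (fun s ω => K s ω * S n s ω - D s ω) j ω) *
          ((g'.u (j + 1) : ℝ) - g'.u j)} ⊆ RH ∪ bad1 n := by
      intro ω hω
      by_contra hcon
      rw [Set.mem_union, not_or] at hcon
      obtain ⟨h1, h2⟩ := hcon
      have h1' := not_le.1 (show ¬ (ENNReal.ofReal (ε / 4) ≤ _) from h1)
      have h2' := not_le.1 (show ¬ (ENNReal.ofReal (ε / 4 / B ^ 2) ≤ _) from h2)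
      have hω' : ε < _ := hω
      simp_rw [Grid.frobSq_coeff_mul] at hω'
      have hstep := g'.ofReal_sum_eq_lintegral (f := fun s => frobSq (K s ω * S n s ω - D s ω))
        (fun s => frobSq_nonneg _) (fun j s h1 h2 => by
          exact congrArg frobSq (congrFun (hV.const j s h1 h2) ω))
      have hlt : ENNReal.ofReal ε <
          ∫⁻ s, ENNReal.ofReal (frobSq (K s ω * S n s ω - D s ω)) ∂(timeMeasure T) := by
        rw [← hstep]
        exact (ENNReal.ofReal_lt_ofReal_iff (hε.trans hω')).2 hω'
      have hmeasS : AEMeasurable (fun s => ENNReal.ofReal (frobSq (S n s ω - H s ω)))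
          (timeMeasure T) := by
        have : ∀ a b, AEMeasurable (fun s => (S n s ω - H s ω) a b) (timeMeasure T) := fun a b =>
          (g'.aemeasurable_of_step fun j s h1 h2 => by rw [hS.const j s h1 h2]).sub
            (hX.measurable_integrand ω a b).aemeasurable
        exact (Finset.aemeasurable_fun_sum _ fun a _ => Finset.aemeasurable_fun_sum _ fun b _ =>
          (this a b).pow_const 2).ennreal_ofReal
      have hle : ∫⁻ s, ENNReal.ofReal (frobSq (K s ω * S n s ω - D s ω)) ∂(timeMeasure T) ≤
          ENNReal.ofReal (2 * B ^ 2) *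
            ∫⁻ s, ENNReal.ofReal (frobSq (S n s ω - H s ω)) ∂(timeMeasure T) +
          ENNReal.ofReal 2 *
            ∫⁻ s, ENNReal.ofReal (frobSq (K s ω * H s ω - D s ω)) ∂(timeMeasure T) := by
        rw [← lintegral_const_mul'' _ hmeasS, ← lintegral_const_mul' _ _ (by simp),
          ← lintegral_add_left' (hmeasS.const_mul _)]
        refine lintegral_mono fun s => ?_
        rw [← ENNReal.ofReal_mul (by positivity), ← ENNReal.ofReal_mul (by positivity),
          ← ENNReal.ofReal_add (mul_nonneg (by positivity) (frobSq_nonneg _))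
            (mul_nonneg (by positivity) (frobSq_nonneg _))]
        refine ENNReal.ofReal_le_ofReal ?_
        have e : K s ω * S n s ω - D s ω =
            K s ω * (S n s ω - H s ω) + (K s ω * H s ω - D s ω) := by
          rw [mul_sub]; abel
        rw [e]
        refine (frobSq_add_le _ _).trans ?_
        have h3 := (frobSq_mul_le (K s ω) (S n s ω - H s ω)).trans
          (mul_le_mul_of_nonneg_right (hB s ω) (frobSq_nonneg _))
        linarith
      have hfin : ENNReal.ofReal (2 * B ^ 2) *
            ∫⁻ s, ENNReal.ofReal (frobSq (S n s ω - H s ω)) ∂(timeMeasure T) +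
          ENNReal.ofReal 2 *
            ∫⁻ s, ENNReal.ofReal (frobSq (K s ω * H s ω - D s ω)) ∂(timeMeasure T) ≤
          ENNReal.ofReal ε := by
        calc _ ≤ ENNReal.ofReal (2 * B ^ 2) * ENNReal.ofReal (ε / 4 / B ^ 2) +
              ENNReal.ofReal 2 * ENNReal.ofReal (ε / 4) := by gcongr
          _ = ENNReal.ofReal ε := by
              rw [← ENNReal.ofReal_mul (by positivity), ← ENNReal.ofReal_mul (by positivity),
                ← ENNReal.ofReal_add (by positivity) (by positivity)]
              congr 1
              field_simp
              ring
      exact absurd (hlt.trans_le (hle.trans hfin)) (lt_irrefl _)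
    calc _ ≤ μ {ω | δ / 4 ≤ ∑ l ∈ Finset.range L, ‖gridSum W g'.u g'.M (fun j ω =>
            if c l (κ j) then g'.coeff (fun s ω => K s ω * S n s ω - D s ω) j ω else 0) ω‖ ^ 2} +
            μ (bad2 n) := (measure_mono hsub).trans (measure_union_le _ _)
      _ ≤ ((μ RH + μ (bad1 n)) + ENNReal.ofReal (d * ε / (δ / 4))) + μ (bad2 n) := by
          gcongr
          exact hlen.trans (add_le_add ((measure_mono hsub2).trans (measure_union_le _ _)) le_rfl)
      _ = _ := by
          rw [show (d : ℝ) * ε / (δ / 4) = 4 * d * ε / δ by field_simp]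
          ring
  -- The approximating grid depends on `n` but the terms that remain do not; in the limit the two
  -- exceptional events disappear.
  have hlim : Tendsto (fun n => (μ RH + ENNReal.ofReal (4 * d * ε / δ)) +
      (μ (bad1 n) + μ (bad2 n))) atTop (𝓝 ((μ RH + ENNReal.ofReal (4 * d * ε / δ)) + (0 + 0))) :=
    tendsto_const_nhds.add (hlim1.add hlim2)
  rw [add_zero, add_zero] at hlim
  exact ge_of_tendsto' hlim hmain

end

end

/-! ### The covariation of an Itô integral is a functional of its path -/

section

variable {d : ℕ} {T : ℝ} {Ω : Type*} {mΩ : MeasurableSpace Ω}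

/-- An a.e. limit of `m`-measurable functions has an `m`-measurable version. -/
theorem exists_measurable_ae_eq_of_tendsto {μ : Measure Ω} {m : MeasurableSpace Ω}
    {f : ℕ → Ω → ℝ} {g : Ω → ℝ} (hf : ∀ n, Measurable[m] (f n))
    (h : ∀ᵐ ω ∂μ, Tendsto (fun n => f n ω) atTop (𝓝 (g ω))) :
    ∃ g' : Ω → ℝ, Measurable[m] g' ∧ g =ᵐ[μ] g' :=
  ⟨fun ω => limsup (fun n => f n ω) atTop, Measurable.limsup hf, by
    filter_upwards [h] with ω hω using hω.limsup_eq.symm⟩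

/-- Young's inequality with weight `ε`. The large coefficient falls on the squared differences,
which will be of order `ε²`, and the small one on the squares of `h₁` and `h₂`. -/
theorem abs_mul_sub_mul_le (s₁ s₂ h₁ h₂ : ℝ) {ε : ℝ} (hε : 0 < ε) :
    |s₁ * s₂ - h₁ * h₂| ≤ (1 + 1 / ε) / 2 * ((s₁ - h₁) ^ 2 + (s₂ - h₂) ^ 2) +
      ε / 2 * (h₁ ^ 2 + h₂ ^ 2) := by
  have key : ∀ x y : ℝ, |x * y| ≤ 1 / ε / 2 * x ^ 2 + ε / 2 * y ^ 2 := fun x y => by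
    have h1 : 1 / ε / 2 * x ^ 2 + ε / 2 * y ^ 2 - x * y = (x / ε - y) ^ 2 * (ε / 2) := by
      field_simp; ring
    have h2 : 1 / ε / 2 * x ^ 2 + ε / 2 * y ^ 2 + x * y = (x / ε + y) ^ 2 * (ε / 2) := by
      field_simp; ring
    rw [abs_le]
    constructor
    · linarith [show 0 ≤ (x / ε + y) ^ 2 * (ε / 2) by positivity]
    · linarith [show 0 ≤ (x / ε - y) ^ 2 * (ε / 2) by positivity]
  have h0 : |(s₁ - h₁) * (s₂ - h₂)| ≤ 1 / 2 * ((s₁ - h₁) ^ 2 + (s₂ - h₂) ^ 2) := by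
    rw [abs_le]
    constructor
    · nlinarith [sq_nonneg ((s₁ - h₁) + (s₂ - h₂))]
    · nlinarith [sq_nonneg ((s₁ - h₁) - (s₂ - h₂))]
  have h1 := key (s₁ - h₁) h₂
  have h2 := key (s₂ - h₂) h₁
  have e : s₁ * s₂ - h₁ * h₂ = (s₁ - h₁) * (s₂ - h₂) + (s₁ - h₁) * h₂ + (s₂ - h₂) * h₁ := by ring
  rw [e]
  refine (abs_add_three _ _ _).trans ?_
  linarith

theorem sq_apply_le_norm_sq (v : EuclideanSpace ℝ (Fin d)) (a : Fin d) : v a ^ 2 ≤ ‖v‖ ^ 2 := by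
  rw [EuclideanSpace.real_norm_sq_eq]
  exact Finset.single_le_sum (f := fun a => v a ^ 2) (fun _ _ => sq_nonneg _) (Finset.mem_univ a)

theorem abs_sum_mul_sub_sum_mul_le {ι : Type*} (s : Finset ι) (x y : ι → EuclideanSpace ℝ (Fin d))
    (a b : Fin d) {ε : ℝ} (hε : 0 < ε) :
    |∑ k ∈ s, x k a * x k b - ∑ k ∈ s, y k a * y k b| ≤
      (1 + 1 / ε) * ∑ k ∈ s, ‖x k - y k‖ ^ 2 + ε * ∑ k ∈ s, ‖y k‖ ^ 2 := by
  rw [← Finset.sum_sub_distrib, Finset.mul_sum, Finset.mul_sum, ← Finset.sum_add_distrib]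
  refine (Finset.abs_sum_le_sum_abs _ _).trans (Finset.sum_le_sum fun k _ => ?_)
  refine (abs_mul_sub_mul_le _ _ _ _ hε).trans ?_
  have h1 : (x k a - y k a) ^ 2 ≤ ‖x k - y k‖ ^ 2 := sq_apply_le_norm_sq (x k - y k) a
  have h2 : (x k b - y k b) ^ 2 ≤ ‖x k - y k‖ ^ 2 := sq_apply_le_norm_sq (x k - y k) b
  have h3 := sq_apply_le_norm_sq (y k) a
  have h4 := sq_apply_le_norm_sq (y k) b
  have h5 : 0 < (1 + 1 / ε) / 2 := by positivity
  calc _ ≤ (1 + 1 / ε) / 2 * (‖x k - y k‖ ^ 2 + ‖x k - y k‖ ^ 2) +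
        ε / 2 * (‖y k‖ ^ 2 + ‖y k‖ ^ 2) := by gcongr
    _ = _ := by ring

theorem sum_row_sq_le_frobSq (A : Matrix (Fin d) (Fin d) ℝ) (a : Fin d) :
    ∑ c, A a c ^ 2 ≤ frobSq A :=
  Finset.single_le_sum (f := fun a => ∑ c, A a c ^ 2)
    (fun _ _ => Finset.sum_nonneg fun _ _ => sq_nonneg _) (Finset.mem_univ a)

theorem abs_mul_transpose_sub_le (S H : Matrix (Fin d) (Fin d) ℝ) (a b : Fin d) {ε : ℝ}
    (hε : 0 < ε) :
    |(S * S.transpose) a b - (H * H.transpose) a b| ≤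
      (1 + 1 / ε) * frobSq (S - H) + ε * frobSq H := by
  simp only [Matrix.mul_apply, Matrix.transpose_apply]
  rw [← Finset.sum_sub_distrib]
  calc _ ≤ ∑ c, ((1 + 1 / ε) / 2 * ((S a c - H a c) ^ 2 + (S b c - H b c) ^ 2) +
        ε / 2 * (H a c ^ 2 + H b c ^ 2)) :=
        (Finset.abs_sum_le_sum_abs _ _).trans
          (Finset.sum_le_sum fun c _ => abs_mul_sub_mul_le _ _ _ _ hε)
    _ = (1 + 1 / ε) / 2 * (∑ c, (S - H) a c ^ 2 + ∑ c, (S - H) b c ^ 2) +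
        ε / 2 * (∑ c, H a c ^ 2 + ∑ c, H b c ^ 2) := by
        simp only [Finset.sum_add_distrib, ← Finset.mul_sum, Matrix.sub_apply]
    _ ≤ (1 + 1 / ε) / 2 * (frobSq (S - H) + frobSq (S - H)) +
        ε / 2 * (frobSq H + frobSq H) := by
        have h5 : 0 < (1 + 1 / ε) / 2 := by positivity
        gcongr <;> exact sum_row_sq_le_frobSq _ _
    _ = _ := by ring

theorem trace_mul_transpose_eq_frobSq (A : Matrix (Fin d) (Fin d) ℝ) :
    ∑ a, (A * A.transpose) a a = frobSq A := by
  simp only [Matrix.mul_apply, Matrix.transpose_apply, frobSq, sq]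

theorem abs_mul_transpose_le (H : Matrix (Fin d) (Fin d) ℝ) (a b : Fin d) :
    |(H * H.transpose) a b| ≤ frobSq H := by
  simp only [Matrix.mul_apply, Matrix.transpose_apply]
  calc _ ≤ ∑ c, (H a c ^ 2 / 2 + H b c ^ 2 / 2) := by
        refine (Finset.abs_sum_le_sum_abs _ _).trans (Finset.sum_le_sum fun c _ => ?_)
        rw [abs_le]
        constructor
        · nlinarith [sq_nonneg (H a c + H b c)]
        · nlinarith [sq_nonneg (H a c - H b c)]
    _ ≤ frobSq H := by
        rw [Finset.sum_add_distrib, ← Finset.sum_div, ← Finset.sum_div]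
        linarith [sum_row_sq_le_frobSq H a, sum_row_sq_le_frobSq H b]

section

variable {μ : Measure Ω} {𝓕 : Filtration (Set.Icc (0 : ℝ) T) mΩ}
  {W X : Set.Icc (0 : ℝ) T → Ω → EuclideanSpace ℝ (Fin d)}
  {H : Set.Icc (0 : ℝ) T → Ω → Matrix (Fin d) (Fin d) ℝ}
  {S : ℕ → Set.Icc (0 : ℝ) T → Ω → Matrix (Fin d) (Fin d) ℝ}
  {Y : ℕ → Set.Icc (0 : ℝ) T → Ω → EuclideanSpace ℝ (Fin d)}
  {F : ℕ → Finset (Set.Icc (0 : ℝ) T)}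

theorem measurable_frobSq_of_entries {β : Type*} [MeasurableSpace β]
    {A : β → Matrix (Fin d) (Fin d) ℝ} (h : ∀ a b, Measurable fun t => A t a b) :
    Measurable fun t => frobSq (A t) :=
  Finset.measurable_sum _ fun a _ => Finset.measurable_sum _ fun b _ => (h a b).pow_const 2

theorem integrable_of_nonneg_of_lintegral_lt_top {β : Type*} {mβ : MeasurableSpace β}
    {ν : Measure β} {f : β → ℝ} (hf : AEMeasurable f ν) (h0 : ∀ x, 0 ≤ f x)
    (h : ∫⁻ x, ENNReal.ofReal (f x) ∂ν < ∞) : Integrable f ν :=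
  ⟨hf.aestronglyMeasurable, by
    rwa [hasFiniteIntegral_iff_ofReal (Eventually.of_forall h0)]⟩

/-- The realized covariation of a path is close to the integrated covariation if the path is close
to an elementary integral whose realized covariation is close to its bracket. -/
theorem Grid.abs_realized_sub_integral_le (g : Grid T) {x y : ℕ → EuclideanSpace ℝ (Fin d)}
    {S H : Set.Icc (0 : ℝ) T → Matrix (Fin d) (Fin d) ℝ}
    (hS : ∀ j s, g.u j < s → s ≤ g.u (j + 1) → S s = S (g.u (j + 1)))
    (hH : ∀ a b, Measurable fun t => H t a b)
    (hR : ∫⁻ s, ENNReal.ofReal (frobSq (H s)) ∂(timeMeasure T) < ∞) {ε : ℝ} (hε : 0 < ε)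
    (hε1 : ε ≤ 1)
    (h1 : ∀ a b, |∑ k ∈ Finset.range g.M, (y k a * y k b - (S (g.u (k + 1)) *
      (S (g.u (k + 1))).transpose) a b * ((g.u (k + 1) : ℝ) - g.u k))| ≤ ε)
    (h2 : ∑ k ∈ Finset.range g.M, ‖x k - y k‖ ^ 2 ≤ ε ^ 2)
    (h3 : ∫⁻ s, ENNReal.ofReal (frobSq (S s - H s)) ∂(timeMeasure T) ≤ ENNReal.ofReal (ε ^ 2))
    (a b : Fin d) :
    |∑ k ∈ Finset.range g.M, x k a * x k b - ∫ s, (H s * (H s).transpose) a b ∂(timeMeasure T)| ≤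
      ε * (7 + d + 3 * ∫ s, frobSq (H s) ∂(timeMeasure T)) := by
  set R := ∫ s, frobSq (H s) ∂(timeMeasure T)
  have hSm : ∀ a b, AEMeasurable (fun s => S s a b) (timeMeasure T) := fun a b =>
    g.aemeasurable_of_step fun j s h1 h2 => by rw [hS j s h1 h2]
  have hR0 : Integrable (fun s => frobSq (H s)) (timeMeasure T) :=
    integrable_of_nonneg_of_lintegral_lt_top (measurable_frobSq_of_entries hH).aemeasurable
      (fun _ => frobSq_nonneg _) hR
  have hD0 : Integrable (fun s => frobSq (S s - H s)) (timeMeasure T) := by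
    refine integrable_of_nonneg_of_lintegral_lt_top ?_ (fun _ => frobSq_nonneg _)
      (h3.trans_lt ENNReal.ofReal_lt_top)
    exact Finset.aemeasurable_fun_sum _ fun a _ => Finset.aemeasurable_fun_sum _ fun b _ =>
      ((hSm a b).sub (hH a b).aemeasurable).pow_const 2
  have hD : ∫ s, frobSq (S s - H s) ∂(timeMeasure T) ≤ ε ^ 2 := by
    rw [integral_eq_lintegral_of_nonneg_ae (Eventually.of_forall fun _ => frobSq_nonneg _) hD0.1]
    exact ENNReal.toReal_le_of_le_ofReal (by positivity) h3
  have hRnn : 0 ≤ R := integral_nonneg fun _ => frobSq_nonneg _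
  have hHH : ∀ a b, Integrable (fun s => (H s * (H s).transpose) a b) (timeMeasure T) := fun a b =>
    hR0.mono' (by
      simp only [Matrix.mul_apply, Matrix.transpose_apply]
      exact (Finset.measurable_sum _ fun c _ => (hH a c).mul (hH b c)).aestronglyMeasurable)
      (Eventually.of_forall fun s => abs_mul_transpose_le _ _ _)
  have hSS : ∀ a b, Integrable (fun s => (S s * (S s).transpose) a b) (timeMeasure T) := fun a b =>
    ((hD0.const_mul 2).add (hR0.const_mul 2)).mono' (by
      simp only [Matrix.mul_apply, Matrix.transpose_apply]
      exact (Finset.aemeasurable_fun_sum _ fun c _ =>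
        (hSm a c).mul (hSm b c)).aestronglyMeasurable)
      (Eventually.of_forall fun s => (abs_mul_transpose_le _ _ _).trans (by
        have := frobSq_add_le (S s - H s) (H s)
        rwa [sub_add_cancel] at this))
  have hI : ∀ a b, ∑ k ∈ Finset.range g.M, (S (g.u (k + 1)) *
      (S (g.u (k + 1))).transpose) a b * ((g.u (k + 1) : ℝ) - g.u k) =
      ∫ s, (S s * (S s).transpose) a b ∂(timeMeasure T) := fun a b =>
    (g.integral_eq_sum (f := fun s => (S s * (S s).transpose) a b)
      fun j s h1 h2 => by rw [hS j s h1 h2]).symm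
  have hII : |∫ s, (S s * (S s).transpose) a b ∂(timeMeasure T) -
      ∫ s, (H s * (H s).transpose) a b ∂(timeMeasure T)| ≤ 2 * ε + ε * R := by
    rw [← integral_sub (hSS a b) (hHH a b)]
    refine (abs_integral_le_integral_abs).trans ?_
    calc _ ≤ ∫ s, ((1 + 1 / ε) * frobSq (S s - H s) + ε * frobSq (H s)) ∂(timeMeasure T) :=
          integral_mono ((hSS a b).sub (hHH a b)).abs
            ((hD0.const_mul _).add (hR0.const_mul _)) fun s =>
            abs_mul_transpose_sub_le _ _ _ _ hε
      _ = (1 + 1 / ε) * ∫ s, frobSq (S s - H s) ∂(timeMeasure T) + ε * R := by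
          rw [integral_add (hD0.const_mul _) (hR0.const_mul _), integral_const_mul,
            integral_const_mul]
      _ ≤ (1 + 1 / ε) * ε ^ 2 + ε * R := by gcongr
      _ ≤ 2 * ε + ε * R := by
          have : (1 + 1 / ε) * ε ^ 2 = ε ^ 2 + ε := by field_simp
          nlinarith
  -- The sum of squares is the trace of the realized covariation of `y`, hence close to `∫ |S|² dt`.
  have hy : ∑ k ∈ Finset.range g.M, ‖y k‖ ^ 2 ≤ d * ε + 2 * ε ^ 2 + 2 * R := by
    have e : ∑ k ∈ Finset.range g.M, ‖y k‖ ^ 2 = ∑ a, ((∑ k ∈ Finset.range g.M,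
        (y k a * y k a - (S (g.u (k + 1)) * (S (g.u (k + 1))).transpose) a a *
          ((g.u (k + 1) : ℝ) - g.u k))) + ∫ s, (S s * (S s).transpose) a a ∂(timeMeasure T)) := by
      simp_rw [Finset.sum_sub_distrib, hI, sub_add_cancel]
      rw [Finset.sum_comm]
      refine Finset.sum_congr rfl fun k _ => ?_
      rw [EuclideanSpace.real_norm_sq_eq]
      exact Finset.sum_congr rfl fun a _ => sq _
    rw [e, Finset.sum_add_distrib, ← integral_finsetSum _ fun a _ => hSS a a]
    simp_rw [trace_mul_transpose_eq_frobSq]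
    have hA : ∑ a, ∑ k ∈ Finset.range g.M, (y k a * y k a - (S (g.u (k + 1)) *
        (S (g.u (k + 1))).transpose) a a * ((g.u (k + 1) : ℝ) - g.u k)) ≤ d * ε := by
      refine (Finset.sum_le_sum fun a _ => (le_abs_self _).trans (h1 a a)).trans ?_
      simp
    have hB : ∫ s, frobSq (S s) ∂(timeMeasure T) ≤ 2 * ε ^ 2 + 2 * R := by
      calc _ ≤ ∫ s, (2 * frobSq (S s - H s) + 2 * frobSq (H s)) ∂(timeMeasure T) :=
            integral_mono_of_nonneg (Eventually.of_forall fun _ => frobSq_nonneg _)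
              ((hD0.const_mul _).add (hR0.const_mul _)) (Eventually.of_forall fun s => by
                have := frobSq_add_le (S s - H s) (H s)
                rwa [sub_add_cancel] at this)
        _ = 2 * ∫ s, frobSq (S s - H s) ∂(timeMeasure T) + 2 * R := by
            rw [integral_add (hD0.const_mul _) (hR0.const_mul _), integral_const_mul,
              integral_const_mul]
        _ ≤ _ := by linarith
    linarith
  have hx := abs_sum_mul_sub_sum_mul_le (Finset.range g.M) x y a b hε
  have hY := h1 a b
  rw [Finset.sum_sub_distrib, hI] at hY
  have h4 : (1 + 1 / ε) * ∑ k ∈ Finset.range g.M, ‖x k - y k‖ ^ 2 ≤ 2 * ε := by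
    calc _ ≤ (1 + 1 / ε) * ε ^ 2 := by gcongr
      _ = ε ^ 2 + ε := by field_simp
      _ ≤ 2 * ε := by nlinarith
  have h5 : ε * ∑ k ∈ Finset.range g.M, ‖y k‖ ^ 2 ≤ ε * (d + 2 + 2 * R) := by
    refine mul_le_mul_of_nonneg_left (hy.trans ?_) hε.le
    have : (d : ℝ) * ε ≤ d := mul_le_of_le_one_right (by positivity) hε1
    nlinarith
  have e : ∑ k ∈ Finset.range g.M, x k a * x k b - ∫ s, (H s * (H s).transpose) a b
      ∂(timeMeasure T) = (∑ k ∈ Finset.range g.M, x k a * x k b -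
        ∑ k ∈ Finset.range g.M, y k a * y k b) + (∑ k ∈ Finset.range g.M, y k a * y k b -
          ∫ s, (S s * (S s).transpose) a b ∂(timeMeasure T)) +
        (∫ s, (S s * (S s).transpose) a b ∂(timeMeasure T) -
          ∫ s, (H s * (H s).transpose) a b ∂(timeMeasure T)) := by ring
  rw [e]
  refine (abs_add_three _ _ _).trans ?_
  linarith

/-- The integrated covariation `∫ H Hᵀ dt` of `X = ∫ H dW` is a functional of `X`. -/
theorem ItoApprox.exists_measurable_integral [IsProbabilityMeasure μ] (hW : IsBrownian μ 𝓕 W)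
    (hT : 0 < T) (hX : ItoApprox μ 𝓕 W H X S Y F)
    (hR : ∀ᵐ ω ∂μ, ∫⁻ s, ENNReal.ofReal (frobSq (H s ω)) ∂(timeMeasure T) < ∞) (a b : Fin d) :
    ∃ A : Ω → ℝ, Measurable[⨆ t, MeasurableSpace.comap (X t) inferInstance] A ∧
      (fun ω => ∫ s, (H s ω * (H s ω).transpose) a b ∂(timeMeasure T)) =ᵐ[μ] A := by
  classical
  have key : ∀ ε : ℝ, 0 < ε → ∃ (g : Grid T) (bad : Set Ω), μ bad ≤ 4 * ENNReal.ofReal ε ∧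
      ∀ ω ∉ bad, ∫⁻ s, ENNReal.ofReal (frobSq (H s ω)) ∂(timeMeasure T) < ∞ → ε ≤ 1 →
      |∑ k ∈ Finset.range g.M, (X (g.u (k + 1)) ω - X (g.u k) ω) a *
        (X (g.u (k + 1)) ω - X (g.u k) ω) b -
        ∫ s, (H s ω * (H s ω).transpose) a b ∂(timeMeasure T)| ≤
      ε * (7 + d + 3 * ∫ s, frobSq (H s ω) ∂(timeMeasure T)) := by
    intro ε hε
    -- The first bound makes the energy error at most `ε²`, the second makes the Lenglart term `4dε₁
    -- / ε²` at most `ε`.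
    set ε₁ : ℝ := min (4 * ε ^ 2) (ε ^ 3 / (4 * (d + 1))) with hε₁
    have hε₁0 : 0 < ε₁ := by positivity
    obtain ⟨n, hn⟩ : ∃ n, μ {ω | ENNReal.ofReal (ε₁ / 4) ≤
        ∫⁻ t, ENNReal.ofReal (frobSq (S n t ω - H t ω)) ∂(timeMeasure T)} ≤ ENNReal.ofReal ε :=
      ((hX.tendsto_integrand (ENNReal.ofReal (ε₁ / 4)) (by rw [ENNReal.ofReal_pos]; positivity)
        ).eventually (eventually_le_nhds (ENNReal.ofReal_pos.2 hε))).exists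
    obtain ⟨g₀, hg₀, -⟩ := exists_grid hT (F n) one_pos
    obtain ⟨C, hC⟩ := (hX.isStepOn n g₀ hg₀).bounded
    -- The bound `C` depends on the step process `S n`, so the mesh can be chosen only after `n` has
    -- been fixed. `Q` collects the variance constants of all `d²` pairs of coordinates.
    set Q : ℝ := d ^ 2 * (d ^ 2 * (d ^ 2 * (max C 0 ^ 4 * (varianceConst * T)))) with hQ
    have hQ0 : 0 ≤ Q := by
      have := varianceConst_nonneg
      positivity
    obtain ⟨g, hg, hmesh⟩ := exists_grid hT (F n) (show 0 < ε ^ 3 / (Q + 1) by positivity)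
    have hS := hX.isStepOn n g hg
    set badY : Set Ω := ⋃ p ∈ (Finset.univ : Finset (Fin d × Fin d)),
      {ω | ε ≤ |∑ j ∈ Finset.range g.M,
      (Matrix.toEuclideanLin (g.coeff (S n) j ω) (W (g.u (j + 1)) ω - W (g.u j) ω) p.1 *
        Matrix.toEuclideanLin (g.coeff (S n) j ω) (W (g.u (j + 1)) ω - W (g.u j) ω) p.2 -
        (g.coeff (S n) j ω * (g.coeff (S n) j ω).transpose) p.1 p.2 *
          ((g.u (j + 1) : ℝ) - g.u j))|} with hbadY
    -- With `K = 1`, `D = S n` and one class per cell, the residual is the error `ΔX - S ΔW` of a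
    -- single cell; all squared errors are controlled at once.
    set badQ : Set Ω := {ω | ε ^ 2 ≤ ∑ l ∈ Finset.range g.M,
      ‖g.residual W X (fun _ _ => 1) (S n) (fun k => l = k) ω‖ ^ 2} with hbadQ
    set badD : Set Ω := {ω | ENNReal.ofReal (ε₁ / 4) ≤
      ∫⁻ t, ENNReal.ofReal (frobSq (S n t ω - H t ω)) ∂(timeMeasure T)} with hbadD
    refine ⟨g, badY ∪ badQ ∪ badD, ?_, ?_⟩
    · have hY : μ badY ≤ ENNReal.ofReal ε := by
        refine (measure_biUnion_finset_le _ _).trans ?_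
        refine (Finset.sum_le_sum fun p _ => hW.measure_realized_sub_bracket_ge_le g.mono
          hS.measurable_coeff (Grid.abs_coeff_le (le_max_right C 0)
            fun s ω a b => (hC s ω a b).trans (le_max_left _ _)) hmesh g.M p.1 p.2 hε).trans ?_
        rw [Finset.sum_const, Finset.card_univ, Fintype.card_prod, Fintype.card_fin, nsmul_eq_mul,
          ← ENNReal.ofReal_natCast, ← ENNReal.ofReal_mul (by positivity)]
        refine ENNReal.ofReal_le_ofReal ?_
        have e : ((d * d : ℕ) : ℝ) * (d ^ 2 * (d ^ 2 * (max C 0 ^ 4 * (varianceConst *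
            (ε ^ 3 / (Q + 1) * T)))) / ε ^ 2) = Q * ε / (Q + 1) := by
          rw [hQ]
          push_cast
          field_simp
        rw [e, div_le_iff₀ (by positivity)]
        nlinarith
      have hQ' : μ badQ ≤ ENNReal.ofReal ε + ENNReal.ofReal ε := by
        have h1 : IsStepOn 𝓕 g fun _ (_ : Ω) => (1 : Matrix (Fin d) (Fin d) ℝ) :=
          ⟨fun _ _ _ _ => rfl, fun _ _ _ _ => measurable_const, 1, fun _ _ a b => by
            rw [Matrix.one_apply]
            split_ifs <;> simp⟩
        have h2 := hX.measure_sum_residual_sq_ge_le hW hT g h1 hS g.M (fun l k => l = k)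
          (fun k l l' h h' => h.trans h'.symm) hε₁0 (by positivity : 0 < ε ^ 2)
        refine le_trans (le_of_eq ?_) (h2.trans ?_)
        · rw [hbadQ]
          congr!
        refine add_le_add (le_trans (measure_mono fun ω hω => ?_) hn)
          (ENNReal.ofReal_le_ofReal ?_)
        · have e : ∀ t, frobSq (S n t ω - H t ω) = frobSq (1 * H t ω - S n t ω) := fun t => by
            simp only [frobSq, one_mul, Matrix.sub_apply]
            exact Finset.sum_congr rfl fun _ _ => Finset.sum_congr rfl fun _ _ => by ring
          change ENNReal.ofReal (ε₁ / 4) ≤ _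
          simp_rw [e]
          exact hω
        · have h2 : ε₁ ≤ ε ^ 3 / (4 * (d + 1)) := min_le_right _ _
          calc 4 * (d : ℝ) * ε₁ / ε ^ 2 ≤ 4 * d * (ε ^ 3 / (4 * (d + 1))) / ε ^ 2 := by gcongr
            _ = ε * (d / (d + 1)) := by field_simp
            _ ≤ ε * 1 := by
              gcongr
              rw [div_le_one (by positivity)]
              linarith
            _ = ε := mul_one _
      calc _ ≤ μ badY + μ badQ + μ badD :=
            (measure_union_le _ _).trans (add_le_add (measure_union_le _ _) le_rfl)
        _ ≤ ENNReal.ofReal ε + (ENNReal.ofReal ε + ENNReal.ofReal ε) + ENNReal.ofReal ε := by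
            gcongr
        _ = 4 * ENNReal.ofReal ε := by ring
    · intro ω hω hRω hε1
      simp only [Set.mem_union, not_or] at hω
      obtain ⟨⟨hω1, hω2⟩, hω3⟩ := hω
      refine g.abs_realized_sub_integral_le (S := fun s => S n s ω) (y := fun k =>
        Matrix.toEuclideanLin (S n (g.u (k + 1)) ω) (W (g.u (k + 1)) ω - W (g.u k) ω))
        (x := fun k => X (g.u (k + 1)) ω - X (g.u k) ω)
        (fun j s h1 h2 => congrFun (hS.const j s h1 h2) ω) (hX.measurable_integrand ω) hRω hε hε1
        (fun a b => ?_) ?_ ?_ a b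
      · by_contra hcon
        refine hω1 (Set.mem_biUnion (Finset.mem_coe.2 (Finset.mem_univ (a, b))) ?_)
        change ε ≤ _
        refine (not_le.1 hcon).le.trans (le_of_eq ?_)
        congr 1
        refine Finset.sum_congr rfl fun j _ => ?_
        rw [g.toEuclideanLin_coeff]
        congr 1
        unfold Grid.coeff
        split_ifs with h
        · rfl
        · rw [(g.mono j.le_succ).antisymm (not_lt.1 h), sub_self, mul_zero, mul_zero]
      · have h := (not_le.1 (show ¬ (ε ^ 2 ≤ _) from hω2)).le
        refine le_trans (le_of_eq (Finset.sum_congr rfl fun l hl => ?_)) h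
        unfold Grid.residual
        rw [Finset.sum_ite_eq, if_pos hl]
        congr 2
        simp [Matrix.toEuclideanLin]
      · refine (not_le.1 (show ¬ (ENNReal.ofReal (ε₁ / 4) ≤ _) from hω3)).le.trans
          (ENNReal.ofReal_le_ofReal ?_)
        linarith [min_le_left (4 * ε ^ 2) (ε ^ 3 / (4 * (d + 1)))]
  -- Summable error probabilities allow the Borel–Cantelli lemma, and thus almost sure convergence.
  let e : ℕ → ℝ := fun n => (1 / 2) ^ n
  have he : ∀ n, 0 < e n := fun n => by positivity
  choose g bad hbad hgood using fun n => key (e n) (he n)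
  have hsum : ∑' n, μ (bad n) ≠ ∞ := by
    refine ne_top_of_le_ne_top ?_ (ENNReal.tsum_le_tsum fun n => hbad n)
    rw [ENNReal.tsum_mul_left]
    refine ENNReal.mul_ne_top (by simp) ?_
    rw [← ENNReal.ofReal_tsum_of_nonneg (fun n => (he n).le) summable_geometric_two]
    exact ENNReal.ofReal_ne_top
  refine exists_measurable_ae_eq_of_tendsto (f := fun n ω => ∑ k ∈ Finset.range (g n).M,
    (X ((g n).u (k + 1)) ω - X ((g n).u k) ω) a *
      (X ((g n).u (k + 1)) ω - X ((g n).u k) ω) b) (fun n => ?_) ?_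
  · have hXm : ∀ t c, Measurable[⨆ t, MeasurableSpace.comap (X t) inferInstance]
        fun ω => X t ω c := fun t c =>
      ((EuclideanSpace.proj c).continuous.measurable.comp (comap_measurable (X t))).mono
        (le_iSup (fun t => MeasurableSpace.comap (X t) inferInstance) t) le_rfl
    exact Finset.measurable_sum _ fun k _ => ((hXm _ a).sub (hXm _ a)).mul
      ((hXm _ b).sub (hXm _ b))
  · filter_upwards [ae_eventually_notMem hsum, hR] with ω hω hRω
    rw [tendsto_iff_norm_sub_tendsto_zero]
    have h0 : Tendsto (fun n => e n * (7 + d + 3 * ∫ s, frobSq (H s ω) ∂(timeMeasure T))) atTop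
        (𝓝 0) := by
      have := (tendsto_pow_atTop_nhds_zero_of_lt_one (r := (1 / 2 : ℝ)) (by norm_num)
        (by norm_num)).mul_const (7 + d + 3 * ∫ s, frobSq (H s ω) ∂(timeMeasure T))
      rwa [zero_mul] at this
    refine squeeze_zero' (Eventually.of_forall fun _ => norm_nonneg _) ?_ h0
    filter_upwards [hω] with n hn
    exact hgood n ω hn hRω (pow_le_one₀ (by norm_num) (by norm_num))

end

end

/-! ### Localization to a time interval `[0,t]` -/

section

variable {d : ℕ} {T : ℝ} {Ω : Type*} {mΩ : MeasurableSpace Ω}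

section

variable {μ : Measure Ω} {𝓕 : Filtration (Set.Icc (0 : ℝ) T) mΩ}
  {W X : Set.Icc (0 : ℝ) T → Ω → EuclideanSpace ℝ (Fin d)}
  {H : Set.Icc (0 : ℝ) T → Ω → Matrix (Fin d) (Fin d) ℝ}
  {S : ℕ → Set.Icc (0 : ℝ) T → Ω → Matrix (Fin d) (Fin d) ℝ}
  {Y : ℕ → Set.Icc (0 : ℝ) T → Ω → EuclideanSpace ℝ (Fin d)}
  {F : ℕ → Finset (Set.Icc (0 : ℝ) T)}

theorem Grid.le_iff_of_mem_range {g : Grid T} {t : Set.Icc (0 : ℝ) T} (ht : t ∈ Set.range g.u)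
    {j : ℕ} {s : Set.Icc (0 : ℝ) T} (h1 : g.u j < s) (h2 : s ≤ g.u (j + 1)) :
    s ≤ t ↔ g.u (j + 1) ≤ t := by
  refine ⟨fun h => (g.dichotomy ht j).resolve_left (not_le.2 (h1.trans_le h)), h2.trans⟩

theorem IsStepOn.restrict {g : Grid T} {V : Set.Icc (0 : ℝ) T → Ω → Matrix (Fin d) (Fin d) ℝ}
    (hV : IsStepOn 𝓕 g V) {t : Set.Icc (0 : ℝ) T} (ht : t ∈ Set.range g.u) :
    IsStepOn 𝓕 g fun s ω => if s ≤ t then V s ω else 0 where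
  const j s h1 h2 := by
    simp only [Grid.le_iff_of_mem_range ht h1 h2, hV.const j s h1 h2]
  measurable j hj a b := by
    by_cases h : g.u (j + 1) ≤ t
    · simpa [h] using hV.measurable j hj a b
    · simp [h]
  bounded := by
    obtain ⟨C, hC⟩ := hV.bounded
    refine ⟨max C 0, fun s ω a b => ?_⟩
    by_cases h : s ≤ t
    · simpa [h] using Or.inl (hC s ω a b)
    · simp [h]

/-- Stopping at a fixed time. -/
theorem ItoApprox.truncate (hX : ItoApprox μ 𝓕 W H X S Y F) (t : Set.Icc (0 : ℝ) T) :
    ItoApprox μ 𝓕 W (fun s ω => if s ≤ t then H s ω else 0) (fun s ω => X (min s t) ω)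
      (fun n s ω => if s ≤ t then S n s ω else 0) (fun n s ω => Y n (min s t) ω)
      (fun n => insert t (F n)) where
  isStepOn n g hg := (hX.isStepOn n g fun s hs => hg s (Finset.mem_insert_of_mem hs)).restrict
    (hg t (Finset.mem_insert_self _ _))
  eq_stepInt n g hg r hr ω := by
    have ht := hg t (Finset.mem_insert_self _ _)
    rw [hX.eq_stepInt n g (fun s hs => hg s (Finset.mem_insert_of_mem hs)) (min r t)
      (by rcases min_choice r t with h | h <;> rw [h] <;> assumption)]
    unfold Grid.stepInt
    refine Finset.sum_congr rfl fun j _ => ?_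
    by_cases h1 : g.u (j + 1) ≤ r <;> by_cases h2 : g.u (j + 1) ≤ t <;> simp [h1, h2]
  measurable_integrand ω a b := by
    have : (fun s => (if s ≤ t then H s ω else 0) a b) =
        (Set.Iic t).indicator fun s => H s ω a b := by
      ext s
      by_cases h : s ≤ t
      · simp [h]
      · simp [h]
    rw [this]
    exact (hX.measurable_integrand ω a b).indicator measurableSet_Iic
  tendsto_integrand ε hε := by
    refine tendsto_of_tendsto_of_tendsto_of_le_of_le tendsto_const_nhds
      (hX.tendsto_integrand ε hε) (fun _ => zero_le) fun n => measure_mono fun ω hω => ?_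
    refine le_trans (show ε ≤ _ from hω) (lintegral_mono fun s => ENNReal.ofReal_le_ofReal ?_)
    split_ifs
    · exact le_rfl
    · simpa using frobSq_nonneg _
  tendsto_integral r ε hε := hX.tendsto_integral (min r t) ε hε

/-- The integrated covariation `∫_0^t H Hᵀ ds` of `X = ∫ H dW` is a functional of `X` up to the
time `t`. -/
theorem ItoApprox.exists_measurable_setIntegral [IsProbabilityMeasure μ] (hW : IsBrownian μ 𝓕 W)
    (hT : 0 < T) (hX : ItoApprox μ 𝓕 W H X S Y F)
    (hR : ∀ᵐ ω ∂μ, ∫⁻ s, ENNReal.ofReal (frobSq (H s ω)) ∂(timeMeasure T) < ∞)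
    (t : Set.Icc (0 : ℝ) T) (a b : Fin d) :
    ∃ A : Ω → ℝ, Measurable[⨆ r ≤ t, MeasurableSpace.comap (X r) inferInstance] A ∧
      (fun ω => ∫ s in Set.Iic t, (H s ω * (H s ω).transpose) a b ∂(timeMeasure T)) =ᵐ[μ] A := by
  obtain ⟨A, hA, hA'⟩ := (hX.truncate t).exists_measurable_integral hW hT (by
    filter_upwards [hR] with ω hω
    refine (lintegral_mono fun s => ENNReal.ofReal_le_ofReal ?_).trans_lt hω
    split_ifs
    · exact le_rfl
    · simpa using frobSq_nonneg _) a b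
  refine ⟨A, hA.mono (iSup_le fun r => le_iSup₂_of_le (min r t) (min_le_right _ _) le_rfl) le_rfl,
    ?_⟩
  filter_upwards [hA'] with ω hω
  rw [← hω, ← integral_indicator measurableSet_Iic]
  refine integral_congr_ae (Eventually.of_forall fun s => ?_)
  by_cases h : s ∈ Set.Iic t
  · simp [h, Set.mem_Iic.1 h]
  · have h' : ¬ s ≤ t := h
    simp [h']

end

end

/-! ### Matrix square roots and their regularized inverses -/

section

variable {d : ℕ} {T : ℝ} {Ω : Type*} {mΩ : MeasurableSpace Ω}

section MatrixFunctions

theorem isClosed_posSemidef : IsClosed {A : Matrix (Fin d) (Fin d) ℝ | A.PosSemidef} := by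
  have : {A : Matrix (Fin d) (Fin d) ℝ | A.PosSemidef} =
      {A | A.conjTranspose = A} ∩ ⋂ x : Fin d → ℝ, {A | 0 ≤ star x ⬝ᵥ A.mulVec x} := by
    ext A
    simp [Matrix.posSemidef_iff_dotProduct_mulVec, Matrix.IsHermitian]
  rw [this]
  refine (isClosed_eq (continuous_id.matrix_conjTranspose) continuous_id).inter
    (isClosed_iInter fun x => isClosed_le continuous_const ?_)
  exact continuous_const.dotProduct (continuous_id.matrix_mulVec continuous_const)

open scoped MatrixOrder in
theorem posSemidef_matrixSqrt (A : Matrix (Fin d) (Fin d) ℝ) : (matrixSqrt A).PosSemidef :=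
  Matrix.nonneg_iff_posSemidef.1 (CFC.sqrt_nonneg A)

open scoped MatrixOrder in
theorem matrixSqrt_mul_self {A : Matrix (Fin d) (Fin d) ℝ} (hA : A.PosSemidef) :
    matrixSqrt A * matrixSqrt A = A :=
  CFC.sqrt_mul_sqrt_self A (Matrix.nonneg_iff_posSemidef.2 hA)

theorem matrixSqrt_mul_transpose {A : Matrix (Fin d) (Fin d) ℝ} (hA : A.PosSemidef) :
    matrixSqrt A * (matrixSqrt A).transpose = A := by
  have h : (matrixSqrt A).transpose = matrixSqrt A := (posSemidef_matrixSqrt A).isHermitian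
  rw [h, matrixSqrt_mul_self hA]

theorem isUnit_det_matrixSqrt {A : Matrix (Fin d) (Fin d) ℝ} (hA : A.PosDef) :
    IsUnit (matrixSqrt A).det := by
  have h := congrArg Matrix.det (matrixSqrt_mul_self hA.posSemidef)
  rw [Matrix.det_mul] at h
  refine isUnit_iff_ne_zero.2 fun h0 => hA.det_pos.ne' ?_
  rw [← h, h0, zero_mul]

section
open scoped MatrixOrder Matrix.Norms.L2Operator
theorem continuousOn_cfcSqrt : ContinuousOn
    (fun A : Matrix (Fin d) (Fin d) ℝ => (CFC.sqrt A : Matrix (Fin d) (Fin d) ℝ)) {A | 0 ≤ A} :=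
  CFC.continuousOn_sqrt
end

open scoped MatrixOrder in
theorem continuousOn_matrixSqrt :
    ContinuousOn (matrixSqrt (d := d)) {A | A.PosSemidef} := by
  have h : {A : Matrix (Fin d) (Fin d) ℝ | A.PosSemidef} = {A | 0 ≤ A} := by
    ext A
    exact Matrix.nonneg_iff_posSemidef.symm
  rw [h]
  exact continuousOn_cfcSqrt

theorem frobSq_eq_sum_col (A : Matrix (Fin d) (Fin d) ℝ) :
    frobSq A = ∑ j, A.col j ⬝ᵥ A.col j := by
  rw [frobSq, Finset.sum_comm]
  simp [dotProduct, Matrix.col, sq]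

theorem isUnit_det_add_smul_one {A : Matrix (Fin d) (Fin d) ℝ} (hA : A.PosSemidef) {l : ℝ}
    (hl : 0 < l) : IsUnit (A + l • (1 : Matrix (Fin d) (Fin d) ℝ)).det :=
  isUnit_iff_ne_zero.2 (Matrix.PosDef.posSemidef_add hA (Matrix.PosDef.one.smul hl)).det_pos.ne'

/-- The resolvent of a positive semidefinite matrix is bounded. -/
theorem sq_mul_frobSq_inv_le {A : Matrix (Fin d) (Fin d) ℝ} (hA : A.PosSemidef) {l : ℝ}
    (hl : 0 < l) : l ^ 2 * frobSq (A + l • (1 : Matrix (Fin d) (Fin d) ℝ))⁻¹ ≤ d := by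
  set R := (A + l • (1 : Matrix (Fin d) (Fin d) ℝ))⁻¹
  have hR : (A + l • (1 : Matrix (Fin d) (Fin d) ℝ)) * R = 1 :=
    Matrix.mul_nonsing_inv _ (isUnit_det_add_smul_one hA hl)
  have h1 : frobSq (1 : Matrix (Fin d) (Fin d) ℝ) = d := by
    simp [frobSq, Matrix.one_apply]
  rw [← h1, ← hR, frobSq_eq_sum_col, frobSq_eq_sum_col, Finset.mul_sum]
  refine Finset.sum_le_sum fun j _ => ?_
  have hc : ((A + l • (1 : Matrix (Fin d) (Fin d) ℝ)) * R).col j =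
      A.mulVec (R.col j) + l • R.col j := by
    rw [Matrix.add_mul]
    ext i
    simp [Matrix.mul_apply, Matrix.mulVec, dotProduct, Matrix.col]
  rw [hc]
  set w := R.col j
  have h2 : 0 ≤ w ⬝ᵥ A.mulVec w := by simpa using hA.dotProduct_mulVec_nonneg w
  have h3 : 0 ≤ A.mulVec w ⬝ᵥ A.mulVec w := by
    simpa [dotProduct] using Finset.sum_nonneg fun i (_ : i ∈ Finset.univ) =>
      mul_self_nonneg (A.mulVec w i)
  -- Expanding `|(A + l)w|² = |Aw|² + 2l ⟨w, Aw⟩ + l²|w|²`, the first two terms are nonnegative.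
  simp only [add_dotProduct, dotProduct_add, smul_dotProduct, dotProduct_smul, smul_eq_mul]
  rw [dotProduct_comm (A.mulVec w) w]
  nlinarith [mul_nonneg hl.le h2]

open scoped Classical in
/-- The regularized inverse square root `(A^{1/2} + l)⁻¹` of a positive semidefinite matrix. -/
def regInvSqrt (l : ℝ) (A : Matrix (Fin d) (Fin d) ℝ) : Matrix (Fin d) (Fin d) ℝ :=
  if A.PosSemidef then (matrixSqrt A + l • 1)⁻¹ else 0

theorem frobSq_regInvSqrt_le {l : ℝ} (hl : 0 < l) (A : Matrix (Fin d) (Fin d) ℝ) :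
    frobSq (regInvSqrt l A) ≤ d / l ^ 2 := by
  unfold regInvSqrt
  split_ifs with h
  · rw [le_div_iff₀ (by positivity), mul_comm]
    exact sq_mul_frobSq_inv_le (posSemidef_matrixSqrt A) hl
  · rw [frobSq_zero]
    positivity

theorem continuousOn_regInvSqrt {l : ℝ} (hl : 0 < l) :
    ContinuousOn (regInvSqrt (d := d) l) {A | A.PosSemidef} := by
  have h : ContinuousOn (fun A : Matrix (Fin d) (Fin d) ℝ => (matrixSqrt A + l • 1)⁻¹)
      {A | A.PosSemidef} := by
    intro A hA
    have h1 : ContinuousWithinAt (fun A : Matrix (Fin d) (Fin d) ℝ => matrixSqrt A + l • 1)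
        {A | A.PosSemidef} A := (continuousOn_matrixSqrt A hA).add continuousWithinAt_const
    have hu := isUnit_det_add_smul_one (posSemidef_matrixSqrt A) hl
    refine ContinuousAt.comp_continuousWithinAt (continuousAt_matrix_inv _ ?_) h1
    rw [Ring.inverse_eq_inv']
    exact continuousAt_inv₀ hu.ne_zero
  exact h.congr fun A hA => if_pos hA

theorem regInvSqrt_mul_matrixSqrt_sub_one {l : ℝ} (hl : 0 < l) {A : Matrix (Fin d) (Fin d) ℝ}
    (hA : A.PosSemidef) : regInvSqrt l A * matrixSqrt A - 1 = -(l • regInvSqrt l A) := by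
  have h := Matrix.nonsing_inv_mul _ (isUnit_det_add_smul_one (posSemidef_matrixSqrt A) hl)
  rw [regInvSqrt, if_pos hA]
  rw [mul_add, Matrix.mul_smul, mul_one] at h
  rw [eq_sub_of_add_eq h]
  abel

theorem frobSq_smul (l : ℝ) (A : Matrix (Fin d) (Fin d) ℝ) :
    frobSq (l • A) = l ^ 2 * frobSq A := by
  simp [frobSq, mul_pow, Finset.mul_sum]

theorem frobSq_neg (A : Matrix (Fin d) (Fin d) ℝ) : frobSq (-A) = frobSq A := by
  simp [frobSq]

theorem continuous_frobSq : Continuous (frobSq (d := d)) := by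
  unfold frobSq
  fun_prop

/-- The bound depends neither on `l` nor on `A` and serves as the dominating constant when `l → 0`.
-/
theorem frobSq_regInvSqrt_mul_sub_one_le {l : ℝ} (hl : 0 < l) {A : Matrix (Fin d) (Fin d) ℝ}
    (hA : A.PosSemidef) : frobSq (regInvSqrt l A * matrixSqrt A - 1) ≤ d := by
  rw [regInvSqrt_mul_matrixSqrt_sub_one hl hA, frobSq_neg, frobSq_smul]
  have := frobSq_regInvSqrt_le hl A
  rwa [le_div_iff₀ (by positivity), mul_comm] at this

/-- Strict positivity of `α` enters the recovery of the driver here: for a singular `A` the product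
would tend only to the projection onto the range of `A`. -/
theorem tendsto_frobSq_regInvSqrt_mul_sub_one {A : Matrix (Fin d) (Fin d) ℝ} (hA : A.PosDef) :
    Tendsto (fun l => frobSq (regInvSqrt l A * matrixSqrt A - 1)) (𝓝[>] 0) (𝓝 0) := by
  have h1 : Tendsto (fun l : ℝ => l • (matrixSqrt A + l • 1)⁻¹) (𝓝 0) (𝓝 (0 : Matrix _ _ ℝ)) := by
    have h2 : ContinuousAt (fun l : ℝ => (matrixSqrt A + l • (1 : Matrix (Fin d) (Fin d) ℝ))⁻¹)
        0 := by
      refine ContinuousAt.comp (g := fun B : Matrix (Fin d) (Fin d) ℝ => B⁻¹)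
        (f := fun l : ℝ => matrixSqrt A + l • (1 : Matrix (Fin d) (Fin d) ℝ))
        (continuousAt_matrix_inv _ ?_) (by fun_prop)
      rw [Ring.inverse_eq_inv', zero_smul, add_zero]
      exact continuousAt_inv₀ (isUnit_det_matrixSqrt hA).ne_zero
    have h3 := (continuousAt_id (x := (0 : ℝ))).smul h2
    have h4 : Tendsto (fun l : ℝ => l • (matrixSqrt A + l • (1 : Matrix (Fin d) (Fin d) ℝ))⁻¹)
        (𝓝 0) (𝓝 ((0 : ℝ) • (matrixSqrt A + (0 : ℝ) • 1)⁻¹)) := h3.tendsto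
    rwa [zero_smul] at h4
  have h5 := (continuous_frobSq.tendsto _).comp (h1.mono_left (nhdsWithin_le_nhds (s := Set.Ioi 0)))
  rw [frobSq_zero] at h5
  refine h5.congr' ?_
  filter_upwards [self_mem_nhdsWithin] with l hl
  rw [regInvSqrt_mul_matrixSqrt_sub_one hl hA.posSemidef, frobSq_neg, regInvSqrt,
    if_pos hA.posSemidef]
  rfl

/-- Functions of matrices that are continuous on the positive semidefinite matrices and vanish
elsewhere are measurable. -/
theorem measurable_comp_of_continuousOn_posSemidef
    {f : Matrix (Fin d) (Fin d) ℝ → Matrix (Fin d) (Fin d) ℝ}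
    (hf : ContinuousOn f {A | A.PosSemidef}) (hf0 : ∀ A, ¬ A.PosSemidef → f A = 0)
    {A : Ω → Matrix (Fin d) (Fin d) ℝ} (hA : ∀ a b, Measurable fun ω => A ω a b) (a b : Fin d) :
    Measurable fun ω => f (A ω) a b := by
  let f' : (Fin d → Fin d → ℝ) → ℝ := fun B => f (Matrix.of B) a b
  let s : Set (Fin d → Fin d → ℝ) := {B | (Matrix.of B).PosSemidef}
  have hs : MeasurableSet s := IsClosed.measurableSet (α := Fin d → Fin d → ℝ) isClosed_posSemidef
  have hf' : Measurable f' := by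
    classical
    have hc : ContinuousOn f' s :=
      ((continuous_apply_apply a b).comp_continuousOn hf :)
    have := hc.measurable_piecewise (g := fun _ => 0) continuousOn_const hs
    convert this using 1
    ext B
    by_cases hB : B ∈ s
    · rw [Set.piecewise_eq_of_mem _ _ _ hB]
    · rw [Set.piecewise_eq_of_notMem _ _ _ hB]
      simp [f', hf0 _ hB]
  exact hf'.comp (measurable_pi_lambda _ fun a => measurable_pi_lambda _ fun b => hA a b)

theorem measurable_regInvSqrt {l : ℝ} (hl : 0 < l) {A : Ω → Matrix (Fin d) (Fin d) ℝ}
    (hA : ∀ a b, Measurable fun ω => A ω a b) (a b : Fin d) :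
    Measurable fun ω => regInvSqrt l (A ω) a b :=
  measurable_comp_of_continuousOn_posSemidef (continuousOn_regInvSqrt hl)
    (fun _ h => if_neg h) hA a b

theorem measurable_matrixSqrt {A : Ω → Matrix (Fin d) (Fin d) ℝ}
    (hA : ∀ a b, Measurable fun ω => A ω a b) (hp : ∀ ω, (A ω).PosSemidef) (a b : Fin d) :
    Measurable fun ω => matrixSqrt (A ω) a b := by
  classical
  have := measurable_comp_of_continuousOn_posSemidef
    (f := fun A => if A.PosSemidef then matrixSqrt A else 0)
    (continuousOn_matrixSqrt.congr fun A hA => if_pos hA) (fun _ h => if_neg h) hA a b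
  simpa [hp] using this

/-- The squared Frobenius norm of the square root is the trace, hence bounded by the norm. -/
theorem frobSq_matrixSqrt_le {A : Matrix (Fin d) (Fin d) ℝ} (hA : A.PosSemidef) :
    frobSq (matrixSqrt A) ≤ d * Real.sqrt (frobSq A) := by
  rw [← trace_mul_transpose_eq_frobSq, matrixSqrt_mul_transpose hA]
  refine (Finset.sum_le_sum fun a _ => (le_abs_self _).trans
    (Real.abs_le_sqrt (sq_entry_le_frobSq A a a))).trans ?_
  simp

end MatrixFunctions

end

/-! ### Convergence in measure, Lebesgue differentiation, processes from coefficients -/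

section

variable {d : ℕ} {T : ℝ} {Ω : Type*} {mΩ : MeasurableSpace Ω}

/-- Truncation at `1` makes dominated convergence available for functions that may be infinite. -/
theorem tendsto_measure_ge_of_tendsto_ae {μ : Measure Ω} [IsFiniteMeasure μ]
    {f : ℕ → Ω → ℝ≥0∞} (hf : ∀ n, AEMeasurable (f n) μ)
    (h : ∀ᵐ ω ∂μ, Tendsto (fun n => f n ω) atTop (𝓝 0)) {ε : ℝ≥0∞} (hε : 0 < ε) :
    Tendsto (fun n => μ {ω | ε ≤ f n ω}) atTop (𝓝 0) := by
  have h1 : Tendsto (fun n => ∫⁻ ω, min (f n ω) 1 ∂μ) atTop (𝓝 (∫⁻ _, 0 ∂μ)) := by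
    refine tendsto_lintegral_of_dominated_convergence' (fun _ => 1)
      (fun n => (hf n).min aemeasurable_const)
      (fun n => Eventually.of_forall fun _ => min_le_right _ _)
      (by simp) ?_
    filter_upwards [h] with ω hω
    simpa using hω.min (tendsto_const_nhds (x := (1 : ℝ≥0∞)))
  rw [lintegral_zero] at h1
  have hm : 0 < min ε 1 := lt_min hε one_pos
  have hm' : min ε 1 ≠ ∞ := ne_top_of_le_ne_top ENNReal.one_ne_top (min_le_right _ _)
  have h2 : Tendsto (fun n => (∫⁻ ω, min (f n ω) 1 ∂μ) / min ε 1) atTop (𝓝 0) := by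
    simpa using ENNReal.Tendsto.div_const h1 (Or.inr hm.ne')
  refine tendsto_of_tendsto_of_tendsto_of_le_of_le tendsto_const_nhds h2 (fun _ => zero_le)
    fun n => ?_
  refine le_trans (measure_mono fun ω hω => ?_)
    (meas_ge_le_lintegral_div ((hf n).min aemeasurable_const) hm.ne' hm')
  exact min_le_min_right 1 (show ε ≤ f n ω from hω)

section LebesguePoints

/-- The point `(r - η)⁺`. -/
def stepBack (r : Set.Icc (0 : ℝ) T) (η : ℝ≥0) : Set.Icc (0 : ℝ) T :=
  ⟨max 0 (r - η), le_max_left _ _,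
    max_le (r.2.1.trans r.2.2) ((sub_le_self _ η.2).trans r.2.2)⟩

theorem ae_timeMeasure_of_ae {p : ℝ → Prop} (h : ∀ᵐ x, p x) :
    ∀ᵐ s : Set.Icc (0 : ℝ) T ∂(timeMeasure T), p s := by
  rw [ae_iff] at h ⊢
  rw [timeMeasure_apply]
  refine measure_mono_null ?_ h
  rintro _ ⟨s, hs, rfl⟩
  exact hs

theorem ae_pos_time : ∀ᵐ s : Set.Icc (0 : ℝ) T ∂(timeMeasure T), (0 : ℝ) < s := by
  refine (ae_timeMeasure_of_ae (p := fun x => x ≠ 0) (by rw [ae_iff]; simp)).mono fun s hs => ?_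
  exact lt_of_le_of_ne s.2.1 (Ne.symm hs)

/-- Lebesgue differentiation with averages over intervals that end slightly before the point. -/
theorem ae_tendsto_average_stepBack {f : Set.Icc (0 : ℝ) T → ℝ}
    (hf : Integrable f (timeMeasure T)) :
    ∀ᵐ s ∂(timeMeasure T), ∀ (η : ℕ → ℝ≥0) (r : ℕ → Set.Icc (0 : ℝ) T),
      Tendsto η atTop (𝓝 0) → (∀ n, 0 < η n) → (∀ n, r n < s ∧ (s : ℝ) ≤ r n + η n) →
      Tendsto (fun n => (η n : ℝ)⁻¹ * ∫ y in Set.Ioc (stepBack (r n) (η n)) (r n), f y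
        ∂(timeMeasure T)) atTop (𝓝 (f s)) := by
  -- After extension by zero, averages over intervals cut off at time `0` are averages of `f'` over
  -- full intervals of length `η`, which matches the normalization by `η`.
  let f' : ℝ → ℝ := Function.extend Subtype.val f 0
  have hf's : ∀ s : Set.Icc (0 : ℝ) T, f' s = f s := fun s =>
    Subtype.val_injective.extend_apply _ _ _
  have hf'0 : ∀ x ∉ Set.Icc (0 : ℝ) T, f' x = 0 := fun x hx =>
    Function.extend_apply' _ _ _ (by rintro ⟨y, rfl⟩; exact hx y.2)
  have hemb := MeasurableEmbedding.subtype_coe (measurableSet_Icc (a := (0 : ℝ)) (b := T))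
  have hmap : (timeMeasure T).map Subtype.val = volume.restrict (Set.Icc (0 : ℝ) T) := by
    rw [timeMeasure, hemb.map_comap, Subtype.range_coe]
  have hf'c : f' ∘ Subtype.val = f := funext hf's
  have hint : Integrable f' volume := by
    have h1 : IntegrableOn f' (Set.Icc (0 : ℝ) T) := by
      rw [IntegrableOn, ← hmap, hemb.integrable_map_iff, hf'c]
      exact hf
    rw [← integrable_indicator_iff measurableSet_Icc] at h1
    have h2 : (Set.Icc (0 : ℝ) T).indicator f' = f' := by
      ext x
      by_cases hx : x ∈ Set.Icc (0 : ℝ) T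
      · rw [Set.indicator_of_mem hx]
      · rw [Set.indicator_of_notMem hx, hf'0 x hx]
    rwa [h2] at h1
  have hset : ∀ (r : Set.Icc (0 : ℝ) T) (η : ℝ≥0), ∫ x in Set.Icc ((r : ℝ) - η) r, f' x =
      ∫ y in Set.Ioc (stepBack r η) r, f y ∂(timeMeasure T) := by
    intro r η
    have h1 : ∫ x in Set.Icc ((r : ℝ) - η) r, f' x =
        ∫ x in Set.Icc ((r : ℝ) - η) r, f' x ∂(volume.restrict (Set.Icc (0 : ℝ) T)) := by
      rw [Measure.restrict_restrict measurableSet_Icc]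
      exact setIntegral_eq_of_subset_of_forall_sdiff_eq_zero measurableSet_Icc
        Set.inter_subset_left fun x hx => hf'0 x fun h => hx.2 ⟨hx.1, h⟩
    rw [h1, ← hmap, hemb.setIntegral_map]
    simp_rw [hf's]
    refine setIntegral_congr_set ?_
    have h2 : ∀ᵐ s : Set.Icc (0 : ℝ) T ∂(timeMeasure T), (s : ℝ) ≠ r - η :=
      ae_timeMeasure_of_ae (p := fun x => x ≠ r - η) (by rw [ae_iff]; simp)
    filter_upwards [ae_pos_time, h2] with s hs hs2
    refine propext ⟨fun h => ⟨?_, h.2⟩, fun h => ⟨?_, h.2⟩⟩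
    · exact max_lt hs (lt_of_le_of_ne h.1 (Ne.symm hs2))
    · exact (le_max_right _ _).trans (show max 0 ((r : ℝ) - η) < s from h.1).le
  refine (ae_timeMeasure_of_ae (IsUnifLocDoublingMeasure.ae_tendsto_average volume
    hint.locallyIntegrable 3)).mono fun s hs η r hη hη0 hr => ?_
  have hη' : Tendsto (fun n => (η n : ℝ)) atTop (𝓝 0) := by
    simpa using (NNReal.tendsto_coe.2 hη)
  -- The interval `[r - η, r]` is the ball of radius `η / 2` about `r - η / 2`. It does not contain
  -- `s`, but `s ≤ r + η` puts `s` in the ball of three times the radius, hence the constant `3`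
  -- above.
  have h1 := hs (l := atTop) (fun n => (r n : ℝ) - η n / 2) (fun n => (η n : ℝ) / 2)
    (tendsto_nhdsWithin_iff.2 ⟨by simpa using hη'.div_const 2,
      Eventually.of_forall fun n => by
        have : (0 : ℝ) < η n := hη0 n
        exact half_pos this⟩)
    (Eventually.of_forall fun n => by
      have h1 : (r n : ℝ) < s := (hr n).1
      have h2 := (hr n).2
      have h3 : (0 : ℝ) < η n := hη0 n
      rw [Metric.mem_closedBall, Real.dist_eq, abs_le]
      constructor <;> linarith)
  rw [hf's] at h1
  refine h1.congr fun n => ?_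
  have h3 : (0 : ℝ) < η n := hη0 n
  rw [Real.closedBall_eq_Icc, show (r n : ℝ) - η n / 2 - η n / 2 = r n - η n by ring,
    sub_add_cancel, setAverage_eq, hset, smul_eq_mul, measureReal_def, Real.volume_Icc,
    sub_sub_cancel, ENNReal.toReal_ofReal h3.le]

end LebesguePoints

section OfCoeff

variable {𝓕 : Filtration (Set.Icc (0 : ℝ) T) mΩ}

open scoped Classical in
/-- The step process with value `c j` on the `j`-th cell of the grid. -/
def Grid.ofCoeff (g : Grid T) (c : ℕ → Ω → Matrix (Fin d) (Fin d) ℝ) (s : Set.Icc (0 : ℝ) T)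
    (ω : Ω) : Matrix (Fin d) (Fin d) ℝ :=
  ∑ j ∈ Finset.range g.M, if g.u j < s ∧ s ≤ g.u (j + 1) then c j ω else 0

theorem Grid.lt_M {g : Grid T} {j : ℕ} {s : Set.Icc (0 : ℝ) T} (h : g.u j < s) : j < g.M := by
  by_contra hj
  have h1 : (g.u j : ℝ) < s := h
  rw [g.top j (not_lt.1 hj)] at h1
  exact absurd s.2.2 (not_le.2 h1)

theorem Grid.ofCoeff_apply (g : Grid T) {c : ℕ → Ω → Matrix (Fin d) (Fin d) ℝ}
    {s : Set.Icc (0 : ℝ) T} {j : ℕ} (h1 : g.u j < s) (h2 : s ≤ g.u (j + 1)) (ω : Ω) :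
    g.ofCoeff c s ω = c j ω := by
  unfold Grid.ofCoeff
  rw [Finset.sum_eq_single_of_mem j (Finset.mem_range.2 (Grid.lt_M h1)) fun i _ hij =>
    if_neg fun hi => hij (g.cell_unique hi ⟨h1, h2⟩), if_pos ⟨h1, h2⟩]

theorem Grid.ofCoeff_eq_zero_or (g : Grid T) (c : ℕ → Ω → Matrix (Fin d) (Fin d) ℝ)
    (s : Set.Icc (0 : ℝ) T) (ω : Ω) : g.ofCoeff c s ω = 0 ∨ ∃ j, g.ofCoeff c s ω = c j ω := by
  by_cases h : ∃ j, g.u j < s ∧ s ≤ g.u (j + 1)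
  · obtain ⟨j, h1, h2⟩ := h
    exact Or.inr ⟨j, g.ofCoeff_apply h1 h2 ω⟩
  · left
    push Not at h
    exact Finset.sum_eq_zero fun j _ => if_neg fun hj => absurd hj.2 (not_le.2 (h j hj.1))

theorem Grid.isStepOn_ofCoeff (g : Grid T) {c : ℕ → Ω → Matrix (Fin d) (Fin d) ℝ}
    (hc : IsAdaptedCoeff 𝓕 g.u c) : IsStepOn 𝓕 g (g.ofCoeff c) where
  const j s h1 h2 := by
    ext ω : 1
    rw [g.ofCoeff_apply h1 h2, g.ofCoeff_apply (h1.trans_le h2) le_rfl]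
  measurable j hj a b := by
    have : (fun ω => g.ofCoeff c (g.u (j + 1)) ω a b) = fun ω => c j ω a b := by
      ext ω
      rw [g.ofCoeff_apply hj le_rfl]
    rw [this]
    exact hc.measurable j a b
  bounded := by
    obtain ⟨C, hC⟩ := hc.bounded
    refine ⟨max C 0, fun s ω a b => ?_⟩
    rcases g.ofCoeff_eq_zero_or c s ω with h | ⟨j, h⟩
    · rw [h]
      simp
    · rw [h]
      exact (hC j ω a b).trans (le_max_left _ _)

theorem Grid.measurable_ofCoeff (g : Grid T) {c : ℕ → Ω → Matrix (Fin d) (Fin d) ℝ}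
    (hc : ∀ j a b, Measurable fun ω => c j ω a b) (a b : Fin d) :
    Measurable fun p : Set.Icc (0 : ℝ) T × Ω => g.ofCoeff c p.1 p.2 a b := by
  classical
  have : (fun p : Set.Icc (0 : ℝ) T × Ω => g.ofCoeff c p.1 p.2 a b) = fun p =>
      ∑ j ∈ Finset.range g.M,
        if g.u j < p.1 ∧ p.1 ≤ g.u (j + 1) then c j p.2 a b else 0 := by
    ext p
    unfold Grid.ofCoeff
    rw [Matrix.sum_apply]
    refine Finset.sum_congr rfl fun j _ => ?_
    split_ifs <;> rfl
  rw [this]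
  refine Finset.measurable_sum _ fun j _ => Measurable.ite ?_ ((hc j a b).comp measurable_snd)
    measurable_const
  exact measurable_fst (measurableSet_Ioc (a := g.u j) (b := g.u (j + 1)))

end OfCoeff

end

/-! ### Backward averages of the volatility and approximate inverses -/

section

variable {d : ℕ} {T : ℝ} {Ω : Type*} {mΩ : MeasurableSpace Ω}

theorem posSemidef_integral {β : Type*} {mβ : MeasurableSpace β} {ν : Measure β}
    {f : β → Matrix (Fin d) (Fin d) ℝ} (hf : ∀ a b, Integrable (fun x => f x a b) ν)
    (hp : ∀ x, (f x).PosSemidef) :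
    (Matrix.of fun a b => ∫ x, f x a b ∂ν).PosSemidef := by
  refine Matrix.PosSemidef.of_dotProduct_mulVec_nonneg ?_ fun x => ?_
  · ext a b
    simp only [Matrix.conjTranspose_apply, Matrix.of_apply, star_trivial]
    refine integral_congr_ae (Eventually.of_forall fun y => ?_)
    have := (hp y).isHermitian.apply a b
    simpa using this
  · have h : star x ⬝ᵥ (Matrix.of fun a b => ∫ y, f y a b ∂ν).mulVec x =
        ∫ y, star x ⬝ᵥ (f y).mulVec x ∂ν := by
      simp only [dotProduct, Matrix.mulVec, Matrix.of_apply]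
      rw [integral_finsetSum _ fun a _ => (integrable_finsetSum _ fun b _ =>
        (hf a b).mul_const _).const_mul _]
      refine Finset.sum_congr rfl fun a _ => ?_
      rw [integral_const_mul, integral_finsetSum _ fun b _ => (hf a b).mul_const _]
      simp_rw [integral_mul_const]
    rw [h]
    exact integral_nonneg fun y => (hp y).dotProduct_mulVec_nonneg x

/-- `α` is an adapted process with positive definite values and integrable paths. -/
structure IsVolatility (μ : Measure Ω) (𝓕 : Filtration (Set.Icc (0 : ℝ) T) mΩ)
    (α : Set.Icc (0 : ℝ) T → Ω → Matrix (Fin d) (Fin d) ℝ) : Prop where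
  posDef : ∀ s ω, (α s ω).PosDef
  measurable : ∀ a b, Measurable fun p : Set.Icc (0 : ℝ) T × Ω => α p.1 p.2 a b
  -- Beyond joint measurability, progressive measurability is needed only through these time
  -- integrals.
  adapted : ∀ q r a b, Measurable[𝓕 r] fun ω => ∫ y in Set.Ioc q r, α y ω a b ∂(timeMeasure T)
  finite : ∀ᵐ ω ∂μ, ∫⁻ s, ENNReal.ofReal (Real.sqrt (frobSq (α s ω))) ∂(timeMeasure T) < ∞

/-- The average of `α` over the interval of length `η` that ends at `r`. -/
def backAverage (α : Set.Icc (0 : ℝ) T → Ω → Matrix (Fin d) (Fin d) ℝ) (η : ℝ≥0)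
    (r : Set.Icc (0 : ℝ) T) (ω : Ω) : Matrix (Fin d) (Fin d) ℝ :=
  -- The interval lies before `r`, so the average is known at time `r` and can be read off from the
  -- covariation of `X` up to `r`.
  Matrix.of fun a b => (η : ℝ)⁻¹ * ∫ y in Set.Ioc (stepBack r η) r, α y ω a b ∂(timeMeasure T)

section

variable {μ : Measure Ω} {𝓕 : Filtration (Set.Icc (0 : ℝ) T) mΩ}
  {W X : Set.Icc (0 : ℝ) T → Ω → EuclideanSpace ℝ (Fin d)}
  {α : Set.Icc (0 : ℝ) T → Ω → Matrix (Fin d) (Fin d) ℝ}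
  {S : ℕ → Set.Icc (0 : ℝ) T → Ω → Matrix (Fin d) (Fin d) ℝ}
  {Y : ℕ → Set.Icc (0 : ℝ) T → Ω → EuclideanSpace ℝ (Fin d)}
  {F : ℕ → Finset (Set.Icc (0 : ℝ) T)}

theorem IsVolatility.measurable_path (hα : IsVolatility μ 𝓕 α) (ω : Ω) (a b : Fin d) :
    Measurable fun s => α s ω a b :=
  (hα.measurable a b).comp measurable_prodMk_right

theorem IsVolatility.integrable (hα : IsVolatility μ 𝓕 α) {ω : Ω}
    (h : ∫⁻ s, ENNReal.ofReal (Real.sqrt (frobSq (α s ω))) ∂(timeMeasure T) < ∞) (a b : Fin d) :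
    Integrable (fun s => α s ω a b) (timeMeasure T) := by
  have h1 : Integrable (fun s => Real.sqrt (frobSq (α s ω))) (timeMeasure T) :=
    integrable_of_nonneg_of_lintegral_lt_top
      (measurable_frobSq_of_entries (hα.measurable_path ω)).sqrt.aemeasurable
      (fun _ => Real.sqrt_nonneg _) h
  exact h1.mono' (hα.measurable_path ω a b).aestronglyMeasurable
    (Eventually.of_forall fun s => Real.abs_le_sqrt (sq_entry_le_frobSq _ _ _))

theorem IsVolatility.lintegral_frobSq_matrixSqrt_lt_top (hα : IsVolatility μ 𝓕 α) {ω : Ω}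
    (h : ∫⁻ s, ENNReal.ofReal (Real.sqrt (frobSq (α s ω))) ∂(timeMeasure T) < ∞) :
    ∫⁻ s, ENNReal.ofReal (frobSq (matrixSqrt (α s ω))) ∂(timeMeasure T) < ∞ := by
  calc _ ≤ ∫⁻ s, ENNReal.ofReal d * ENNReal.ofReal (Real.sqrt (frobSq (α s ω)))
        ∂(timeMeasure T) := by
        refine lintegral_mono fun s => ?_
        rw [← ENNReal.ofReal_mul (by positivity)]
        exact ENNReal.ofReal_le_ofReal (frobSq_matrixSqrt_le (hα.posDef s ω).posSemidef)
    _ = ENNReal.ofReal d * _ := lintegral_const_mul' _ _ ENNReal.ofReal_ne_top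
    _ < ∞ := ENNReal.mul_lt_top ENNReal.ofReal_lt_top h

theorem posSemidef_backAverage (hα : ∀ s ω, (α s ω).PosSemidef) {ω : Ω}
    (h : ∀ a b, Integrable (fun s => α s ω a b) (timeMeasure T)) (η : ℝ≥0)
    (r : Set.Icc (0 : ℝ) T) : (backAverage α η r ω).PosSemidef := by
  have h1 := (posSemidef_integral (ν := (timeMeasure T).restrict (Set.Ioc (stepBack r η) r))
    (f := fun s => α s ω) (fun a b => (h a b).integrableOn) fun s => hα s ω).smul
    (inv_nonneg.2 η.2)
  exact h1

theorem IsVolatility.measurable_backAverage (hα : IsVolatility μ 𝓕 α) (η : ℝ≥0)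
    (r : Set.Icc (0 : ℝ) T) (a b : Fin d) : Measurable[𝓕 r] fun ω => backAverage α η r ω a b :=
  (hα.adapted _ _ _ _).const_mul _

/-- The regularized inverse square roots of the averages converge as the mesh of the grid tends
to zero. -/
theorem IsVolatility.tendsto_lintegral_ofCoeff (hα : IsVolatility μ 𝓕 α) {ω : Ω}
    (h : ∫⁻ s, ENNReal.ofReal (Real.sqrt (frobSq (α s ω))) ∂(timeMeasure T) < ∞) {l : ℝ}
    (hl : 0 < l) {η : ℕ → ℝ≥0} (hη : Tendsto η atTop (𝓝 0)) (hη0 : ∀ n, 0 < η n)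
    (g : ℕ → Grid T) (hg : ∀ n j, ((g n).u (j + 1) : ℝ) - (g n).u j ≤ η n) :
    Tendsto (fun n => ∫⁻ s, ENNReal.ofReal (frobSq (((g n).ofCoeff
      (fun j ω => regInvSqrt l (backAverage α (η n) ((g n).u j) ω)) s ω -
        regInvSqrt l (α s ω)) * matrixSqrt (α s ω))) ∂(timeMeasure T)) atTop (𝓝 0) := by
  have hp : ∀ s ω, (α s ω).PosSemidef := fun s ω => (hα.posDef s ω).posSemidef
  have hHm : ∀ a b, Measurable fun s => matrixSqrt (α s ω) a b :=
    measurable_matrixSqrt (hα.measurable_path ω) fun s => hp s ω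
  have hrm : ∀ a b, Measurable fun s => regInvSqrt l (α s ω) a b :=
    measurable_regInvSqrt hl (hα.measurable_path ω)
  have hint := hα.integrable h
  have hb : ∀ n s, frobSq ((g n).ofCoeff
      (fun j ω => regInvSqrt l (backAverage α (η n) ((g n).u j) ω)) s ω) ≤ d / l ^ 2 := by
    intro n s
    rcases (g n).ofCoeff_eq_zero_or
      (fun j ω => regInvSqrt l (backAverage α (η n) ((g n).u j) ω)) s ω with h0 | ⟨j, h0⟩
    · rw [h0, frobSq_zero]
      positivity
    · rw [h0]
      exact frobSq_regInvSqrt_le hl _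
  have hstep : ∀ n a b, AEMeasurable (fun s => (g n).ofCoeff
      (fun j ω => regInvSqrt l (backAverage α (η n) ((g n).u j) ω)) s ω a b) (timeMeasure T) :=
    fun n a b => (g n).aemeasurable_of_step fun j s h1 h2 => by
      rw [(g n).ofCoeff_apply h1 h2, (g n).ofCoeff_apply (h1.trans_le h2) le_rfl]
  rw [show (0 : ℝ≥0∞) = ∫⁻ _ : Set.Icc (0 : ℝ) T, 0 ∂(timeMeasure T) by simp]
  refine tendsto_lintegral_of_dominated_convergence'
    (fun s => ENNReal.ofReal (4 * (d / l ^ 2)) * ENNReal.ofReal (frobSq (matrixSqrt (α s ω))))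
    (fun n => ?_) (fun n => Eventually.of_forall fun s => ?_) ?_ ?_
  · refine (Finset.aemeasurable_fun_sum _ fun a _ => Finset.aemeasurable_fun_sum _ fun b _ =>
      AEMeasurable.pow_const ?_ 2).ennreal_ofReal
    simp only [Matrix.mul_apply, Matrix.sub_apply]
    exact Finset.aemeasurable_fun_sum _ fun c _ =>
      ((hstep n a c).sub (hrm a c).aemeasurable).mul (hHm c b).aemeasurable
  · beta_reduce
    rw [← ENNReal.ofReal_mul (by positivity)]
    refine ENNReal.ofReal_le_ofReal ((frobSq_mul_le _ _).trans
      (mul_le_mul_of_nonneg_right ?_ (frobSq_nonneg _)))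
    rw [sub_eq_add_neg]
    refine (frobSq_add_le _ _).trans ?_
    rw [frobSq_neg]
    linarith [hb n s, frobSq_regInvSqrt_le hl (α s ω)]
  · rw [lintegral_const_mul' _ _ ENNReal.ofReal_ne_top]
    exact ENNReal.mul_ne_top ENNReal.ofReal_ne_top
      (hα.lintegral_frobSq_matrixSqrt_lt_top h).ne
  · have hL : ∀ᵐ s ∂(timeMeasure T), ∀ a b, ∀ (η : ℕ → ℝ≥0) (r : ℕ → Set.Icc (0 : ℝ) T),
        Tendsto η atTop (𝓝 0) → (∀ n, 0 < η n) → (∀ n, r n < s ∧ (s : ℝ) ≤ r n + η n) →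
        Tendsto (fun n => (η n : ℝ)⁻¹ * ∫ y in Set.Ioc (stepBack (r n) (η n)) (r n), α y ω a b
          ∂(timeMeasure T)) atTop (𝓝 (α s ω a b)) :=
      ae_all_iff.2 fun a => ae_all_iff.2 fun b => ae_tendsto_average_stepBack (hint a b)
    filter_upwards [hL, ae_pos_time] with s hs hs0
    have hcell : ∀ n, ∃ j, (g n).u j < s ∧ s ≤ (g n).u (j + 1) := fun n => by
      obtain ⟨j, -, hj⟩ := (g n).exists_cell hs0
      exact ⟨j, hj⟩
    choose j hj1 hj2 using hcell
    have hconv : Tendsto (fun n => backAverage α (η n) ((g n).u (j n)) ω) atTop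
        (𝓝 (α s ω)) := by
      refine tendsto_pi_nhds.2 fun a => tendsto_pi_nhds.2 fun b =>
        hs a b η (fun n => (g n).u (j n)) hη hη0 fun n => ⟨hj1 n, ?_⟩
      have h1 : (s : ℝ) ≤ (g n).u (j n + 1) := hj2 n
      linarith [hg n (j n)]
    have hconv2 : Tendsto (fun n => regInvSqrt l (backAverage α (η n) ((g n).u (j n)) ω)) atTop
        (𝓝 (regInvSqrt l (α s ω))) :=
      (continuousOn_regInvSqrt hl (α s ω) (hp s ω)).tendsto.comp
        (tendsto_nhdsWithin_iff.2 ⟨hconv, Eventually.of_forall fun n =>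
          posSemidef_backAverage hp hint _ _⟩)
    have hcont : Continuous fun A : Matrix (Fin d) (Fin d) ℝ =>
        ENNReal.ofReal (frobSq ((A - regInvSqrt l (α s ω)) * matrixSqrt (α s ω))) := by
      refine ENNReal.continuous_ofReal.comp (continuous_frobSq.comp ?_)
      exact (continuous_id.sub continuous_const).matrix_mul continuous_const
    have := (hcont.tendsto (regInvSqrt l (α s ω))).comp hconv2
    rw [sub_self, zero_mul, frobSq_zero, ENNReal.ofReal_zero] at this
    refine this.congr fun n => ?_
    simp only [Function.comp_apply]
    rw [(g n).ofCoeff_apply (hj1 n) (hj2 n)]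

theorem IsVolatility.tendsto_lintegral_regInvSqrt (hα : IsVolatility μ 𝓕 α) (ω : Ω) :
    Tendsto (fun n : ℕ => ∫⁻ s, ENNReal.ofReal (frobSq (regInvSqrt (1 / ((n : ℝ) + 1)) (α s ω) *
      matrixSqrt (α s ω) - 1)) ∂(timeMeasure T)) atTop (𝓝 0) := by
  have hp : ∀ s ω, (α s ω).PosSemidef := fun s ω => (hα.posDef s ω).posSemidef
  have hpos : ∀ n : ℕ, 0 < 1 / ((n : ℝ) + 1) := fun n => by positivity
  rw [show (0 : ℝ≥0∞) = ∫⁻ _ : Set.Icc (0 : ℝ) T, 0 ∂(timeMeasure T) by simp]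
  refine tendsto_lintegral_of_dominated_convergence (fun _ => ENNReal.ofReal d) (fun n => ?_)
    (fun n => Eventually.of_forall fun s => ENNReal.ofReal_le_ofReal
      (frobSq_regInvSqrt_mul_sub_one_le (hpos n) (hp s ω))) ?_
    (Eventually.of_forall fun s => ?_)
  · refine (measurable_frobSq_of_entries fun a b => ?_).ennreal_ofReal
    simp only [Matrix.mul_apply, Matrix.sub_apply]
    exact (Finset.measurable_sum _ fun c _ =>
      (measurable_regInvSqrt (hpos n) (hα.measurable_path ω) a c).mul
        (measurable_matrixSqrt (hα.measurable_path ω) (fun s => hp s ω) c b)).sub_const _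
  · rw [lintegral_const]
    exact ENNReal.mul_ne_top ENNReal.ofReal_ne_top (measure_ne_top _ _)
  · have h1 : Tendsto (fun n : ℕ => 1 / ((n : ℝ) + 1)) atTop (𝓝[>] 0) :=
      tendsto_nhdsWithin_iff.2 ⟨tendsto_one_div_add_atTop_nhds_zero_nat,
        Eventually.of_forall hpos⟩
    have := (ENNReal.continuous_ofReal.tendsto _).comp
      ((tendsto_frobSq_regInvSqrt_mul_sub_one (hα.posDef s ω)).comp h1)
    rwa [ENNReal.ofReal_zero] at this

/-- There are step processes `K`, built from averages of `α`, with `K α^{1/2}` close to the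
identity. -/
theorem IsVolatility.exists_approx_inverse [IsProbabilityMeasure μ] (hα : IsVolatility μ 𝓕 α)
    (hT : 0 < T) (t : Set.Icc (0 : ℝ) T) {θ ε : ℝ} (hθ : 0 < θ) (hε : 0 < ε) :
    ∃ (g : Grid T) (l : ℝ) (η : ℝ≥0), t ∈ Set.range g.u ∧ 0 < l ∧
      μ {ω | ENNReal.ofReal θ ≤ ∫⁻ s, ENNReal.ofReal (frobSq (g.ofCoeff
        (fun j ω => regInvSqrt l (backAverage α η (g.u j) ω)) s ω * matrixSqrt (α s ω) - 1))
          ∂(timeMeasure T)} ≤ ENNReal.ofReal ε := by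
  have hp : ∀ s ω, (α s ω).PosSemidef := fun s ω => (hα.posDef s ω).posSemidef
  have hHm : ∀ a b, Measurable fun p : Set.Icc (0 : ℝ) T × Ω => matrixSqrt (α p.1 p.2) a b :=
    measurable_matrixSqrt hα.measurable fun p => hp p.1 p.2
  have hrm : ∀ {l : ℝ}, 0 < l → ∀ a b, Measurable fun p : Set.Icc (0 : ℝ) T × Ω =>
      regInvSqrt l (α p.1 p.2) a b := fun hl => measurable_regInvSqrt hl hα.measurable
  have hpos : ∀ n : ℕ, 0 < 1 / ((n : ℝ) + 1) := fun n => by positivity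
  have hm1 : ∀ n : ℕ, Measurable fun p : Set.Icc (0 : ℝ) T × Ω => ENNReal.ofReal (frobSq
      (regInvSqrt (1 / ((n : ℝ) + 1)) (α p.1 p.2) * matrixSqrt (α p.1 p.2) - 1)) := fun n => by
    refine (measurable_frobSq_of_entries fun a b => ?_).ennreal_ofReal
    simp only [Matrix.mul_apply, Matrix.sub_apply]
    exact (Finset.measurable_sum _ fun c _ => (hrm (hpos n) a c).mul (hHm c b)).sub_const _
  have hlim1 := tendsto_measure_ge_of_tendsto_ae (μ := μ)
    (fun n => (hm1 n).lintegral_prod_left'.aemeasurable)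
    (Eventually.of_forall hα.tendsto_lintegral_regInvSqrt)
    (show 0 < ENNReal.ofReal (θ / 4) by rw [ENNReal.ofReal_pos]; positivity)
  have hε2 : 0 < ENNReal.ofReal (ε / 2) := by rw [ENNReal.ofReal_pos]; positivity
  -- The regularization `l` is fixed first and the grid is refined afterwards, since the step
  -- coefficients are bounded only for fixed `l`. The two thresholds `θ / 4` add up to `θ` through
  -- `|A + B|² ≤ 2|A|² + 2|B|²`.
  obtain ⟨m, hm⟩ := (hlim1.eventually (eventually_le_nhds hε2)).exists
  set l : ℝ := 1 / ((m : ℝ) + 1)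
  have hl : 0 < l := hpos m
  let η : ℕ → ℝ≥0 := fun n => ⟨1 / ((n : ℝ) + 1), (hpos n).le⟩
  have hη : Tendsto η atTop (𝓝 0) :=
    NNReal.tendsto_coe.1 tendsto_one_div_add_atTop_nhds_zero_nat
  choose g hgt hg using fun n => exists_grid hT {t} (hpos n)
  have hcm : ∀ n j a b, Measurable fun ω =>
      regInvSqrt l (backAverage α (η n) ((g n).u j) ω) a b := fun n j a b =>
    measurable_regInvSqrt hl (fun a b => (hα.measurable_backAverage (η n) ((g n).u j) a b).mono
      (𝓕.le _) le_rfl) a b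
  have hm2 : ∀ n : ℕ, Measurable fun p : Set.Icc (0 : ℝ) T × Ω => ENNReal.ofReal (frobSq
      (((g n).ofCoeff (fun j ω => regInvSqrt l (backAverage α (η n) ((g n).u j) ω)) p.1 p.2 -
        regInvSqrt l (α p.1 p.2)) * matrixSqrt (α p.1 p.2))) := fun n => by
    refine (measurable_frobSq_of_entries fun a b => ?_).ennreal_ofReal
    simp only [Matrix.mul_apply, Matrix.sub_apply]
    exact Finset.measurable_sum _ fun c _ =>
      (((g n).measurable_ofCoeff (hcm n) a c).sub (hrm hl a c)).mul (hHm c b)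
  have hlim2 := tendsto_measure_ge_of_tendsto_ae (μ := μ)
    (fun n => (hm2 n).lintegral_prod_left'.aemeasurable)
    (hα.finite.mono fun ω hω => hα.tendsto_lintegral_ofCoeff hω hl hη (fun n => hpos n) g
      fun n j => hg n j)
    (show 0 < ENNReal.ofReal (θ / 4) by rw [ENNReal.ofReal_pos]; positivity)
  obtain ⟨n, hn⟩ := (hlim2.eventually (eventually_le_nhds hε2)).exists
  refine ⟨g n, l, η n, hgt n t (Finset.mem_singleton_self t), hl, ?_⟩
  rw [← add_halves ε, ENNReal.ofReal_add (by positivity) (by positivity)]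
  refine le_trans ((measure_mono fun ω hω => ?_).trans (measure_union_le _ _)) (add_le_add hn hm)
  by_contra hcon
  rw [Set.mem_union, not_or] at hcon
  have h1 := not_le.1 (show ¬ (ENNReal.ofReal (θ / 4) ≤ _) from hcon.1)
  have h2 := not_le.1 (show ¬ (ENNReal.ofReal (θ / 4) ≤ _) from hcon.2)
  have h3 : ENNReal.ofReal θ ≤ _ := hω
  refine absurd h3 (not_le.2 ?_)
  calc _ ≤ ∫⁻ s, (2 * ENNReal.ofReal (frobSq (((g n).ofCoeff
          (fun j ω => regInvSqrt l (backAverage α (η n) ((g n).u j) ω)) s ω -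
            regInvSqrt l (α s ω)) * matrixSqrt (α s ω))) +
          2 * ENNReal.ofReal (frobSq (regInvSqrt l (α s ω) * matrixSqrt (α s ω) - 1)))
            ∂(timeMeasure T) := by
        refine lintegral_mono fun s => ?_
        rw [show (2 : ℝ≥0∞) = ENNReal.ofReal 2 by simp, ← ENNReal.ofReal_mul (by norm_num),
          ← ENNReal.ofReal_mul (by norm_num), ← ENNReal.ofReal_add
            (mul_nonneg (by norm_num) (frobSq_nonneg _))
            (mul_nonneg (by norm_num) (frobSq_nonneg _))]
        refine ENNReal.ofReal_le_ofReal (le_trans (le_of_eq ?_) (frobSq_add_le _ _))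
        congr 1
        rw [sub_mul]
        abel
    _ = 2 * ∫⁻ s, ENNReal.ofReal (frobSq (((g n).ofCoeff
          (fun j ω => regInvSqrt l (backAverage α (η n) ((g n).u j) ω)) s ω -
            regInvSqrt l (α s ω)) * matrixSqrt (α s ω))) ∂(timeMeasure T) +
        2 * ∫⁻ s, ENNReal.ofReal (frobSq (regInvSqrt l (α s ω) * matrixSqrt (α s ω) - 1))
            ∂(timeMeasure T) := by
        rw [lintegral_add_left, lintegral_const_mul' _ _ (by simp),
          lintegral_const_mul' _ _ (by simp)]
        exact ((hm2 n).comp measurable_prodMk_right).const_mul 2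
    _ < 2 * ENNReal.ofReal (θ / 4) + 2 * ENNReal.ofReal (θ / 4) := by
        refine ENNReal.add_lt_add ?_ ?_ <;>
          exact (ENNReal.mul_lt_mul_iff_right (by simp) (by simp)).2 (by assumption)
    _ = ENNReal.ofReal θ := by
        rw [← two_mul, ← mul_assoc, show (2 : ℝ≥0∞) * 2 = ENNReal.ofReal 4 by
          rw [show (4 : ℝ) = 2 * 2 by norm_num, ENNReal.ofReal_mul (by norm_num)]; simp,
          ← ENNReal.ofReal_mul (by norm_num)]
        congr 1
        ring

end

end

/-! ### Recovery of the Brownian motion from the Itô integral -/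

section

variable {d : ℕ} {T : ℝ} {Ω : Type*} {mΩ : MeasurableSpace Ω}

section

variable {μ : Measure Ω} {𝓕 : Filtration (Set.Icc (0 : ℝ) T) mΩ}
  {W X : Set.Icc (0 : ℝ) T → Ω → EuclideanSpace ℝ (Fin d)}
  {α : Set.Icc (0 : ℝ) T → Ω → Matrix (Fin d) (Fin d) ℝ}
  {S : ℕ → Set.Icc (0 : ℝ) T → Ω → Matrix (Fin d) (Fin d) ℝ}
  {Y : ℕ → Set.Icc (0 : ℝ) T → Ω → EuclideanSpace ℝ (Fin d)}
  {F : ℕ → Finset (Set.Icc (0 : ℝ) T)}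

/-- The averages of `α` are functionals of `X = ∫ α^{1/2} dW`. -/
theorem ItoApprox.exists_measurable_backAverage [IsProbabilityMeasure μ] (hW : IsBrownian μ 𝓕 W)
    (hT : 0 < T) (hα : IsVolatility μ 𝓕 α)
    (hX : ItoApprox μ 𝓕 W (fun s ω => matrixSqrt (α s ω)) X S Y F) (η : ℝ≥0)
    (r : Set.Icc (0 : ℝ) T) :
    ∃ A : Ω → Matrix (Fin d) (Fin d) ℝ,
      (∀ a b, Measurable[⨆ q ≤ r, MeasurableSpace.comap (X q) inferInstance]
        fun ω => A ω a b) ∧ backAverage α η r =ᵐ[μ] A := by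
  have hR : ∀ᵐ ω ∂μ, ∫⁻ s, ENNReal.ofReal (frobSq (matrixSqrt (α s ω))) ∂(timeMeasure T) < ∞ :=
    hα.finite.mono fun ω hω => hα.lintegral_frobSq_matrixSqrt_lt_top hω
  have h := fun q a b => hX.exists_measurable_setIntegral hW hT hR q a b
  choose A hA hA' using h
  have hle : stepBack r η ≤ r := max_le r.2.1 (sub_le_self _ η.2)
  refine ⟨fun ω => Matrix.of fun a b => (η : ℝ)⁻¹ * (A r a b ω - A (stepBack r η) a b ω),
    fun a b => ((hA r a b).sub ((hA (stepBack r η) a b).mono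
      (biSup_mono fun q hq => hq.trans hle) le_rfl)).const_mul _, ?_⟩
  have h1 : ∀ᵐ ω ∂μ, ∀ a b, ∫ s in Set.Iic r,
      (matrixSqrt (α s ω) * (matrixSqrt (α s ω)).transpose) a b ∂(timeMeasure T) = A r a b ω :=
    ae_all_iff.2 fun a => ae_all_iff.2 fun b => hA' r a b
  have h2 : ∀ᵐ ω ∂μ, ∀ a b, ∫ s in Set.Iic (stepBack r η),
      (matrixSqrt (α s ω) * (matrixSqrt (α s ω)).transpose) a b ∂(timeMeasure T) =
        A (stepBack r η) a b ω :=
    ae_all_iff.2 fun a => ae_all_iff.2 fun b => hA' _ a b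
  filter_upwards [h1, h2, hα.finite] with ω h1 h2 hfin
  ext a b
  have hint := hα.integrable hfin a b
  -- Since `α^{1/2} (α^{1/2})ᵀ = α`, the covariation of `X` up to `q` is `∫_0^q α ds`.
  have e : ∀ q : Set.Icc (0 : ℝ) T, ∫ s in Set.Iic q,
      (matrixSqrt (α s ω) * (matrixSqrt (α s ω)).transpose) a b ∂(timeMeasure T) =
      ∫ s in Set.Iic q, α s ω a b ∂(timeMeasure T) := fun q => by
    simp_rw [matrixSqrt_mul_transpose (hα.posDef _ ω).posSemidef]
  change (η : ℝ)⁻¹ * _ = (η : ℝ)⁻¹ * (A r a b ω - A (stepBack r η) a b ω)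
  rw [← h1, ← h2, e, e, ← Set.Iic_sdiff_Iic,
    setIntegral_sdiff measurableSet_Iic hint.integrableOn (Set.Iic_subset_Iic.2 hle)]

/-- The Brownian motion `W` is a functional of `X = ∫ α^{1/2} dW`, without anticipation. -/
theorem ItoApprox.exists_measurable_driver [IsProbabilityMeasure μ] (hW : IsBrownian μ 𝓕 W)
    (hT : 0 < T) (hα : IsVolatility μ 𝓕 α)
    (hX : ItoApprox μ 𝓕 W (fun s ω => matrixSqrt (α s ω)) X S Y F) (t : Set.Icc (0 : ℝ) T)
    (a : Fin d) :
    ∃ A : Ω → ℝ, Measurable[⨆ q ≤ t, MeasurableSpace.comap (X q) inferInstance] A ∧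
      (fun ω => W t ω a) =ᵐ[μ] A := by
  classical
  have hXm : ∀ q ≤ t, ∀ b, Measurable[⨆ q ≤ t, MeasurableSpace.comap (X q) inferInstance]
      fun ω => X q ω b := fun q hq b =>
    ((EuclideanSpace.proj b).continuous.measurable.comp (comap_measurable (X q))).mono
      (le_iSup₂_of_le q hq le_rfl) le_rfl
  have key : ∀ ε : ℝ, 0 < ε → ∃ (f : Ω → ℝ) (bad : Set Ω),
      Measurable[⨆ q ≤ t, MeasurableSpace.comap (X q) inferInstance] f ∧
      μ bad ≤ 2 * ENNReal.ofReal ε ∧ ∀ᵐ ω ∂μ, ω ∉ bad → ‖f ω - W t ω a‖ ≤ ε := by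
    intro ε hε
    set ε₁ : ℝ := ε ^ 3 / (4 * (d + 1)) with hε₁
    have hε₁0 : 0 < ε₁ := by positivity
    obtain ⟨g, l, η, htg, hl, hbad⟩ := hα.exists_approx_inverse hT t
      (show 0 < ε₁ / 4 by positivity) hε
    set c : ℕ → Ω → Matrix (Fin d) (Fin d) ℝ := fun j ω =>
      regInvSqrt l (backAverage α η (g.u j) ω) with hc
    have hcA : IsAdaptedCoeff 𝓕 g.u c := by
      refine ⟨fun j a b => measurable_regInvSqrt hl
        (fun a b => hα.measurable_backAverage η (g.u j) a b) a b, Real.sqrt (d / l ^ 2),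
        fun j ω a b => Real.abs_le_sqrt ((sq_entry_le_frobSq _ a b).trans
          (frobSq_regInvSqrt_le hl _))⟩
    have hone : IsStepOn 𝓕 g fun _ (_ : Ω) => (1 : Matrix (Fin d) (Fin d) ℝ) :=
      ⟨fun _ _ _ _ => rfl, fun _ _ _ _ => measurable_const, 1, fun _ _ a b => by
        rw [Matrix.one_apply]
        split_ifs <;> simp⟩
    -- With `K` the approximate inverse and `D` the identity, both cut off at `t`, and a single
    -- class, the residual is `∫_0^t K dX - W_t`.
    have hP := hX.measure_sum_residual_sq_ge_le hW hT g ((g.isStepOn_ofCoeff hcA).restrict htg)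
      (hone.restrict htg) 1 (fun l _ => l = 0)
      (fun k l l' h h' => h.trans h'.symm) hε₁0 (by positivity : 0 < ε ^ 2)
    choose A hA hA' using fun r => hX.exists_measurable_backAverage hW hT hα η r
    -- This is `∫_0^t K dX` with every average replaced by its version that depends on `X` alone;
    -- the two coincide almost surely.
    let f : Ω → ℝ := fun ω => (∑ k ∈ Finset.range g.M, if g.u (k + 1) ≤ t then
      Matrix.toEuclideanLin (regInvSqrt l (A (g.u k) ω)) (X (g.u (k + 1)) ω - X (g.u k) ω)
        else 0) a
    refine ⟨f, _, ?_, hP.trans ?_, ?_⟩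
    · have : f = fun ω => ∑ k ∈ Finset.range g.M, if g.u (k + 1) ≤ t then
          ∑ b, regInvSqrt l (A (g.u k) ω) a b * (X (g.u (k + 1)) ω b - X (g.u k) ω b)
            else 0 := by
        ext ω
        simp only [f]
        rw [WithLp.ofLp_sum, Finset.sum_apply]
        refine Finset.sum_congr rfl fun k _ => ?_
        split_ifs
        · rfl
        · rfl
      rw [this]
      refine Finset.measurable_sum _ fun k _ => ?_
      by_cases hk : g.u (k + 1) ≤ t
      · simp only [hk, if_true]
        have hk' : g.u k ≤ t := (g.mono k.le_succ).trans hk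
        exact Finset.measurable_sum _ fun b _ => (measurable_regInvSqrt hl (fun a b =>
          (hA (g.u k) a b).mono (biSup_mono fun q hq => hq.trans hk') le_rfl) a b).mul
            ((hXm _ hk b).sub (hXm _ hk' b))
      · simp only [hk, if_false]
        exact measurable_const
    · rw [two_mul]
      refine add_le_add (le_trans (measure_mono fun ω hω => ?_) hbad)
        (ENNReal.ofReal_le_ofReal ?_)
      · refine le_trans (show ENNReal.ofReal (ε₁ / 4) ≤ _ from hω) (lintegral_mono fun s =>
          ENNReal.ofReal_le_ofReal ?_)
        by_cases hs : s ≤ t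
        · simp [hs, hc]
        · simpa [hs] using frobSq_nonneg _
      · calc 4 * (d : ℝ) * ε₁ / ε ^ 2 = ε * (d / (d + 1)) := by rw [hε₁]; field_simp
          _ ≤ ε * 1 := by
            gcongr
            rw [div_le_one (by positivity)]
            linarith
          _ = ε := mul_one _
    · have hAall : ∀ᵐ ω ∂μ, ∀ k, backAverage α η (g.u k) ω = A (g.u k) ω :=
        ae_all_iff.2 fun k => hA' (g.u k)
      filter_upwards [hAall] with ω hAω hω
      have hlt := not_le.1 (show ¬ (ε ^ 2 ≤ _) from hω)
      rw [Finset.sum_range_one] at hlt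
      have hW0 : W (g.u 0) ω = 0 := hW.zero _ g.zero ω
      have e : g.residual W X (fun s ω => if s ≤ t then g.ofCoeff c s ω else 0)
          (fun s _ => if s ≤ t then 1 else 0) (fun _ => 0 = 0) ω =
          (∑ k ∈ Finset.range g.M, if g.u (k + 1) ≤ t then
            Matrix.toEuclideanLin (regInvSqrt l (A (g.u k) ω))
              (X (g.u (k + 1)) ω - X (g.u k) ω) else 0) - W t ω := by
        have h1 := g.increment_eq_sum (W := W) (show g.u 0 ≤ t by
          change (g.u 0 : ℝ) ≤ t
          rw [g.zero]
          exact t.2.1) ⟨0, rfl⟩ htg ω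
        rw [hW0, sub_zero] at h1
        rw [h1]
        unfold Grid.residual
        rw [← Finset.sum_sub_distrib]
        refine Finset.sum_congr rfl fun k _ => ?_
        have hk0 : g.u 0 ≤ g.u k := g.mono k.zero_le
        by_cases hk : g.u (k + 1) ≤ t
        · simp only [hk, hk0, if_true, and_self]
          congr 1
          · rcases (g.mono k.le_succ).eq_or_lt with h | h
            · rw [Nat.succ_eq_add_one] at h
              rw [← h, sub_self, map_zero, map_zero]
            · rw [g.ofCoeff_apply h le_rfl, hc, ← hAω k]
          · simp [Matrix.toEuclideanLin]
        · simp [hk]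
      have hcoord : ∀ u v : EuclideanSpace ℝ (Fin d), ‖u a - v a‖ ≤ ‖u - v‖ := fun u v =>
        abs_le_of_sq_le_sq (sq_apply_le_norm_sq (u - v) a) (norm_nonneg _)
      have hnorm := lt_of_pow_lt_pow_left₀ 2 hε.le hlt
      have h2 : ‖f ω - W t ω a‖ ≤ ‖g.residual W X (fun s ω => if s ≤ t then g.ofCoeff c s ω else 0)
          (fun s _ => if s ≤ t then 1 else 0) (fun _ => 0 = 0) ω‖ := by
        rw [e]
        exact hcoord _ _
      refine h2.trans (le_trans (le_of_eq ?_) hnorm.le)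
      congr!
  -- The Borel–Cantelli lemma again turns the estimates in probability into almost sure convergence.
  let e : ℕ → ℝ := fun n => (1 / 2) ^ n
  have he : ∀ n, 0 < e n := fun n => by positivity
  choose f bad hf hbad hgood using fun n => key (e n) (he n)
  have hsum : ∑' n, μ (bad n) ≠ ∞ := by
    refine ne_top_of_le_ne_top ?_ (ENNReal.tsum_le_tsum fun n => hbad n)
    rw [ENNReal.tsum_mul_left]
    refine ENNReal.mul_ne_top (by simp) ?_
    rw [← ENNReal.ofReal_tsum_of_nonneg (fun n => (he n).le) summable_geometric_two]
    exact ENNReal.ofReal_ne_top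
  refine exists_measurable_ae_eq_of_tendsto hf ?_
  filter_upwards [ae_eventually_notMem hsum, ae_all_iff.2 hgood] with ω hω hω2
  rw [tendsto_iff_norm_sub_tendsto_zero]
  have h0 : Tendsto e atTop (𝓝 0) :=
    tendsto_pow_atTop_nhds_zero_of_lt_one (by norm_num) (by norm_num)
  refine squeeze_zero' (Eventually.of_forall fun _ => norm_nonneg _) ?_ h0
  filter_upwards [hω] with n hn using hω2 n hn

end

end

/-! ### The doubled probability space -/

section

variable {d : ℕ} {T : ℝ} {Ω : Type*} {mΩ : MeasurableSpace Ω}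

section SumSpace

/-- The filtration on the disjoint union of two copies of a filtered space. -/
def sumFiltration (𝓕 : Filtration (Set.Icc (0 : ℝ) T) mΩ) :
    Filtration (Set.Icc (0 : ℝ) T) (inferInstance : MeasurableSpace (Ω ⊕ Ω)) where
  seq t := (𝓕 t).map Sum.inl ⊓ (𝓕 t).map Sum.inr
  mono' _ _ h := inf_le_inf (MeasurableSpace.map_mono (𝓕.mono h))
    (MeasurableSpace.map_mono (𝓕.mono h))
  le' t := inf_le_inf (MeasurableSpace.map_mono (𝓕.le t)) (MeasurableSpace.map_mono (𝓕.le t))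

theorem measurable_sumFiltration_iff {𝓕 : Filtration (Set.Icc (0 : ℝ) T) mΩ}
    {t : Set.Icc (0 : ℝ) T} {β : Type*} [MeasurableSpace β] {f : Ω ⊕ Ω → β} :
    Measurable[sumFiltration 𝓕 t] f ↔
      Measurable[𝓕 t] (fun ω => f (Sum.inl ω)) ∧ Measurable[𝓕 t] fun ω => f (Sum.inr ω) :=
  ⟨fun h => ⟨fun _ hs => (h hs).1, fun _ hs => (h hs).2⟩,
    fun h _ hs => ⟨h.1 hs, h.2 hs⟩⟩

/-- The mixture of two copies of a measure on the disjoint union. -/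
def sumMeasure (μ : Measure Ω) : Measure (Ω ⊕ Ω) :=
  (2⁻¹ : ℝ≥0∞) • (μ.map Sum.inl + μ.map Sum.inr)

variable {μ : Measure Ω}

theorem sumMeasure_apply (s : Set (Ω ⊕ Ω)) :
    sumMeasure μ s = 2⁻¹ * (μ {ω | Sum.inl ω ∈ s} + μ {ω | Sum.inr ω ∈ s}) := by
  have h1 : MeasurableEmbedding (Sum.inl : Ω → Ω ⊕ Ω) :=
    ⟨Sum.inl_injective, measurable_inl, fun _ => MeasurableSet.inl_image⟩
  have h2 : MeasurableEmbedding (Sum.inr : Ω → Ω ⊕ Ω) :=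
    ⟨Sum.inr_injective, measurable_inr, fun _ => MeasurableSet.inr_image⟩
  rw [sumMeasure, Measure.smul_apply, Measure.add_apply, h1.map_apply, h2.map_apply]
  rfl

theorem two_inv_mul_add_self (x : ℝ≥0∞) : 2⁻¹ * (x + x) = x := by
  rw [← two_mul, ← mul_assoc, ENNReal.inv_mul_cancel (by simp) (by simp), one_mul]

instance [IsProbabilityMeasure μ] : IsProbabilityMeasure (sumMeasure μ) := ⟨by
  rw [sumMeasure_apply]
  simp [← two_mul, ENNReal.inv_mul_cancel]⟩

theorem ae_sumMeasure_iff {p : Ω ⊕ Ω → Prop} :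
    (∀ᵐ x ∂(sumMeasure μ), p x) ↔
      (∀ᵐ ω ∂μ, p (Sum.inl ω)) ∧ ∀ᵐ ω ∂μ, p (Sum.inr ω) := by
  rw [ae_iff, sumMeasure_apply]
  simp [ae_iff]

theorem tendsto_sumMeasure {s : ℕ → Set (Ω ⊕ Ω)}
    (h1 : Tendsto (fun n => μ {ω | Sum.inl ω ∈ s n}) atTop (𝓝 0))
    (h2 : Tendsto (fun n => μ {ω | Sum.inr ω ∈ s n}) atTop (𝓝 0)) :
    Tendsto (fun n => sumMeasure μ (s n)) atTop (𝓝 0) := by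
  simp_rw [sumMeasure_apply]
  have := ENNReal.Tendsto.const_mul (a := 2⁻¹) (h1.add h2) (Or.inr (by simp))
  simpa using this

variable {𝓕 : Filtration (Set.Icc (0 : ℝ) T) mΩ}
  {W : Set.Icc (0 : ℝ) T → Ω → EuclideanSpace ℝ (Fin d)}

/-- The filtration reveals from the start which copy has been drawn. The increments have the same
conditional law on both copies, so mixing the copies preserves their independence of the past. -/
theorem IsBrownian.sum (hW : IsBrownian μ 𝓕 W) :
    IsBrownian (sumMeasure μ) (sumFiltration 𝓕) fun t => Sum.elim (W t) (W t) where
  adapted t := measurable_sumFiltration_iff.2 ⟨hW.adapted t, hW.adapted t⟩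
  indep s t hst := by
    rw [Indep_iff]
    rintro _ G ⟨B, hB, rfl⟩ ⟨hG1, hG2⟩
    have h := (Indep_iff _ _ μ).1 (hW.indep s t hst)
    have h1 := h _ _ ⟨B, hB, rfl⟩ hG1
    have h2 := h _ _ ⟨B, hB, rfl⟩ hG2
    rw [sumMeasure_apply, sumMeasure_apply, sumMeasure_apply]
    have e1 : μ {ω | Sum.inl ω ∈ (fun ω => (Sum.elim (W t) (W t) ω : EuclideanSpace ℝ (Fin d)) -
        Sum.elim (W s) (W s) ω) ⁻¹' B ∩ G} = μ ((fun ω => W t ω - W s ω) ⁻¹' B) *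
          μ (Sum.inl ⁻¹' G) := h1
    have e2 : μ {ω | Sum.inr ω ∈ (fun ω => (Sum.elim (W t) (W t) ω : EuclideanSpace ℝ (Fin d)) -
        Sum.elim (W s) (W s) ω) ⁻¹' B ∩ G} = μ ((fun ω => W t ω - W s ω) ⁻¹' B) *
          μ (Sum.inr ⁻¹' G) := h2
    rw [e1, e2, ← mul_add]
    have e3 : 2⁻¹ * (μ {ω | Sum.inl ω ∈ (fun ω => (Sum.elim (W t) (W t) ω :
        EuclideanSpace ℝ (Fin d)) - Sum.elim (W s) (W s) ω) ⁻¹' B} +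
        μ {ω | Sum.inr ω ∈ (fun ω => (Sum.elim (W t) (W t) ω : EuclideanSpace ℝ (Fin d)) -
        Sum.elim (W s) (W s) ω) ⁻¹' B}) = μ ((fun ω => W t ω - W s ω) ⁻¹' B) :=
      two_inv_mul_add_self _
    rw [e3, mul_left_comm]
    rfl
  law s t hst := by
    ext B hB
    have hm : Measurable fun ω => W t ω - W s ω := (hW.measurable t).sub (hW.measurable s)
    rw [← hW.law s t hst, Measure.map_apply hm hB, Measure.map_apply, sumMeasure_apply]
    · exact two_inv_mul_add_self _
    · exact ((hW.measurable t).sumElim (hW.measurable t)).sub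
        ((hW.measurable s).sumElim (hW.measurable s))
    · exact hB
  zero t ht := Sum.rec (hW.zero t ht) (hW.zero t ht)

variable {H₁ H₂ : Set.Icc (0 : ℝ) T → Ω → Matrix (Fin d) (Fin d) ℝ}
  {X₁ X₂ : Set.Icc (0 : ℝ) T → Ω → EuclideanSpace ℝ (Fin d)}
  {S₁ S₂ : ℕ → Set.Icc (0 : ℝ) T → Ω → Matrix (Fin d) (Fin d) ℝ}
  {Y₁ Y₂ : ℕ → Set.Icc (0 : ℝ) T → Ω → EuclideanSpace ℝ (Fin d)}
  {F₁ F₂ : ℕ → Finset (Set.Icc (0 : ℝ) T)}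

theorem IsStepOn.sum {g : Grid T} {V₁ V₂ : Set.Icc (0 : ℝ) T → Ω → Matrix (Fin d) (Fin d) ℝ}
    (h₁ : IsStepOn 𝓕 g V₁) (h₂ : IsStepOn 𝓕 g V₂) :
    IsStepOn (sumFiltration 𝓕) g fun s => Sum.elim (V₁ s) (V₂ s) where
  const j s h1 h2 := by rw [h₁.const j s h1 h2, h₂.const j s h1 h2]
  measurable j hj a b := measurable_sumFiltration_iff.2
    ⟨h₁.measurable j hj a b, h₂.measurable j hj a b⟩
  bounded := by
    obtain ⟨C₁, h1⟩ := h₁.bounded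
    obtain ⟨C₂, h2⟩ := h₂.bounded
    exact ⟨max C₁ C₂, fun s => Sum.rec (fun ω a b => (h1 s ω a b).trans (le_max_left _ _))
      (fun ω a b => (h2 s ω a b).trans (le_max_right _ _))⟩

/-- Two integrals with the same driver become one integral on the doubled space. Any functional
recovered from it then serves both of them. -/
theorem ItoApprox.sum (h₁ : ItoApprox μ 𝓕 W H₁ X₁ S₁ Y₁ F₁)
    (h₂ : ItoApprox μ 𝓕 W H₂ X₂ S₂ Y₂ F₂) :
    ItoApprox (sumMeasure μ) (sumFiltration 𝓕) (fun t => Sum.elim (W t) (W t))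
      (fun s => Sum.elim (H₁ s) (H₂ s)) (fun s => Sum.elim (X₁ s) (X₂ s))
      (fun n s => Sum.elim (S₁ n s) (S₂ n s)) (fun n s => Sum.elim (Y₁ n s) (Y₂ n s))
      (fun n => F₁ n ∪ F₂ n) where
  isStepOn n g hg := (h₁.isStepOn n g fun t ht => hg t (Finset.mem_union_left _ ht)).sum
    (h₂.isStepOn n g fun t ht => hg t (Finset.mem_union_right _ ht))
  eq_stepInt n g hg t ht := Sum.rec
    (h₁.eq_stepInt n g (fun t ht => hg t (Finset.mem_union_left _ ht)) t ht)
    (h₂.eq_stepInt n g (fun t ht => hg t (Finset.mem_union_right _ ht)) t ht)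
  measurable_integrand := Sum.rec h₁.measurable_integrand h₂.measurable_integrand
  tendsto_integrand ε hε := tendsto_sumMeasure (h₁.tendsto_integrand ε hε)
    (h₂.tendsto_integrand ε hε)
  tendsto_integral t ε hε := tendsto_sumMeasure (h₁.tendsto_integral t ε hε)
    (h₂.tendsto_integral t ε hε)

theorem IsVolatility.sum {α₁ α₂ : Set.Icc (0 : ℝ) T → Ω → Matrix (Fin d) (Fin d) ℝ}
    (h₁ : IsVolatility μ 𝓕 α₁) (h₂ : IsVolatility μ 𝓕 α₂) :
    IsVolatility (sumMeasure μ) (sumFiltration 𝓕) fun s => Sum.elim (α₁ s) (α₂ s) where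
  posDef s := Sum.rec (h₁.posDef s) (h₂.posDef s)
  measurable a b := by
    have h := ((h₁.measurable a b).sumElim (h₂.measurable a b)).comp
      (MeasurableEquiv.prodSumDistrib (Set.Icc (0 : ℝ) T) Ω Ω).measurable
    convert h using 1
    ext ⟨s, ω | ω⟩ <;> rfl
  adapted q r a b := measurable_sumFiltration_iff.2 ⟨h₁.adapted q r a b, h₂.adapted q r a b⟩
  finite := ae_sumMeasure_iff.2 ⟨h₁.finite, h₂.finite⟩

end SumSpace

end

/-! ### The canonical space as an instance of the general setting -/

section

variable {d : ℕ} {T : ℝ}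

theorem measurable_canon (t : Set.Icc (0 : ℝ) T) :
    Measurable[rawFiltration d T t] (canon (d := d) t) :=
  (comap_measurable (canon t)).mono
    (le_iSup₂_of_le (f := fun s (_ : s ≤ t) =>
      MeasurableSpace.comap (canon (d := d) s) inferInstance) t le_rfl le_rfl) le_rfl

theorem IsWienerMeasure.isBrownian {P₀ : PathMeasure d T} (h : IsWienerMeasure P₀) :
    IsBrownian P₀ (rawFiltration d T) canon :=
  ⟨measurable_canon, h.indep, h.law, fun t ht ω => ω.2 t ht⟩

section SimpleIntegrand

variable {S : SimpleIntegrand d T} {g : Grid T}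

theorem SimpleIntegrand.isStepOn (hg : ∀ k ≤ S.n, S.time k ∈ Set.range g.u) :
    IsStepOn (rawFiltration d T) g S.val where
  const j s h1 h2 := by
    ext ω : 1
    refine Finset.sum_congr rfl fun k hk => ?_
    have hk' := Finset.mem_range.1 hk
    have e1 : S.time k < s ↔ S.time k < g.u (j + 1) := by
      rcases g.dichotomy (hg k hk'.le) j with h | h
      · simp [h.trans_lt h1, h.trans_lt (h1.trans_le h2)]
      · simp [not_lt.2 (h2.trans h), not_lt.2 h]
    have e2 := Grid.le_iff_of_mem_range (hg (k + 1) hk') h1 h2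
    simp only [e1, e2]
  measurable j hj a b := by
    have : (fun ω => S.val (g.u (j + 1)) ω a b) = fun ω => ∑ k ∈ Finset.range S.n,
        if S.time k < g.u (j + 1) ∧ g.u (j + 1) ≤ S.time (k + 1) then S.coeff k ω a b else 0 := by
      ext ω
      rw [SimpleIntegrand.val, Matrix.sum_apply]
      refine Finset.sum_congr rfl fun k _ => ?_
      split_ifs <;> rfl
    rw [this]
    refine Finset.measurable_sum _ fun k hk => ?_
    by_cases h : S.time k < g.u (j + 1) ∧ g.u (j + 1) ≤ S.time (k + 1)
    · simp only [h, and_self, if_true]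
      exact (S.measurable_coeff k a b).mono ((rawFiltration d T).mono
        ((g.dichotomy (hg k (Finset.mem_range.1 hk).le) j).resolve_right (not_le.2 h.1))) le_rfl
    · simp only [h, if_false]
      exact measurable_const
  bounded := by
    obtain ⟨C, hC⟩ := S.bounded_coeff
    refine ⟨∑ _k ∈ Finset.range S.n, max C 0, fun s ω a b => ?_⟩
    rw [SimpleIntegrand.val, Matrix.sum_apply]
    refine (Finset.abs_sum_le_sum_abs _ _).trans (Finset.sum_le_sum fun k _ => ?_)
    split_ifs
    · exact (hC k ω a b).trans (le_max_left _ _)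
    · simp

theorem SimpleIntegrand.integral_eq_stepInt (hg : ∀ k ≤ S.n, S.time k ∈ Set.range g.u)
    {t : Set.Icc (0 : ℝ) T} (ht : t ∈ Set.range g.u) (ω : PathSpace d T) :
    S.integral t ω = g.stepInt canon S.val t ω := by
  classical
  have hmin : ∀ k ≤ S.n, min (S.time k) t ∈ Set.range g.u := fun k hk => by
    rcases min_choice (S.time k) t with h | h <;> rw [h]
    exacts [hg k hk, ht]
  have hterm : ∀ k ∈ Finset.range S.n, Matrix.toEuclideanLin (S.coeff k ω)
      (canon (min (S.time (k + 1)) t) ω - canon (min (S.time k) t) ω) =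
      ∑ j ∈ Finset.range g.M,
        if min (S.time k) t ≤ g.u j ∧ g.u (j + 1) ≤ min (S.time (k + 1)) t then
        Matrix.toEuclideanLin (S.coeff k ω) (canon (g.u (j + 1)) ω - canon (g.u j) ω) else 0 := by
    intro k hk
    have hk' := Finset.mem_range.1 hk
    rw [g.increment_eq_sum (W := canon) (min_le_min_right t (S.monotone_time k.le_succ))
      (hmin k hk'.le) (hmin (k + 1) hk'), map_sum]
    refine Finset.sum_congr rfl fun j _ => ?_
    split_ifs
    · rfl
    · rw [map_zero]
  rw [SimpleIntegrand.integral, Finset.sum_congr rfl hterm, Finset.sum_comm]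
  refine Finset.sum_congr rfl fun j _ => ?_
  rcases (g.mono j.le_succ).eq_or_lt with h | h
  · rw [Nat.succ_eq_add_one] at h
    simp [← h]
  rw [Nat.succ_eq_add_one] at h
  rw [SimpleIntegrand.val, map_sum, LinearMap.sum_apply]
  by_cases hjt : g.u (j + 1) ≤ t
  · rw [if_pos hjt]
    refine Finset.sum_congr rfl fun k hk => ?_
    have hk' := Finset.mem_range.1 hk
    have e : (min (S.time k) t ≤ g.u j ∧ g.u (j + 1) ≤ min (S.time (k + 1)) t) ↔
        (S.time k < g.u (j + 1) ∧ g.u (j + 1) ≤ S.time (k + 1)) := by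
      constructor
      · rintro ⟨h1, h2⟩
        refine ⟨?_, h2.trans (min_le_left _ _)⟩
        rcases min_le_iff.1 h1 with h3 | h3
        · exact h3.trans_lt h
        · exact absurd (hjt.trans h3) (not_le.2 h)
      · rintro ⟨h1, h2⟩
        exact ⟨(min_le_left _ _).trans ((g.dichotomy (hg k hk'.le) j).resolve_right
          (not_le.2 h1)), le_min h2 hjt⟩
    by_cases hc : S.time k < g.u (j + 1) ∧ g.u (j + 1) ≤ S.time (k + 1)
    · rw [if_pos hc, if_pos (e.2 hc)]
    · rw [if_neg hc, if_neg fun h => hc (e.1 h), map_zero, LinearMap.zero_apply]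
  · rw [if_neg hjt]
    exact Finset.sum_eq_zero fun k _ => if_neg fun h => hjt (h.2.trans (min_le_right _ _))

end SimpleIntegrand

theorem itoApprox_of_simpleIntegrand {P₀ : PathMeasure d T}
    {H : Set.Icc (0 : ℝ) T → PathSpace d T → Matrix (Fin d) (Fin d) ℝ}
    {X : PathSpace d T → PathSpace d T} (hH : ∀ ω a b, Measurable fun t => H t ω a b)
    (hX : IsItoIntegral P₀ H X) :
    ∃ S Y F, ItoApprox P₀ (rawFiltration d T) canon H (fun t ω => canon t (X ω)) S Y F := by
  classical
  obtain ⟨S, hS1, hS2⟩ := hX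
  have hF : ∀ n (g : Grid T), (∀ t ∈ (Finset.range ((S n).n + 1)).image (S n).time,
      t ∈ Set.range g.u) → ∀ k ≤ (S n).n, (S n).time k ∈ Set.range g.u := fun n g hg k hk =>
    hg _ (Finset.mem_image_of_mem _ (Finset.mem_range.2 (Nat.lt_succ_of_le hk)))
  refine ⟨fun n => (S n).val, fun n => (S n).integral,
    fun n => (Finset.range ((S n).n + 1)).image (S n).time,
    fun n g hg => SimpleIntegrand.isStepOn (hF n g hg),
    fun n g hg t ht ω => SimpleIntegrand.integral_eq_stepInt (hF n g hg) ht ω, hH, hS1,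
    fun t ε hε => ?_⟩
  refine tendsto_of_tendsto_of_tendsto_of_le_of_le tendsto_const_nhds
    (hS2 (ENNReal.ofReal ε) (ENNReal.ofReal_pos.2 hε)) (fun _ => zero_le)
    fun n => measure_mono fun ω hω => ?_
  refine le_trans ?_ (le_iSup (fun t => edist ((S n).integral t ω) (canon t (X ω))) t)
  rw [edist_comm, edist_dist, dist_eq_norm]
  exact ENNReal.ofReal_le_ofReal hω

section Progressive

variable {Ω : Type*} {mΩ : MeasurableSpace Ω}

/-- Fubini's theorem on `[0,r] × Ω`, with the σ-algebra of time `r` in the second factor, which is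
exactly where progressive measurability gives joint measurability. -/
theorem measurable_setIntegral_Ioc {m : MeasurableSpace Ω} (q r : Set.Icc (0 : ℝ) T)
    {f : Set.Icc (0 : ℝ) T → Ω → ℝ}
    (hf : StronglyMeasurable fun p : Set.Iic r × Ω => f p.1 p.2) :
    Measurable fun ω => ∫ y in Set.Ioc q r, f y ω ∂(timeMeasure T) := by
  have h1 : StronglyMeasurable fun p : Set.Iic r × Ω =>
      {p : Set.Iic r × Ω | q < p.1}.indicator (fun p : Set.Iic r × Ω => f p.1 p.2) p :=
    hf.indicator (measurable_fst.subtype_val (measurableSet_Ioi (a := q)))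
  have h2 := h1.integral_prod_left' (μ := (timeMeasure T).comap Subtype.val)
  have e : (fun ω => ∫ y in Set.Ioc q r, f y ω ∂(timeMeasure T)) = fun ω =>
      ∫ x : Set.Iic r, {p : Set.Iic r × Ω | q < p.1}.indicator
        (fun p : Set.Iic r × Ω => f p.1 p.2) (x, ω) ∂((timeMeasure T).comap Subtype.val) := by
    ext ω
    rw [← Set.Ioi_inter_Iic, Set.inter_comm, ← setIntegral_indicator measurableSet_Ioi,
      ← integral_subtype_comap measurableSet_Iic]
    rfl
  rw [e]
  exact h2.measurable

theorem isVolatility_of_progressive {μ : Measure Ω} {𝓕 : Filtration (Set.Icc (0 : ℝ) T) mΩ}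
    (hT : 0 < T) {α : Set.Icc (0 : ℝ) T → Ω → Matrix (Fin d) (Fin d) ℝ}
    (hα : IsStronglyProgressive 𝓕 α) (hp : ∀ t ω, (α t ω).PosDef)
    (hfin : ∀ᵐ ω ∂μ, ∫⁻ t, ENNReal.ofReal (Real.sqrt (frobSq (α t ω))) ∂(timeMeasure T) < ∞) :
    IsVolatility μ 𝓕 α := by
  have hent : ∀ t a b, StronglyMeasurable[Subtype.instMeasurableSpace.prod (𝓕 t)]
      fun p : Set.Iic t × Ω => α p.1 p.2 a b := fun t a b =>
    (continuous_apply_apply a b).comp_stronglyMeasurable (hα t)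
  refine ⟨hp, fun a b => ?_, fun q r a b => measurable_setIntegral_Ioc q r (hent r a b), hfin⟩
  let top : Set.Icc (0 : ℝ) T := ⟨T, hT.le, le_rfl⟩
  have h1 : Measurable fun p : Set.Iic top × Ω => α p.1 p.2 a b :=
    (hent top a b).measurable.mono (sup_le_sup le_rfl (MeasurableSpace.comap_mono (𝓕.le top)))
      le_rfl
  have h2 : Measurable fun p : Set.Icc (0 : ℝ) T × Ω => ((⟨p.1, p.1.2.2⟩ : Set.Iic top), p.2) :=
    (measurable_fst.subtype_mk).prodMk measurable_snd
  exact h1.comp h2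

end Progressive

end

/-! ### Transfer of events between the driver and the solutions -/

section

variable {d : ℕ} {T : ℝ}

section Transfer

variable {Ω Ω₁ Ω₂ : Type*} {mΩ : MeasurableSpace Ω}

/-- The sets `D` such that `{f ∈ D}` is almost surely of the form `{g ∈ D'}` with `D' ∈ m`. -/
@[reducible]
def aeTransfer (ν : Measure Ω) (f : Ω → Ω₁) (g : Ω → Ω₂) (m : MeasurableSpace Ω₂) :
    MeasurableSpace Ω₁ where
  MeasurableSet' D := ∃ D', MeasurableSet[m] D' ∧ ∀ᵐ x ∂ν, (g x ∈ D' ↔ f x ∈ D)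
  measurableSet_empty := ⟨∅, MeasurableSet.empty, by simp⟩
  measurableSet_compl := by
    rintro D ⟨D', hD', h⟩
    exact ⟨D'ᶜ, hD'.compl, h.mono fun x hx => not_congr hx⟩
  measurableSet_iUnion := by
    intro D h
    choose D' hD' h using h
    refine ⟨⋃ n, D' n, MeasurableSet.iUnion hD', (ae_all_iff.2 h).mono fun x hx => ?_⟩
    simp only [Set.mem_iUnion]
    exact exists_congr hx

theorem measurable_of_forall_apply {m : MeasurableSpace Ω} {f : Ω → EuclideanSpace ℝ (Fin d)}
    (h : ∀ a, Measurable fun ω => f ω a) : Measurable f := by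
  have h1 : Measurable fun ω => (f ω).ofLp := measurable_pi_iff.2 h
  exact (MeasurableEquiv.toLp 2 (Fin d → ℝ)).measurable.comp h1

/-- The transferable events form a σ-algebra, so only the generating coordinates need be checked.
The representing event lies in `m` itself, without completion by null sets. -/
theorem rawFiltration_le_aeTransfer {ν : Measure Ω} {f : Ω → PathSpace d T} {g : Ω → Ω₂}
    {m : MeasurableSpace Ω₂} {t : Set.Icc (0 : ℝ) T}
    (h : ∀ s ≤ t, ∀ a, ∃ A : Ω → ℝ, Measurable[m.comap g] A ∧
      (fun x => canon s (f x) a) =ᵐ[ν] A) :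
    rawFiltration d T t ≤ aeTransfer ν f g m := by
  refine iSup₂_le fun s hs => ?_
  have : Measurable[aeTransfer ν f g m] (canon (d := d) s) := by
    refine measurable_of_forall_apply fun a => ?_
    intro B hB
    obtain ⟨A, hA, hA'⟩ := h s hs a
    obtain ⟨D', hD', hD⟩ := hA hB
    refine ⟨D', hD', hA'.mono fun x hx => ?_⟩
    have h1 : g x ∈ D' ↔ A x ∈ B := by
      change x ∈ g ⁻¹' D' ↔ x ∈ A ⁻¹' B
      rw [hD]
    rw [h1, ← hx]
    rfl
  exact this.comap_le

end Transfer

/-- `X` is the Itô integral `∫ α^{1/2} dB` for an admissible `α`. -/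
structure IsStrongSolution (P₀ : PathMeasure d T)
    (α : Set.Icc (0 : ℝ) T → PathSpace d T → Matrix (Fin d) (Fin d) ℝ)
    (X : PathSpace d T → PathSpace d T) : Prop where
  progressive : IsStronglyProgressive (rawFiltration d T) α
  posDef : ∀ t ω, (α t ω).PosDef
  finite : ∀ᵐ ω ∂P₀, ∫⁻ t, ENNReal.ofReal (Real.sqrt (frobSq (α t ω))) ∂(timeMeasure T) < ∞
  measurable : Measurable X
  isItoIntegral : IsItoIntegral P₀ (fun t ω => matrixSqrt (α t ω)) X

section

variable {P₀ : PathMeasure d T}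
  {α α₁ α₂ : Set.Icc (0 : ℝ) T → PathSpace d T → Matrix (Fin d) (Fin d) ℝ}
  {X X₁ X₂ : PathSpace d T → PathSpace d T}

theorem IsStrongSolution.isVolatility (hT : 0 < T) (h : IsStrongSolution P₀ α X) :
    IsVolatility P₀ (rawFiltration d T) α :=
  isVolatility_of_progressive hT h.progressive h.posDef h.finite

theorem IsStrongSolution.measurable_matrixSqrt (hT : 0 < T) (h : IsStrongSolution P₀ α X)
    (ω : PathSpace d T) (a b : Fin d) : Measurable fun t => matrixSqrt (α t ω) a b :=
  StrongVolatility.measurable_matrixSqrt ((h.isVolatility hT).measurable_path ω)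
    (fun t => (h.posDef t ω).posSemidef) a b

/-- An event of the driving Brownian motion up to time `t` can be read off from `X` up to time
`t`, in the same way for two solutions. -/
theorem IsStrongSolution.exists_measurableSet_preimage (hP₀ : IsWienerMeasure P₀) (hT : 0 < T)
    (h₁ : IsStrongSolution P₀ α₁ X₁) (h₂ : IsStrongSolution P₀ α₂ X₂) {t : Set.Icc (0 : ℝ) T}
    {D : Set (PathSpace d T)} (hD : MeasurableSet[rawFiltration d T t] D) :
    ∃ D', MeasurableSet[rawFiltration d T t] D' ∧ (∀ᵐ ω ∂P₀, (X₁ ω ∈ D' ↔ ω ∈ D)) ∧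
      ∀ᵐ ω ∂P₀, (X₂ ω ∈ D' ↔ ω ∈ D) := by
  have := hP₀.isProbabilityMeasure
  obtain ⟨S₁, Y₁, F₁, hX₁⟩ := itoApprox_of_simpleIntegrand (h₁.measurable_matrixSqrt hT)
    h₁.isItoIntegral
  obtain ⟨S₂, Y₂, F₂, hX₂⟩ := itoApprox_of_simpleIntegrand (h₂.measurable_matrixSqrt hT)
    h₂.isItoIntegral
  have hX := hX₁.sum hX₂
  have e : (fun (s : Set.Icc (0 : ℝ) T) => (Sum.elim (fun ω => matrixSqrt (α₁ s ω))
      (fun ω => matrixSqrt (α₂ s ω)) : PathSpace d T ⊕ PathSpace d T → _)) =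
      fun s x => matrixSqrt (Sum.elim (α₁ s) (α₂ s) x) := by
    ext s (x | x) <;> rfl
  have hX' : ItoApprox _ _ _ (fun s x => matrixSqrt (Sum.elim (α₁ s) (α₂ s) x)) _ _ _ _ := e ▸ hX
  have hdrv := hX'.exists_measurable_driver hP₀.isBrownian.sum hT
    ((h₁.isVolatility hT).sum (h₂.isVolatility hT))
  -- One transfer on the doubled space yields a single path event `D'`, whose preimages under `X₁`
  -- and `X₂` both represent `D`.
  have hle : rawFiltration d T t ≤ aeTransfer (sumMeasure P₀)
      (Sum.elim id id) (Sum.elim X₁ X₂) (rawFiltration d T t) := by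
    refine rawFiltration_le_aeTransfer fun s hs a => ?_
    obtain ⟨A, hA, hA'⟩ := hdrv s a
    refine ⟨A, hA.mono (iSup₂_le fun q hq => ?_) le_rfl, ?_⟩
    · have e2 : (Sum.elim (fun ω => canon q (X₁ ω)) fun ω => canon q (X₂ ω)) =
          canon q ∘ Sum.elim X₁ X₂ := by
        ext1 (x | x) <;> rfl
      rw [e2, ← MeasurableSpace.comap_comp]
      exact MeasurableSpace.comap_mono (le_iSup₂_of_le (f := fun s (_ : s ≤ t) =>
        MeasurableSpace.comap (canon (d := d) s) inferInstance) q (hq.trans hs) le_rfl)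
    · filter_upwards [hA'] with x hx
      rw [← hx]
      rcases x with x | x <;> rfl
  obtain ⟨D', hD', h⟩ := hle D hD
  exact ⟨D', hD', (ae_sumMeasure_iff.1 h).1, (ae_sumMeasure_iff.1 h).2⟩

theorem IsStepOn.measurable_stepInt {Ω : Type*} {mΩ : MeasurableSpace Ω} {μ : Measure Ω}
    {𝓕 : Filtration (Set.Icc (0 : ℝ) T) mΩ}
    {W : Set.Icc (0 : ℝ) T → Ω → EuclideanSpace ℝ (Fin d)} (hW : IsBrownian μ 𝓕 W) {g : Grid T}
    {V : Set.Icc (0 : ℝ) T → Ω → Matrix (Fin d) (Fin d) ℝ} (hV : IsStepOn 𝓕 g V)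
    (t : Set.Icc (0 : ℝ) T) (a : Fin d) : Measurable[𝓕 t] fun ω => g.stepInt W V t ω a := by
  have : (fun ω => g.stepInt W V t ω a) = fun ω => ∑ j ∈ Finset.range g.M,
      if g.u (j + 1) ≤ t then
        ∑ b, g.coeff V j ω a b * (W (g.u (j + 1)) ω - W (g.u j) ω) b else 0 := by
    ext ω
    rw [Grid.stepInt, WithLp.ofLp_sum, Finset.sum_apply]
    refine Finset.sum_congr rfl fun j _ => ?_
    rw [← g.toEuclideanLin_coeff]
    split_ifs <;> rfl
  rw [this]
  refine Finset.measurable_sum _ fun j _ => ?_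
  by_cases h : g.u (j + 1) ≤ t
  · simp only [h, if_true]
    exact Finset.measurable_sum _ fun b _ => ((hV.measurable_coeff j a b).mono
      (𝓕.mono ((g.mono j.le_succ).trans h)) le_rfl).mul
        ((hW.measurable_increment (g.mono j.le_succ) b).mono (𝓕.mono h) le_rfl)
  · simp only [h, if_false]
    exact measurable_const

/-- An event of `X` up to time `t` is almost surely an event of the driving Brownian motion up to
time `t`. -/
theorem IsStrongSolution.exists_measurableSet_ae_eq (hP₀ : IsWienerMeasure P₀) (hT : 0 < T)
    (h : IsStrongSolution P₀ α X) {t : Set.Icc (0 : ℝ) T}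
    {D : Set (PathSpace d T)} (hD : MeasurableSet[rawFiltration d T t] D) :
    ∃ E, MeasurableSet[rawFiltration d T t] E ∧ ∀ᵐ ω ∂P₀, (ω ∈ E ↔ X ω ∈ D) := by
  have := hP₀.isProbabilityMeasure
  obtain ⟨S, Y, F, hX⟩ := itoApprox_of_simpleIntegrand (h.measurable_matrixSqrt hT)
    h.isItoIntegral
  have hle : rawFiltration d T t ≤ aeTransfer P₀ X id (rawFiltration d T t) := by
    refine rawFiltration_le_aeTransfer fun s hs a => ?_
    rw [MeasurableSpace.comap_id]
    have hY : ∀ n, Measurable[rawFiltration d T s] fun ω => Y n s ω a := fun n => by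
      obtain ⟨g, hg, -⟩ := exists_grid hT (insert s (F n)) one_pos
      have hg' : ∀ t ∈ F n, t ∈ Set.range g.u := fun t ht => hg t (Finset.mem_insert_of_mem ht)
      have : (fun ω => Y n s ω a) = fun ω => g.stepInt canon (S n) s ω a := by
        ext ω
        rw [hX.eq_stepInt n g hg' s (hg s (Finset.mem_insert_self _ _)) ω]
      rw [this]
      exact (hX.isStepOn n g hg').measurable_stepInt hP₀.isBrownian s a
    -- The approximating integrals are adapted to the raw filtration, and a subsequence converges
    -- almost surely; this provides a raw version of the limit.
    have hm : TendstoInMeasure P₀ (fun n ω => Y n s ω a) atTop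
        fun ω => canon s (X ω) a := by
      rw [tendstoInMeasure_iff_norm]
      intro ε hε
      refine tendsto_of_tendsto_of_tendsto_of_le_of_le tendsto_const_nhds
        (hX.tendsto_integral s ε hε) (fun _ => zero_le) fun n => measure_mono fun ω hω => ?_
      have h1 : ε ≤ ‖Y n s ω a - canon s (X ω) a‖ := hω
      refine h1.trans ?_
      rw [norm_sub_rev]
      exact abs_le_of_sq_le_sq (sq_apply_le_norm_sq (canon s (X ω) - Y n s ω) a) (norm_nonneg _)
    obtain ⟨ns, -, hns⟩ := hm.exists_seq_tendsto_ae
    obtain ⟨A, hA, hA'⟩ := exists_measurable_ae_eq_of_tendsto (fun n => hY (ns n)) hns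
    exact ⟨A, hA.mono ((rawFiltration d T).mono hs) le_rfl, hA'⟩
  obtain ⟨E, hE, h'⟩ := hle D hD
  exact ⟨E, hE, h'⟩

/-- The paths agree up to time `t`. -/
def AgreeUpTo (t : Set.Icc (0 : ℝ) T) (ω ω' : PathSpace d T) : Prop :=
  ∀ s ≤ t, canon s ω = canon s ω'

/-- The events that do not separate two given paths form a σ-algebra, which contains the generators
of the filtration up to `t`. -/
theorem AgreeUpTo.mem_iff {t : Set.Icc (0 : ℝ) T} {ω ω' : PathSpace d T}
    (h : AgreeUpTo t ω ω') {D : Set (PathSpace d T)}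
    (hD : MeasurableSet[rawFiltration d T t] D) : ω ∈ D ↔ ω' ∈ D := by
  let m : MeasurableSpace (PathSpace d T) :=
    { MeasurableSet' := fun D => ω ∈ D ↔ ω' ∈ D
      measurableSet_empty := by simp
      measurableSet_compl := fun D hD => not_congr hD
      measurableSet_iUnion := fun D hD => by
        simp only [Set.mem_iUnion]
        exact exists_congr hD }
  have hle : rawFiltration d T t ≤ m := by
    refine iSup₂_le fun s hs => ?_
    rintro _ ⟨B, -, rfl⟩
    change canon s ω ∈ B ↔ canon s ω' ∈ B
    rw [h s hs]
  exact hle D hD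

theorem continuous_canon (ω : PathSpace d T) : Continuous fun t => canon t ω := ω.1.continuous

/-- If the laws of two solutions agree on the traces of `F_t` on `A ∈ F_t`, then the solutions
agree up to time `t` on `{X₂ ∈ A}`. -/
theorem IsStrongSolution.ae_agreeUpTo (hP₀ : IsWienerMeasure P₀) (hT : 0 < T)
    (h₁ : IsStrongSolution P₀ α₁ X₁) (h₂ : IsStrongSolution P₀ α₂ X₂) {t : Set.Icc (0 : ℝ) T}
    {A : Set (PathSpace d T)} (hA : MeasurableSet[rawFiltration d T t] A)
    (hlaw : ∀ B, MeasurableSet[rawFiltration d T t] B →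
      P₀.map X₁ (A ∩ B) = P₀.map X₂ (A ∩ B)) :
    ∀ᵐ ω ∂P₀, X₂ ω ∈ A → AgreeUpTo t (X₁ ω) (X₂ ω) := by
  have hle := (rawFiltration d T).le t
  have key : ∀ s ≤ t, ∀ U : Set (EuclideanSpace ℝ (Fin d)), IsOpen U →
      ∀ᵐ ω ∂P₀, X₂ ω ∈ A → canon s (X₁ ω) ∈ U → canon s (X₂ ω) ∈ U := by
    intro s hs U hU
    have hD : MeasurableSet[rawFiltration d T t] (canon (d := d) s ⁻¹' U) :=
      (rawFiltration d T).mono hs _ (measurable_canon s hU.measurableSet)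
    -- Almost surely `X₁ ∈ D'` forces `X₁ s ∈ U`, so `A ∩ (D' \ {ω s ∈ U})` is null for the law of
    -- `X₁`, hence for that of `X₂`. On `X₂ ∈ A` this closes the chain from `X₁ s ∈ U` to the driver
    -- event `E`, to `X₂ ∈ D'`, to `X₂ s ∈ U`.
    obtain ⟨E, hE, hE'⟩ := h₁.exists_measurableSet_ae_eq hP₀ hT hD
    obtain ⟨D', hD', h1, h2⟩ := h₁.exists_measurableSet_preimage hP₀ hT h₂ hE
    have hB : MeasurableSet[rawFiltration d T t] (D' ∩ (canon (d := d) s ⁻¹' U)ᶜ) :=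
      hD'.inter hD.compl
    have h3 := hlaw _ hB
    rw [Measure.map_apply h₁.measurable (hle _ (hA.inter hB)),
      Measure.map_apply h₂.measurable (hle _ (hA.inter hB))] at h3
    have h4 : P₀ (X₁ ⁻¹' (A ∩ (D' ∩ (canon (d := d) s ⁻¹' U)ᶜ))) = 0 := by
      rw [measure_eq_zero_iff_ae_notMem]
      filter_upwards [hE', h1] with ω hω1 hω2 hmem
      exact hmem.2.2 (hω1.1 (hω2.1 hmem.2.1))
    rw [h4, eq_comm, measure_eq_zero_iff_ae_notMem] at h3
    filter_upwards [h3, hE', h2] with ω hω3 hω1 hω2 hωA hωU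
    by_contra hcon
    exact hω3 ⟨hωA, hω2.2 (hω1.2 hωU), hcon⟩
  -- Continuity reduces the claim to countably many times. One-sided implications suffice, as two
  -- distinct points are separated by a basic open set around the first.
  obtain ⟨Q, hQc, hQd⟩ := TopologicalSpace.exists_countable_dense (Set.Iic t)
  have hall : ∀ᵐ ω ∂P₀, ∀ s ∈ Q, ∀ U ∈ TopologicalSpace.countableBasis
      (EuclideanSpace ℝ (Fin d)), X₂ ω ∈ A → canon s (X₁ ω) ∈ U → canon s (X₂ ω) ∈ U :=
    (ae_ball_iff hQc).2 fun s _ => (ae_ball_iff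
      (TopologicalSpace.countable_countableBasis _)).2 fun U hU =>
        key s s.2 U (TopologicalSpace.isOpen_of_mem_countableBasis hU)
  filter_upwards [hall] with ω hω hωA
  have hfun : (fun s : Set.Iic t => canon (s : Set.Icc (0 : ℝ) T) (X₁ ω)) =
      fun s : Set.Iic t => canon (s : Set.Icc (0 : ℝ) T) (X₂ ω) := by
    refine Continuous.ext_on hQd ((continuous_canon _).comp continuous_subtype_val)
      ((continuous_canon _).comp continuous_subtype_val) fun s hs => ?_
    by_contra hne
    obtain ⟨U, hU, h1, h2⟩ :=
      (TopologicalSpace.isBasis_countableBasis (EuclideanSpace ℝ (Fin d))).exists_subset_of_mem_open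
        (show canon (s : Set.Icc (0 : ℝ) T) (X₁ ω) ∈ {canon (s : Set.Icc (0 : ℝ) T) (X₂ ω)}ᶜ from
          hne) isOpen_compl_singleton
    exact h2 (hω s hs U hU hωA h1) rfl
  exact fun s hs => congrFun hfun ⟨s, hs⟩

end

end

/-! ### Processes that switch at a stopping time -/

section

variable {d : ℕ} {T : ℝ}

/-- A step process on a grid as a simple integrand. -/
def SimpleIntegrand.ofStep (g : Grid T)
    {V : Set.Icc (0 : ℝ) T → PathSpace d T → Matrix (Fin d) (Fin d) ℝ}
    (hV : IsStepOn (rawFiltration d T) g V) : SimpleIntegrand d T where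
  n := g.M
  time := g.u
  monotone_time := g.mono
  coeff := g.coeff V
  measurable_coeff := hV.measurable_coeff
  bounded_coeff := hV.isAdaptedCoeff.bounded

/-- A simple integrand vanishes at time `0`, where `V` is arbitrary. -/
theorem SimpleIntegrand.val_ofStep (g : Grid T)
    {V : Set.Icc (0 : ℝ) T → PathSpace d T → Matrix (Fin d) (Fin d) ℝ}
    (hV : IsStepOn (rawFiltration d T) g V) {s : Set.Icc (0 : ℝ) T} (hs : 0 < (s : ℝ))
    (ω : PathSpace d T) : (SimpleIntegrand.ofStep g hV).val s ω = V s ω := by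
  obtain ⟨j, hjM, h1, h2⟩ := g.exists_cell hs
  change ∑ k ∈ Finset.range g.M, (if g.u k < s ∧ s ≤ g.u (k + 1) then g.coeff V k ω else 0) = _
  rw [Finset.sum_eq_single_of_mem j (Finset.mem_range.2 hjM) fun i _ hij =>
    if_neg fun hi => hij (g.cell_unique hi ⟨h1, h2⟩), if_pos ⟨h1, h2⟩, Grid.coeff,
    if_pos (h1.trans_le h2), hV.const j s h1 h2]

section Switch

/-- Whether a time in `R` is before `s` and the event attached to it has occurred. -/
def Switched (R : Set (Set.Icc (0 : ℝ) T)) (E : Set.Icc (0 : ℝ) T → Set (PathSpace d T))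
    (s : Set.Icc (0 : ℝ) T) (ω : PathSpace d T) : Prop := ∃ t ∈ R, t < s ∧ ω ∈ E t

open scoped Classical in
/-- The process that switches from `V₁` to `V₂` after the time `t` on the event `E t`. -/
def switch {β : Type*} (R : Set (Set.Icc (0 : ℝ) T))
    (E : Set.Icc (0 : ℝ) T → Set (PathSpace d T)) (V₁ V₂ : Set.Icc (0 : ℝ) T → PathSpace d T → β)
    (s : Set.Icc (0 : ℝ) T) (ω : PathSpace d T) : β :=
  if Switched R E s ω then V₂ s ω else V₁ s ω

variable {R : Set (Set.Icc (0 : ℝ) T)} {E : Set.Icc (0 : ℝ) T → Set (PathSpace d T)}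

theorem switch_eq_or {β : Type*} (V₁ V₂ : Set.Icc (0 : ℝ) T → PathSpace d T → β)
    (s : Set.Icc (0 : ℝ) T) (ω : PathSpace d T) :
    (Switched R E s ω ∧ switch R E V₁ V₂ s ω = V₂ s ω) ∨
      (¬ Switched R E s ω ∧ switch R E V₁ V₂ s ω = V₁ s ω) := by
  unfold switch
  by_cases h : Switched R E s ω
  · exact Or.inl ⟨h, if_pos h⟩
  · exact Or.inr ⟨h, if_neg h⟩

/-- The switch takes effect strictly after `t`. Every cell that it affects starts at `t` or later,
and there `E t` is already known. -/
theorem isStepOn_switch (hE : ∀ t ∈ R, MeasurableSet[rawFiltration d T t] (E t)) (hR : R.Finite)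
    {g : Grid T} (hg : R ⊆ Set.range g.u)
    {V₁ V₂ : Set.Icc (0 : ℝ) T → PathSpace d T → Matrix (Fin d) (Fin d) ℝ}
    (h₁ : IsStepOn (rawFiltration d T) g V₁) (h₂ : IsStepOn (rawFiltration d T) g V₂) :
    IsStepOn (rawFiltration d T) g (switch R E V₁ V₂) where
  const j s h1 h2 := by
    ext ω : 1
    have e : Switched R E s ω ↔ Switched R E (g.u (j + 1)) ω := by
      refine exists_congr fun t => and_congr_right fun ht => and_congr_left fun _ => ?_
      rcases g.dichotomy (hg ht) j with h | h
      · simp [h.trans_lt h1, h.trans_lt (h1.trans_le h2)]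
      · simp [not_lt.2 (h2.trans h), not_lt.2 h]
    unfold switch
    rw [h₁.const j s h1 h2, h₂.const j s h1 h2]
    by_cases h : Switched R E s ω
    · rw [if_pos h, if_pos (e.1 h)]
    · rw [if_neg h, if_neg fun h' => h (e.2 h')]
  measurable j hj a b := by
    classical
    have hset : MeasurableSet[rawFiltration d T (g.u j)]
        {ω | Switched R E (g.u (j + 1)) ω} := by
      have : {ω | Switched R E (g.u (j + 1)) ω} =
          ⋃ t ∈ R, ⋃ _ : t < g.u (j + 1), E t := by
        ext ω
        change (∃ t ∈ R, t < g.u (j + 1) ∧ ω ∈ E t) ↔ _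
        simp only [Set.mem_iUnion, exists_prop]
      rw [this]
      refine MeasurableSet.biUnion hR.countable fun t ht => MeasurableSet.iUnion fun hlt => ?_
      exact (rawFiltration d T).mono ((g.dichotomy (hg ht) j).resolve_right (not_le.2 hlt)) _
        (hE t ht)
    have : (fun ω => switch R E V₁ V₂ (g.u (j + 1)) ω a b) = fun ω =>
        if Switched R E (g.u (j + 1)) ω then V₂ (g.u (j + 1)) ω a b
          else V₁ (g.u (j + 1)) ω a b := by
      ext ω
      unfold switch
      split_ifs <;> rfl
    rw [this]
    exact Measurable.ite hset (h₂.measurable j hj a b) (h₁.measurable j hj a b)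
  bounded := by
    obtain ⟨C₁, h1⟩ := h₁.bounded
    obtain ⟨C₂, h2⟩ := h₂.bounded
    refine ⟨max C₁ C₂, fun s ω a b => ?_⟩
    rcases switch_eq_or (R := R) (E := E) V₁ V₂ s ω with ⟨-, h⟩ | ⟨-, h⟩ <;> rw [h]
    · exact (h2 s ω a b).trans (le_max_right _ _)
    · exact (h1 s ω a b).trans (le_max_left _ _)

theorem measurableSet_lt_and_mem {Ω : Type*} {m : MeasurableSpace Ω} {i t : Set.Icc (0 : ℝ) T}
    {D : Set Ω} (hD : MeasurableSet D) :
    MeasurableSet {p : Set.Iic i × Ω | t < p.1 ∧ p.2 ∈ D} :=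
  (measurable_fst.subtype_val (measurableSet_Ioi (a := t))).inter (measurable_snd hD)

theorem isStronglyProgressive_switch {β : Type*} [TopologicalSpace β]
    (hE : ∀ t ∈ R, MeasurableSet[rawFiltration d T t] (E t)) (hR : R.Finite)
    {V₁ V₂ : Set.Icc (0 : ℝ) T → PathSpace d T → β}
    (h₁ : IsStronglyProgressive (rawFiltration d T) V₁)
    (h₂ : IsStronglyProgressive (rawFiltration d T) V₂) :
    IsStronglyProgressive (rawFiltration d T) (switch R E V₁ V₂) := by
  classical
  intro i
  have hset : MeasurableSet[Subtype.instMeasurableSpace.prod (rawFiltration d T i)]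
      {p : Set.Iic i × PathSpace d T | Switched R E p.1 p.2} := by
    have : {p : Set.Iic i × PathSpace d T | Switched R E p.1 p.2} =
        ⋃ t ∈ R, ⋃ _ : t ≤ i, {p | t < p.1 ∧ p.2 ∈ E t} := by
      ext p
      change (∃ t ∈ R, t < p.1 ∧ p.2 ∈ E t) ↔ _
      simp only [Set.mem_iUnion, exists_prop]
      exact exists_congr fun t => and_congr_right fun _ =>
        ⟨fun h => ⟨h.1.le.trans p.1.2, h⟩, fun h => h.2⟩
    rw [this]
    exact MeasurableSet.biUnion hR.countable fun t ht => MeasurableSet.iUnion fun hti =>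
      measurableSet_lt_and_mem ((rawFiltration d T).mono hti _ (hE t ht))
  exact StronglyMeasurable.ite hset (h₂ i) (h₁ i)

end Switch

end

/-! ### The Itô integral of a switched process, and pasting in `P_S` -/

section

variable {d : ℕ} {T : ℝ}

theorem Grid.exists_refinement (hT : 0 < T) (g : Grid T) (F : Finset (Set.Icc (0 : ℝ) T)) :
    ∃ g' : Grid T, Set.range g.u ⊆ Set.range g'.u ∧ ∀ t ∈ F, t ∈ Set.range g'.u := by
  classical
  obtain ⟨g', hg', -⟩ := exists_grid hT ((Finset.range (g.M + 1)).image g.u ∪ F) one_pos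
  refine ⟨g', ?_, fun t ht => hg' t (Finset.mem_union_right _ ht)⟩
  rintro _ ⟨k, rfl⟩
  have hin : ∀ k ≤ g.M, g.u k ∈ Set.range g'.u := fun k hk =>
    hg' _ (Finset.mem_union_left _ (Finset.mem_image_of_mem _
      (Finset.mem_range.2 (Nat.lt_succ_of_le hk))))
  rcases le_total k g.M with h | h
  · exact hin k h
  · rw [Subtype.ext ((g.top k h).trans (g.top _ le_rfl).symm)]
    exact hin _ le_rfl

section

variable {R : Set (Set.Icc (0 : ℝ) T)} {E : Set.Icc (0 : ℝ) T → Set (PathSpace d T)}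
  {g : Grid T} {S₁ S₂ : SimpleIntegrand d T}

theorem integral_ofStep_switch_of_notMem (hT : 0 < T)
    (hg₁ : ∀ k ≤ S₁.n, S₁.time k ∈ Set.range g.u)
    (hV : IsStepOn (rawFiltration d T) g (switch R E S₁.val S₂.val)) {ω : PathSpace d T}
    (hω : ∀ t ∈ R, ω ∉ E t) (r : Set.Icc (0 : ℝ) T) :
    (SimpleIntegrand.ofStep g hV).integral r ω = S₁.integral r ω := by
  obtain ⟨g', hgg, hr⟩ := g.exists_refinement hT {r}
  have hr' := hr r (Finset.mem_singleton_self r)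
  rw [SimpleIntegrand.integral_eq_stepInt (g := g') (fun k _ => hgg ⟨k, rfl⟩) hr',
    SimpleIntegrand.integral_eq_stepInt (fun k hk => hgg (hg₁ k hk)) hr']
  refine Finset.sum_congr rfl fun j _ => ?_
  rcases (g'.mono j.le_succ).eq_or_lt with h | h
  · rw [Nat.succ_eq_add_one] at h
    simp [← h]
  have h0 : (0 : ℝ) < g'.u (j + 1) := (g'.u j).2.1.trans_lt h
  rw [SimpleIntegrand.val_ofStep g hV h0]
  have : ¬ Switched R E (g'.u (j + 1)) ω := fun ⟨t, ht, _, hE⟩ => hω t ht hE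
  rw [switch, if_neg this]

/-- On a refinement that contains `r` and `t`, every cell lies on one side of `t`, and both sides
can be compared cell by cell. -/
theorem integral_ofStep_switch_of_mem (hT : 0 < T)
    (hg₁ : ∀ k ≤ S₁.n, S₁.time k ∈ Set.range g.u)
    (hg₂ : ∀ k ≤ S₂.n, S₂.time k ∈ Set.range g.u)
    (hV : IsStepOn (rawFiltration d T) g (switch R E S₁.val S₂.val)) {ω : PathSpace d T}
    {t : Set.Icc (0 : ℝ) T} (htR : t ∈ R) (htg : t ∈ Set.range g.u)
    (hω : ∀ t' ∈ R, ω ∈ E t' ↔ t' = t) (r : Set.Icc (0 : ℝ) T) :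
    (SimpleIntegrand.ofStep g hV).integral r ω =
      S₁.integral (min r t) ω + (S₂.integral r ω - S₂.integral (min r t) ω) := by
  obtain ⟨g', hgg, hr⟩ := g.exists_refinement hT {r}
  have hr' := hr r (Finset.mem_singleton_self r)
  have hrt : min r t ∈ Set.range g'.u := by
    rcases min_choice r t with h | h <;> rw [h]
    exacts [hr', hgg htg]
  rw [SimpleIntegrand.integral_eq_stepInt (g := g') (fun k _ => hgg ⟨k, rfl⟩) hr',
    SimpleIntegrand.integral_eq_stepInt (fun k hk => hgg (hg₁ k hk)) hrt,
    SimpleIntegrand.integral_eq_stepInt (fun k hk => hgg (hg₂ k hk)) hrt,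
    SimpleIntegrand.integral_eq_stepInt (fun k hk => hgg (hg₂ k hk)) hr']
  unfold Grid.stepInt
  rw [← Finset.sum_sub_distrib, ← Finset.sum_add_distrib]
  refine Finset.sum_congr rfl fun j _ => ?_
  rcases (g'.mono j.le_succ).eq_or_lt with h | h
  · rw [Nat.succ_eq_add_one] at h
    simp [← h]
  have h0 : (0 : ℝ) < g'.u (j + 1) := (g'.u j).2.1.trans_lt h
  rw [SimpleIntegrand.val_ofStep g hV h0]
  have hsw : Switched R E (g'.u (j + 1)) ω ↔ t < g'.u (j + 1) := by
    constructor
    · rintro ⟨t', ht', hlt, hE⟩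
      rwa [(hω t' ht').1 hE] at hlt
    · exact fun hlt => ⟨t, htR, hlt, (hω t htR).2 rfl⟩
  unfold switch
  by_cases h1 : g'.u (j + 1) ≤ r
  · by_cases h2 : g'.u (j + 1) ≤ t
    · simp [h1, h2, hsw, not_lt.2 h2]
    · simp [h1, h2, hsw, not_le.1 h2]
  · simp [h1]

variable {P₀ : PathMeasure d T}
  {α₁ α₂ : Set.Icc (0 : ℝ) T → PathSpace d T → Matrix (Fin d) (Fin d) ℝ}
  {X X₁ X₂ : PathSpace d T → PathSpace d T}

/-- Switching from one Itô integral to another one at the times in a finite set. -/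
theorem IsStrongSolution.switch (hT : 0 < T) (h₁ : IsStrongSolution P₀ α₁ X₁)
    (h₂ : IsStrongSolution P₀ α₂ X₂)
    (hE : ∀ t ∈ R, MeasurableSet[rawFiltration d T t] (E t)) (hR : R.Finite)
    (hXm : Measurable X)
    (hX : ∀ᵐ ω ∂P₀, ((∀ t ∈ R, ω ∉ E t) ∧ X ω = X₁ ω) ∨
      ∃ t ∈ R, (∀ t' ∈ R, ω ∈ E t' ↔ t' = t) ∧ X ω = X₂ ω ∧ AgreeUpTo t (X₁ ω) (X₂ ω)) :
    IsStrongSolution P₀ (switch R E α₁ α₂) X := by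
  classical
  have hle : ∀ {β : Type} (V₁ V₂ : Set.Icc (0 : ℝ) T → PathSpace d T → β) (f : β → ℝ≥0∞) s ω,
      f (StrongVolatility.switch R E V₁ V₂ s ω) ≤ f (V₁ s ω) + f (V₂ s ω) := by
    intro β V₁ V₂ f s ω
    rcases switch_eq_or (R := R) (E := E) V₁ V₂ s ω with ⟨-, h⟩ | ⟨-, h⟩ <;> rw [h]
    · exact le_add_self
    · exact le_self_add
  refine ⟨isStronglyProgressive_switch hE hR h₁.progressive h₂.progressive, fun t ω => ?_, ?_, hXm,
    ?_⟩
  · rcases switch_eq_or (R := R) (E := E) α₁ α₂ t ω with ⟨-, h⟩ | ⟨-, h⟩ <;> rw [h]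
    exacts [h₂.posDef t ω, h₁.posDef t ω]
  · filter_upwards [h₁.finite, h₂.finite] with ω hω₁ hω₂
    refine lt_of_le_of_lt (lintegral_mono fun s =>
      hle α₁ α₂ (fun A => ENNReal.ofReal (Real.sqrt (frobSq A))) s ω) ?_
    rw [lintegral_add_left]
    · exact ENNReal.add_lt_top.2 ⟨hω₁, hω₂⟩
    · exact (measurable_frobSq_of_entries
        ((h₁.isVolatility hT).measurable_path ω)).sqrt.ennreal_ofReal
  obtain ⟨S₁, hS₁, hY₁⟩ := h₁.isItoIntegral
  obtain ⟨S₂, hS₂, hY₂⟩ := h₂.isItoIntegral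
  have hgrid : ∀ n, ∃ g : Grid T, (∀ k ≤ (S₁ n).n, (S₁ n).time k ∈ Set.range g.u) ∧
      (∀ k ≤ (S₂ n).n, (S₂ n).time k ∈ Set.range g.u) ∧ R ⊆ Set.range g.u := fun n => by
    obtain ⟨g, hg, -⟩ := exists_grid hT ((Finset.range ((S₁ n).n + 1)).image (S₁ n).time ∪
      (Finset.range ((S₂ n).n + 1)).image (S₂ n).time ∪ hR.toFinset) one_pos
    refine ⟨g, fun k hk => hg _ ?_, fun k hk => hg _ ?_, fun t ht => hg _ ?_⟩
    · exact Finset.mem_union_left _ (Finset.mem_union_left _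
        (Finset.mem_image_of_mem _ (Finset.mem_range.2 (Nat.lt_succ_of_le hk))))
    · exact Finset.mem_union_left _ (Finset.mem_union_right _
        (Finset.mem_image_of_mem _ (Finset.mem_range.2 (Nat.lt_succ_of_le hk))))
    · exact Finset.mem_union_right _ (hR.mem_toFinset.2 ht)
  choose g hg₁ hg₂ hgR using hgrid
  have hV : ∀ n, IsStepOn (rawFiltration d T) (g n)
      (StrongVolatility.switch R E (S₁ n).val (S₂ n).val) := fun n =>
    isStepOn_switch hE hR (hgR n) (SimpleIntegrand.isStepOn (hg₁ n))
      (SimpleIntegrand.isStepOn (hg₂ n))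
  refine ⟨fun n => SimpleIntegrand.ofStep (g n) (hV n), fun ε hε => ?_, fun ε hε => ?_⟩
  · have hε2 : 0 < ε / 2 := ENNReal.div_pos hε.ne' (by simp)
    have hlim := (hS₁ (ε / 2) hε2).add (hS₂ (ε / 2) hε2)
    rw [add_zero] at hlim
    refine tendsto_of_tendsto_of_tendsto_of_le_of_le tendsto_const_nhds hlim (fun _ => zero_le)
      fun n => le_trans (measure_mono fun ω hω => ?_) (measure_union_le _ _)
    by_contra hcon
    rw [Set.mem_union, not_or] at hcon
    have hc1 := not_le.1 (show ¬ (ε / 2 ≤ _) from hcon.1)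
    have hc2 := not_le.1 (show ¬ (ε / 2 ≤ _) from hcon.2)
    refine absurd (show ε ≤ _ from hω) (not_le.2 ?_)
    calc _ ≤ ∫⁻ s, (ENNReal.ofReal (frobSq ((S₁ n).val s ω - matrixSqrt (α₁ s ω))) +
          ENNReal.ofReal (frobSq ((S₂ n).val s ω - matrixSqrt (α₂ s ω)))) ∂(timeMeasure T) := by
          refine lintegral_mono_ae (ae_pos_time.mono fun s hs => ?_)
          rw [SimpleIntegrand.val_ofStep (g n) (hV n) hs]
          change ENNReal.ofReal (frobSq (StrongVolatility.switch R E (S₁ n).val (S₂ n).val s ω -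
            matrixSqrt (StrongVolatility.switch R E α₁ α₂ s ω))) ≤ _
          unfold StrongVolatility.switch
          by_cases h : Switched R E s ω
          · simp only [if_pos h]
            exact le_add_self
          · simp only [if_neg h]
            exact le_self_add
      _ = ∫⁻ s, ENNReal.ofReal (frobSq ((S₁ n).val s ω - matrixSqrt (α₁ s ω)))
            ∂(timeMeasure T) + ∫⁻ s, ENNReal.ofReal (frobSq ((S₂ n).val s ω -
              matrixSqrt (α₂ s ω))) ∂(timeMeasure T) := by
          refine lintegral_add_left' ?_ _
          refine (Finset.aemeasurable_fun_sum _ fun a _ => Finset.aemeasurable_fun_sum _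
            fun b _ => AEMeasurable.pow_const ?_ 2).ennreal_ofReal
          exact ((g n).aemeasurable_of_step (f := fun s => (S₁ n).val s ω a b)
            fun j s h1 h2 => by
              rw [(SimpleIntegrand.isStepOn (hg₁ n)).const j s h1 h2]).sub
            (h₁.measurable_matrixSqrt hT ω a b).aemeasurable
      _ < ε / 2 + ε / 2 := ENNReal.add_lt_add hc1 hc2
      _ = ε := ENNReal.add_halves ε
  · have hε3 : 0 < ε / 3 := ENNReal.div_pos hε.ne' (by simp)
    have hlim := (hY₁ (ε / 3) hε3).add (hY₂ (ε / 3) hε3)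
    rw [add_zero] at hlim
    refine tendsto_of_tendsto_of_tendsto_of_le_of_le tendsto_const_nhds hlim (fun _ => zero_le)
      fun n => le_trans (measure_mono_ae ?_) (measure_union_le _ _)
    filter_upwards [hX] with ω hω hωε
    by_contra hcon
    have hcon' := not_or.1 hcon
    have hc1 := not_le.1 (show ¬ (ε / 3 ≤ _) from hcon'.1)
    have hc2 := not_le.1 (show ¬ (ε / 3 ≤ _) from hcon'.2)
    refine absurd (show ε ≤ _ from hωε) (not_le.2 ?_)
    set s₁ := ⨆ t, edist ((S₁ n).integral t ω) (canon t (X₁ ω))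
    set s₂ := ⨆ t, edist ((S₂ n).integral t ω) (canon t (X₂ ω))
    have hs₁ : ∀ t, edist ((S₁ n).integral t ω) (canon t (X₁ ω)) ≤ s₁ := le_iSup _
    have hs₂ : ∀ t, edist ((S₂ n).integral t ω) (canon t (X₂ ω)) ≤ s₂ := le_iSup _
    -- The error of the second integral enters twice, at `r` and at `min r t`; hence the division by
    -- three.
    have hbound : ⨆ t, edist ((SimpleIntegrand.ofStep (g n) (hV n)).integral t ω)
        (canon t (X ω)) ≤ s₁ + s₂ + s₂ := by
      refine iSup_le fun r => ?_
      rcases hω with ⟨h1, h2⟩ | ⟨t, htR, h1, h2, h3⟩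
      · rw [integral_ofStep_switch_of_notMem hT (hg₁ n) (hV n) h1 r, h2, add_assoc]
        exact (hs₁ r).trans le_self_add
      · rw [integral_ofStep_switch_of_mem hT (hg₁ n) (hg₂ n) (hV n) htR (hgR n htR) h1 r, h2]
        -- Because the solutions agree up to `t`, the path `X₂` decomposes like the switched
        -- elementary integral: `X₁` up to `t`, followed by increments of `X₂`.
        have e : canon r (X₂ ω) = canon (min r t) (X₁ ω) +
            (canon r (X₂ ω) - canon (min r t) (X₂ ω)) := by
          rw [h3 _ (min_le_right _ _)]
          abel
        rw [e, add_assoc]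
        refine (edist_add_add_le _ _ _ _).trans (add_le_add (hs₁ _) ?_)
        rw [sub_eq_add_neg, sub_eq_add_neg]
        refine (edist_add_add_le _ _ _ _).trans (add_le_add (hs₂ _) ?_)
        rw [edist_neg_neg]
        exact hs₂ _
    calc _ ≤ s₁ + s₂ + s₂ := hbound
      _ < ε / 3 + ε / 3 + ε / 3 := ENNReal.add_lt_add (ENNReal.add_lt_add hc1 hc2) hc2
      _ = ε := ENNReal.add_thirds ε

end

theorem FiniteStoppingTime.countable_range_coe (τ : FiniteStoppingTime d T) :
    (Set.range fun ω => (τ.toFun ω : WithTop (Set.Icc (0 : ℝ) T))).Countable := by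
  rw [show (fun ω => (τ.toFun ω : WithTop (Set.Icc (0 : ℝ) T))) = (↑) ∘ τ.toFun from rfl,
    Set.range_comp]
  exact τ.finite_range.countable.image _

theorem FiniteStoppingTime.setOf_coe_eq (τ : FiniteStoppingTime d T) (t : Set.Icc (0 : ℝ) T) :
    {ω | (τ.toFun ω : WithTop (Set.Icc (0 : ℝ) T)) = t} = {ω | τ.toFun ω = t} :=
  Set.ext fun _ => WithTop.coe_inj

theorem FiniteStoppingTime.measurableSet_eq (τ : FiniteStoppingTime d T) (t : Set.Icc (0 : ℝ) T) :
    MeasurableSet[rawFiltration d T t] {ω | τ.toFun ω = t} := by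
  rw [← τ.setOf_coe_eq t]
  exact τ.isStoppingTime.measurableSet_eq_of_countable_range τ.countable_range_coe t

theorem FiniteStoppingTime.measurableSet_sigma_inter_eq_iff (τ : FiniteStoppingTime d T)
    (Λ : Set (PathSpace d T)) (t : Set.Icc (0 : ℝ) T) :
    MeasurableSet[τ.sigma] (Λ ∩ {ω | τ.toFun ω = t}) ↔
      MeasurableSet[rawFiltration d T t] (Λ ∩ {ω | τ.toFun ω = t}) := by
  rw [← τ.setOf_coe_eq t]
  exact τ.isStoppingTime.measurableSet_inter_eq_iff Λ t

theorem FiniteStoppingTime.measurableSet_inter_eq (τ : FiniteStoppingTime d T)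
    {Λ : Set (PathSpace d T)} (hΛ : MeasurableSet[τ.sigma] Λ) (t : Set.Icc (0 : ℝ) T) :
    MeasurableSet[rawFiltration d T t] (Λ ∩ {ω | τ.toFun ω = t}) := by
  refine (τ.measurableSet_sigma_inter_eq_iff Λ t).1 (MeasurableSet.inter hΛ ?_)
  rw [← τ.setOf_coe_eq t]
  exact τ.isStoppingTime.measurableSet_eq_of_countable_range' τ.countable_range_coe t

theorem FiniteStoppingTime.measurableSet_sigma_of_eq (τ : FiniteStoppingTime d T)
    {t : Set.Icc (0 : ℝ) T} {B : Set (PathSpace d T)}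
    (hB : MeasurableSet[rawFiltration d T t] B) :
    MeasurableSet[τ.sigma] ({ω | τ.toFun ω = t} ∩ B) := by
  rw [Set.inter_comm]
  exact (τ.measurableSet_sigma_inter_eq_iff B t).2 (MeasurableSet.inter hB (τ.measurableSet_eq t))

/-- The set `P_S` is stable under pasting. -/
theorem paste_mem_strongLaws {P₀ : PathMeasure d T} (hP₀ : IsWienerMeasure P₀) (hT : 0 < T)
    {P₁ P₂ : PathMeasure d T} (hP₁ : P₁ ∈ strongLaws P₀) (hP₂ : P₂ ∈ strongLaws P₀)
    (τ : FiniteStoppingTime d T) (hlaw : ∀ A, MeasurableSet[τ.sigma] A → P₁ A = P₂ A)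
    {Λ : Set (PathSpace d T)} (hΛ : MeasurableSet[τ.sigma] Λ) :
    paste P₁ P₂ Λ ∈ strongLaws P₀ := by
  classical
  obtain ⟨α₁, X₁, a1, a2, a3, a4, a5, rfl⟩ := hP₁
  obtain ⟨α₂, X₂, b1, b2, b3, b4, b5, rfl⟩ := hP₂
  have h₁ : IsStrongSolution P₀ α₁ X₁ := ⟨a1, a2, a3, a4, a5⟩
  have h₂ : IsStrongSolution P₀ α₂ X₂ := ⟨b1, b2, b3, b4, b5⟩
  have hR := τ.finite_range
  set R := Set.range τ.toFun
  have hlaw' : ∀ t B, MeasurableSet[rawFiltration d T t] B →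
      P₀.map X₁ ({ω | τ.toFun ω = t} ∩ B) = P₀.map X₂ ({ω | τ.toFun ω = t} ∩ B) :=
    fun t B hB => hlaw _ (τ.measurableSet_sigma_of_eq hB)
  have hag₂ : ∀ᵐ ω ∂P₀, ∀ t ∈ R, τ.toFun (X₂ ω) = t → AgreeUpTo t (X₁ ω) (X₂ ω) :=
    (ae_ball_iff hR.countable).2 fun t _ =>
      h₁.ae_agreeUpTo hP₀ hT h₂ (τ.measurableSet_eq t) (hlaw' t)
  have hag₁ : ∀ᵐ ω ∂P₀, ∀ t ∈ R, τ.toFun (X₁ ω) = t → AgreeUpTo t (X₂ ω) (X₁ ω) :=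
    (ae_ball_iff hR.countable).2 fun t _ =>
      h₂.ae_agreeUpTo hP₀ hT h₁ (τ.measurableSet_eq t) fun B hB => (hlaw' t B hB).symm
  have hΛ' : MeasurableSet[PathSpace.instMeasurableSpace] Λ := τ.sigma_le _ hΛ
  have hΛt : ∀ t, MeasurableSet[rawFiltration d T t] (Λᶜ ∩ {ω | τ.toFun ω = t}) :=
    τ.measurableSet_inter_eq hΛ.compl
  -- The switching event `X₁ ∉ Λ`, `τ (X₁) = t` must be known to the raw filtration of the driver at
  -- time `t`; `E t` is such a version.
  choose E hE hE' using fun t => h₁.exists_measurableSet_ae_eq hP₀ hT (hΛt t)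
  -- The solutions agree up to `τ`, and on `τ = t` membership in `Λ` depends on the path up to `t`
  -- only; hence both solutions make the same decision.
  have hΛiff : ∀ᵐ ω ∂P₀, (X₁ ω ∈ Λᶜ ↔ X₂ ω ∈ Λᶜ) := by
    filter_upwards [hag₁, hag₂] with ω h1 h2
    have e1 := h1 _ ⟨X₁ ω, rfl⟩ rfl
    have e2 := h2 _ ⟨X₂ ω, rfl⟩ rfl
    constructor
    · intro h
      exact ((e1.mem_iff (hΛt _)).2 ⟨h, rfl⟩).1
    · intro h
      exact ((e2.mem_iff (hΛt _)).2 ⟨h, rfl⟩).1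
  let X : PathSpace d T → PathSpace d T := fun ω => if X₁ ω ∈ Λᶜ then X₂ ω else X₁ ω
  have hXm : Measurable X := Measurable.ite (h₁.measurable hΛ'.compl) h₂.measurable h₁.measurable
  have hX : ∀ᵐ ω ∂P₀, ((∀ t ∈ R, ω ∉ E t) ∧ X ω = X₁ ω) ∨
      ∃ t ∈ R, (∀ t' ∈ R, ω ∈ E t' ↔ t' = t) ∧ X ω = X₂ ω ∧ AgreeUpTo t (X₁ ω) (X₂ ω) := by
    filter_upwards [hag₁, (ae_ball_iff hR.countable).2 fun t _ => hE' t] with ω h1 h2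
    by_cases h : X₁ ω ∈ Λᶜ
    · refine Or.inr ⟨τ.toFun (X₁ ω), ⟨X₁ ω, rfl⟩, fun t' ht' => ?_, if_pos h, fun s hs =>
        (h1 _ ⟨X₁ ω, rfl⟩ rfl s hs).symm⟩
      rw [h2 t' ht']
      exact ⟨fun h' => h'.2.symm, fun h' => ⟨h, h'.symm⟩⟩
    · exact Or.inl ⟨fun t ht hm => h ((h2 t ht).1 hm).1, if_neg h⟩
  have hsol := h₁.switch hT h₂ (fun t _ => hE t) hR hXm hX
  refine ⟨_, X, hsol.progressive, hsol.posDef, hsol.finite, hsol.measurable,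
    hsol.isItoIntegral, ?_⟩
  refine Measure.ext fun C hC => ?_
  rw [paste_apply _ _ hC, Measure.map_apply h₁.measurable (hC.inter hΛ'),
    Measure.map_apply h₂.measurable (hC.inter hΛ'.compl), Measure.map_apply hXm hC,
    -- Split according to `X₁ ∈ Λ`: there `X = X₁`, and on the complement `X = X₂`, which almost
    -- surely also lies outside `Λ`.
    ← measure_inter_add_sdiff (X ⁻¹' C) (h₁.measurable hΛ')]
  congr 1
  · congr 1
    ext ω
    by_cases h : X₁ ω ∈ Λ
    · simp [X, h]
    · simp [h]
  · refine measure_congr ?_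
    filter_upwards [hΛiff] with ω h
    refine propext ?_
    by_cases h' : X₁ ω ∈ Λᶜ
    · have hX2 : X ω = X₂ ω := if_pos h'
      constructor
      · intro hm
        exact ⟨show X ω ∈ C by rw [hX2]; exact hm.1, h'⟩
      · intro hm
        have hXC : X ω ∈ C := hm.1
        rw [hX2] at hXC
        exact ⟨hXC, h.1 h'⟩
    · exact ⟨fun hm => absurd (h.2 hm.2) h', fun hm => absurd hm.2 h'⟩

end

end StrongVolatility

end

theorem mainTheorem9 (d : ℕ) (T : ℝ) (hT : 0 < T)
    (P₀ : StrongVolatility.PathMeasure d T)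
    (hP₀ : StrongVolatility.IsWienerMeasure P₀)
    (Ps : Set (StrongVolatility.PathMeasure d T)) (hPs : Ps.Nonempty)
    (hPsS : Ps ⊆ StrongVolatility.strongLaws P₀)
    (H : Set (StrongVolatility.PathSpace d T → ℝ)) (hH : H.Nonempty)
    (hHL : H ⊆ StrongVolatility.quasiSureL1 Ps) :
    (StrongVolatility.IsStableUnderPasting Ps →
      StrongVolatility.IsTimeConsistentOn Ps (StrongVolatility.quasiSureL1 Ps)) ∧
    (StrongVolatility.IsTimeConsistentOn Ps H ∧ StrongVolatility.IsMaximallyChosen P₀ Ps H →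
      StrongVolatility.IsStableUnderPasting Ps) := by
  have hprob : ∀ P ∈ Ps, IsProbabilityMeasure P := fun P hP =>
    StrongVolatility.isProbabilityMeasure_of_mem_strongLaws hP₀ (hPsS hP)
  exact ⟨StrongVolatility.isTimeConsistentOn_of_isStableUnderPasting hprob, fun ⟨htc, hmax⟩ =>
    StrongVolatility.isStableUnderPasting_of_isTimeConsistentOn hT hprob hPsS hHL htc hmax
      fun _ h₁ _ h₂ τ hlaw _ hΛ => StrongVolatility.paste_mem_strongLaws hP₀ hT h₁ h₂ τ hlaw hΛ⟩
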